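/- **Setting.** Let $d\ge 1$, let $\mathbb{B}^d$ be the open unit ball of $\mathbb{C}^d$, let $\nu$ be Lebesgue measure on $\mathbb{B}^d$ normalised by $\nu(\mathbb{B}^d)=1$, write $\langle z,\zeta\rangle=z\bar\zeta=\sum_i z_i\overline{\zeta_i}$, and let $$Pf(z)=\int_{\mathbb{B}^d}\frac{f(\zeta)}{(1-z\bar\zeta)^{d+1}}\,d\nu(\zeta)$$ be the Bergman projection. A *weight* is a real-valued (a.e.) positive function in $L^1_{\rm loc}(\mathbb{B}^d)$. *Bergman trees.* Let $\varphi_z$ be the biholomorphic involution of $\mathbb{B}^d$ exchanging $z$ and $0$, let $\beta(z,\zeta)=\frac12\log\frac{1+|\varphi_z(\zeta)|}{1-|\varphi_z(\zeta)|}$ be the Bergman metric, $B(z,r)$ its open balls, $\mathbb{S}_r=\{\beta(0,\cdot)=r\}$, and $\pi_r$ the radial projection onto $\mathbb{S}_r$. Let $R,\delta>0$. A *Bergman tree* with parameters $R,\delta$ is given by, for each $n\ge 0$, finitely many points $z^n_j\in\mathbb{S}_{nR}$ and a Borel partition $\{\Omega^n_j\}_j$ of $\mathbb{S}_{nR}$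 with $B(z^n_j,\delta)\cap\mathbb{S}_{nR}\subseteq\Omega^n_j\subseteq B(z^n_j,c\,\delta)\cap\mathbb{S}_{nR}$, where $c$ does not depend on $n,j$. Its kubes are $K^n_j=\{\zeta\in B(0,(n+1)R)\setminus B(0,nR):\pi_{nR}(\zeta)\in\Omega^n_j\}$, with centres $c^n_j=\pi_{(n+1/2)R}(z^n_j)$; $c^{n+1}_i$ is a child of $c^n_k$ if $\pi_{nR}(c^{n+1}_i)\in\Omega^n_k$. The dyadic tent $\hat K^n_j$ is the union of $K^n_j$ and of all kubes whose centres are descendants of $c^n_j$. *Admissible collections.* For $z\in\mathbb{B}^d\setminus\{0\}$ let $T_z=\{\zeta\in\mathbb{B}^d:|1-\langle\zeta,z/|z|\rangle|\le 1-|z|\}$ be the Carleson tent, and let $T_0=\mathbb{B}^d$. A finite collection of Bergman trees with common parameters $R,\delta$, with $\mathcal{T}$ the set of all their dyadic tents, is *admissible* if there is $A<\infty$ such that each $T_z$ is contained in some $\hat K\in\mathcal{T}$ with $\nu(\hat K)\le A\,\nu(T_z)$. *Characteristics.* For weights $w,\sigma$, with suprema over $\mathcal{T}$, $$[w,\sigma]_{B_2}=\sup_{\hat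 K\in\mathcal{T}}\frac{1}{\nu(\hat K)}\int_{\hat K}w\,d\nu\cdot\frac{1}{\nu(\hat K)}\int_{\hat K}\sigma\,d\nu,\qquad Mf=\sup_{\hat K\in\mathcal{T}}\Big(\frac{1}{\nu(\hat K)}\int_{\hat K}|f|\,d\nu\Big)\mathbf 1_{\hat K},$$ $$[\sigma]_{B_\infty}=\sup_{\hat K\in\mathcal{T}}\frac{1}{\sigma(\hat K)}\int_{\hat K}M(\sigma\mathbf 1_{\hat K})\,d\nu,\qquad \sigma(\hat K)=\int_{\hat K}\sigma\,d\nu,$$ and $\sigma\in B_\infty$ means $[\sigma]_{B_\infty}<\infty$. **Theorem.** Admissible finite collections of Bergman trees exist (for some $R,\delta>0$). For every admissible finite collection of Bergman trees there is a constant $C>0$ such that for all weights $\sigma,w\in B_\infty$ on $\mathbb{B}^d$ with $[w,\sigma]_{B_2}<\infty$ the following holds: for every $f\in L^2(\sigma)=L^2(\sigma\,d\nu)$ the integral defining $P(\sigma f)(z)$ converges absolutely for every $z\in\mathbb{B}^d$, the map $f\mapsto P(\sigma f)$ is a bounded linear operator from $L^2(\sigma)$ to $L^2(w)=L^2(w\,d\nu)$,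 and $$\|P(\sigma\,\cdot)\|_{L^2(\sigma)\to L^2(w)}\le C\,[w,\sigma]_{B_2}^{1/2}\big([w]_{B_\infty}^{1/2}+[\sigma]_{B_\infty}^{1/2}\big).$$ The constant $C$ does not depend on $\sigma$ and $w$. -/

import Mathlib

open MeasureTheory
open scoped ENNReal NNReal

noncomputable section

namespace BergmanBall

/-- The complex Euclidean space `ℂ^d`. -/
abbrev Cd (d : ℕ) : Type := EuclideanSpace ℂ (Fin d)

/-- The open unit ball of `ℂ^d`. -/
def unitBall (d : ℕ) : Set (Cd d) := Metric.ball 0 1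

/-- The Hermitian product `∑ i, z i * conj (ζ i)`, linear in the first variable
(Mathlib's `inner` is conjugate-linear in its first variable). -/
def herm {d : ℕ} (z ζ : Cd d) : ℂ := inner ℂ ζ z

/-- Lebesgue measure on the unit ball, normalised to total mass one. -/
def nu (d : ℕ) : Measure (Cd d) :=
  (volume (unitBall d))⁻¹ • volume.restrict (unitBall d)

/-! ### The Bergman projection -/

/-- The integrand of the Bergman projection at the point `z`. -/
def bergmanIntegrand {d : ℕ} (f : Cd d → ℂ) (z ζ : Cd d) : ℂ :=
  f ζ / (1 - herm z ζ) ^ (d + 1)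

/-- The Bergman projection `P f (z) = ∫ f(ζ) (1 - z ζ̄)^{-(d+1)} dν(ζ)`. -/
def bergmanP {d : ℕ} (f : Cd d → ℂ) (z : Cd d) : ℂ :=
  ∫ ζ, bergmanIntegrand f z ζ ∂(nu d)

/-! ### Bergman metric -/

/-- The unit vector `z / |z|` (zero at `z = 0`). -/
def unitVec {d : ℕ} (z : Cd d) : Cd d := ((‖z‖ : ℂ)⁻¹) • z

/-- The biholomorphic involution of the ball exchanging `z` and the origin. -/
def involution {d : ℕ} (z w : Cd d) : Cd d :=
  (1 - herm w z)⁻¹ •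
    (z - herm w (unitVec z) • unitVec z
      - (Real.sqrt (1 - ‖z‖ ^ 2) : ℂ) • (w - herm w (unitVec z) • unitVec z))

/-- The Bergman metric on the ball. -/
def bergmanDist {d : ℕ} (z w : Cd d) : ℝ :=
  1 / 2 * Real.log ((1 + ‖involution z w‖) / (1 - ‖involution z w‖))

/-- Open balls of the Bergman metric. -/
def bBall {d : ℕ} (z : Cd d) (r : ℝ) : Set (Cd d) :=
  {ζ | ζ ∈ unitBall d ∧ bergmanDist z ζ < r}

/-- Spheres of the Bergman metric centred at the origin. -/
def bSphere (d : ℕ) (r : ℝ) : Set (Cd d) :=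
  {ζ | ζ ∈ unitBall d ∧ bergmanDist 0 ζ = r}

/-- The radial projection onto the Bergman sphere of radius `r` about the origin, which has
Euclidean radius `tanh r`. -/
def radialProj {d : ℕ} (r : ℝ) (ζ : Cd d) : Cd d := (Real.tanh r : ℂ) • unitVec ζ

/-! ### Bergman trees, kubes and dyadic tents -/

/-- The data from which a Bergman tree with parameters `R, δ` is built: for each `n`, finitely many
points of the sphere of radius `n R`, and a Borel partition of that sphere into sets which are
comparable to Bergman balls about these points (with a comparability constant `C` not depending
on `n`). -/
structure BergmanTree (d : ℕ) (R δ : ℝ) where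
  J : ℕ → ℕ
  C : ℝ
  pt : (n : ℕ) → Fin (J n) → Cd d
  Om : (n : ℕ) → Fin (J n) → Set (Cd d)
  pt_mem : ∀ (n : ℕ) (j : Fin (J n)), pt n j ∈ bSphere d (n * R)
  measurable_Om : ∀ (n : ℕ) (j : Fin (J n)), MeasurableSet (Om n j)
  disjoint_Om : ∀ (n : ℕ) (i j : Fin (J n)), i ≠ j → Disjoint (Om n i) (Om n j)
  iUnion_Om : ∀ n : ℕ, ⋃ j, Om n j = bSphere d (n * R)
  ball_subset : ∀ (n : ℕ) (j : Fin (J n)), bBall (pt n j) δ ∩ bSphere d (n * R) ⊆ Om n j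
  subset_ball : ∀ (n : ℕ) (j : Fin (J n)), Om n j ⊆ bBall (pt n j) (C * δ) ∩ bSphere d (n * R)

namespace BergmanTree

variable {d : ℕ} {R δ : ℝ}

/-- The vertices `(n, j)` of the tree; they index the kubes and their centres. -/
def Vertex (T : BergmanTree d R δ) : Type := Σ n : ℕ, Fin (T.J n)

/-- The kube with index `α = (n, j)`; for `n = 0` it is the Bergman ball `B(0, R)`. -/
def kube (T : BergmanTree d R δ) (α : T.Vertex) : Set (Cd d) :=
  {ζ | ζ ∈ bBall (0 : Cd d) ((α.1 + 1) * R) \ bBall (0 : Cd d) (α.1 * R) ∧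
    radialProj (α.1 * R) ζ ∈ T.Om α.1 α.2}

/-- The centre of the kube with index `α = (n, j)`. -/
def center (T : BergmanTree d R δ) (α : T.Vertex) : Cd d :=
  radialProj ((α.1 + 1 / 2) * R) (T.pt α.1 α.2)

/-- `T.IsChild α β`: the vertex `β` is a child of the vertex `α`. -/
def IsChild (T : BergmanTree d R δ) (α β : T.Vertex) : Prop :=
  β.1 = α.1 + 1 ∧ radialProj (α.1 * R) (T.center β) ∈ T.Om α.1 α.2

/-- `T.IsDescendant α β`: `β` is a descendant of `α` (each vertex is a descendant of itself). -/
def IsDescendant (T : BergmanTree d R δ) : T.Vertex → T.Vertex → Prop :=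
  Relation.ReflTransGen T.IsChild

/-- The dyadic tent over `α`: the union of all kubes whose index is a descendant of `α`. -/
def tent (T : BergmanTree d R δ) (α : T.Vertex) : Set (Cd d) :=
  ⋃ β ∈ {β | T.IsDescendant α β}, T.kube β

end BergmanTree

/-- The collection of all dyadic tents of a finite collection of Bergman trees. -/
def tents {d N : ℕ} {R δ : ℝ} (T : Fin N → BergmanTree d R δ) : Set (Set (Cd d)) :=
  {K | ∃ ℓ, ∃ α : (T ℓ).Vertex, K = (T ℓ).tent α}

open Classical in
/-- The Carleson tent at `z`; it is the whole ball for `z = 0`. -/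
def carlesonTent {d : ℕ} (z : Cd d) : Set (Cd d) :=
  if z = 0 then unitBall d
  else {ζ | ζ ∈ unitBall d ∧ ‖1 - herm ζ (unitVec z)‖ ≤ 1 - ‖z‖}

/-- A finite collection of Bergman trees is admissible if every Carleson tent is contained in
a dyadic tent of comparable volume. -/
def Admissible {d N : ℕ} {R δ : ℝ} (T : Fin N → BergmanTree d R δ) : Prop :=
  ∃ A : ℝ≥0, ∀ z ∈ unitBall d, ∃ K ∈ tents T,
    carlesonTent z ⊆ K ∧ nu d K ≤ A * nu d (carlesonTent z)

/-! ### Weights and their characteristics -/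

/-- A weight on the ball: a locally integrable function, positive almost everywhere. -/
def IsWeight {d : ℕ} (w : Cd d → ℝ) : Prop :=
  LocallyIntegrableOn w (unitBall d) (nu d) ∧ ∀ᵐ z ∂(nu d), 0 < w z

/-- The measure `w dν`. -/
def weightMeasure {d : ℕ} (w : Cd d → ℝ) : Measure (Cd d) :=
  (nu d).withDensity (fun z => ENNReal.ofReal (w z))

/-- The joint `B_p` characteristic `[w, σ]_{B_p}` with respect to a collection `𝒯` of sets. -/
def jointBp {d : ℕ} (𝒯 : Set (Set (Cd d))) (p : ℝ) (w σ : Cd d → ℝ) : ℝ≥0∞ :=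
  ⨆ K ∈ 𝒯, ((∫⁻ z in K, ENNReal.ofReal (w z) ∂(nu d)) / nu d K) *
    ((∫⁻ z in K, ENNReal.ofReal (σ z) ∂(nu d)) / nu d K) ^ (p - 1)

/-- The maximal operator `M` over a collection `𝒯` of sets. -/
def maximalFn {d : ℕ} (𝒯 : Set (Set (Cd d))) (f : Cd d → ℝ) (z : Cd d) : ℝ≥0∞ :=
  ⨆ K ∈ 𝒯, K.indicator (fun _ => (∫⁻ ζ in K, ‖f ζ‖ₑ ∂(nu d)) / nu d K) z

/-- The `B_∞` characteristic `[σ]_{B_∞}` with respect to a collection `𝒯` of sets. -/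
def charBinf {d : ℕ} (𝒯 : Set (Set (Cd d))) (σ : Cd d → ℝ) : ℝ≥0∞ :=
  ⨆ K ∈ 𝒯, (∫⁻ z in K, maximalFn 𝒯 (K.indicator σ) z ∂(nu d)) /
    (∫⁻ z in K, ENNReal.ofReal (σ z) ∂(nu d))

end BergmanBall

end

/-!
The proof replaces the Bergman projection by positive dyadic operators and proves a two-weight
inequality for these.

**Domination.** With `ρ(z, ζ) = |1 - z ζ̄|^{1/2}` (`rho`), which satisfies the triangle inequality
on the closed ball, the sets `{ζ | |1 - ζ ū| ≤ h}` (`region u h`) have measure comparable to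
`h^{d+1}`. Any two points `z, ζ` lie in a Carleson tent of height comparable to `|1 - z ζ̄|`, hence,
for an admissible collection, in a dyadic tent `K̂` with `|1 - z ζ̄|^{-(d+1)} ≤ C / ν(K̂)`
(`BergmanTree.exists_kernel_le`). So `|P(σ f)|` is at most a constant times the sum over the trees
of `∑_K̂ (1/ν(K̂)) ∫_K̂ |f| σ dν · 1_K̂` (`BergmanTree.dyadicOp`).

**Geometry of the trees.** Kubes and tents of generation `n` have measure comparable to
`e^{-2nR(d+1)}` (`BergmanTree.exists_nu_kube_tent_bounds`): a kube contains, and a tent is contained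
in, a nonisotropic ball of that size. For tents this holds since the distances between the centres
along a branch form a geometric series. As the kubes are disjoint and `ν(K̂) ≤ C ν(K)`, the
definition of `B_∞` gives the Carleson condition `∑_{K̂' ⊆ K̂} σ(K̂') ≤ C [σ]_{B_∞} σ(K̂)`
(`BergmanTree.sum_weightMeasure_tent_le`).

**The two-weight inequality.** Under the Carleson conditions for both measures and the joint `B_2`
condition, the dyadic operator is bounded by testing: its value on an indicator function is
controlled by expanding the square along branches (`testing_le`). The passage from testing to all
functions puts a tent into one of two parts according to whether `⟨f⟩² σ(K̂)` or `⟨g⟩² w(K̂)` is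
larger, where `⟨f⟩` and `⟨g⟩` are the averages with respect to `σ dν` and `w dν`, and runs a
stopping-time argument for the averages of the dominating function, with the Carleson embedding
along the stopping family (`sum_le_of_dominated`, `sum_sq_dyadic_le`). This is done with finite sums
over a finite forest; every finite set of tents is such a forest once the ball is cut into the cells
of points having the same smallest tent (`BergmanTree.lintegral_dyadicOp_sq_le`).

**Existence.** For `R = 3`, `δ = 1` and each generation `n ≥ 1`, take a maximal `5e^{-3n}`-separated
set of unit vectors. By comparison of volumes (`exists_card_le`) it splits into boundedly many
`20e^{-3n}`-separated colour classes, and there is one tree per colour, built from Voronoi cells of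
a maximal separated set extending the class (`BergmanTree.exists_dir_eq`). A Carleson tent of height
about `e^{-6n}` has its axis near a centre of one of these trees, and the branch of every kube which
it meets passes, at generation `n + 1`, so near this centre that the kube lies in the tent
(`BergmanTree.region_subset_tent`).
-/

noncomputable section

namespace BergmanBall

section

/-! ### The nonisotropic distance -/

section Triangle

variable {E : Type*} [NormedAddCommGroup E] [InnerProductSpace ℂ E]

theorem norm_sub_smul_inner_sq_le {a c : E} (ha : ‖a‖ ≤ 1) (hc : ‖c‖ = 1) :
    ‖a - inner ℂ c a • c‖ ^ 2 ≤ 2 * ‖1 - inner ℂ c a‖ := by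
  have h1 : ‖a - inner ℂ c a • c‖ ^ 2 = ‖a‖ ^ 2 - ‖inner ℂ c a‖ ^ 2 := by
    have h := @norm_sub_sq ℂ E _ _ _ a (inner ℂ c a • c)
    rw [inner_smul_right, norm_smul, hc, mul_one, ← inner_conj_symm a c, RCLike.mul_conj] at h
    have h2 : RCLike.re ((‖inner ℂ c a‖ : ℂ) ^ 2) = ‖inner ℂ c a‖ ^ 2 := by
      rw [← Complex.ofReal_pow]; exact Complex.ofReal_re _
    have h3 : RCLike.re (((‖inner ℂ c a‖ : ℝ) : ℂ) ^ 2) = ‖inner ℂ c a‖ ^ 2 := h2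
    rw [h]
    erw [h3]
    ring
  have h4 : ‖inner ℂ c a‖ ≤ 1 := by
    refine (norm_inner_le_norm c a).trans ?_
    rw [hc, one_mul]; exact ha
  have h5 : 1 - ‖inner ℂ c a‖ ≤ ‖1 - inner ℂ c a‖ := by
    have := norm_sub_norm_le (1 : ℂ) (inner ℂ c a)
    simpa using this
  rw [h1]
  have := norm_nonneg a
  have := norm_nonneg (inner ℂ c a : ℂ)
  nlinarith

theorem sqrt_norm_one_sub_inner_le_of_norm_eq_one {a b c : E} (ha : ‖a‖ ≤ 1) (hb : ‖b‖ ≤ 1)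
    (hc : ‖c‖ = 1) :
    √‖1 - inner ℂ b a‖ ≤ √‖1 - inner ℂ c a‖ + √‖1 - inner ℂ b c‖ := by
  have hA := norm_sub_smul_inner_sq_le ha hc
  have hB := norm_sub_smul_inner_sq_le hb hc
  set x := inner ℂ c a with hx
  have hy : ‖1 - inner ℂ c b‖ = ‖1 - inner ℂ b c‖ := by
    rw [← inner_conj_symm c b, ← Complex.norm_conj (1 - inner ℂ b c)]; simp
  rw [hy] at hB
  have hdec : inner ℂ b a = inner ℂ b c * x + inner ℂ (b - inner ℂ c b • c) (a - x • c) := by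
    have hcc : inner ℂ c c = 1 := by rw [inner_self_eq_norm_sq_to_K, hc]; norm_num
    simp only [inner_sub_left, inner_sub_right, inner_smul_left, inner_smul_right,
      inner_conj_symm, hcc, ← hx]
    ring
  have hx1 : ‖x‖ ≤ 1 := by
    refine (norm_inner_le_norm c a).trans ?_
    rw [hc, one_mul]; exact ha
  set p := √‖1 - x‖
  set q := √‖1 - inner ℂ b c‖
  have hp : p ^ 2 = ‖1 - x‖ := Real.sq_sqrt (norm_nonneg _)
  have hq : q ^ 2 = ‖1 - inner ℂ b c‖ := Real.sq_sqrt (norm_nonneg _)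
  have hp0 : 0 ≤ p := Real.sqrt_nonneg _
  have hq0 : 0 ≤ q := Real.sqrt_nonneg _
  have h2 : ‖inner ℂ (b - inner ℂ c b • c) (a - x • c)‖ ≤ 2 * (p * q) := by
    refine (norm_inner_le_norm _ _).trans ?_
    refine abs_le_of_sq_le_sq' ?_ (by positivity) |>.2
    rw [mul_pow]
    calc _ ≤ (2 * ‖1 - inner ℂ b c‖) * (2 * ‖1 - x‖) := by gcongr
      _ = _ := by rw [← hp, ← hq]; ring
  apply Real.sqrt_le_iff.2 ⟨by positivity, ?_⟩
  have h1 : (1 : ℂ) - inner ℂ b a = (1 - x) + x * (1 - inner ℂ b c)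
      - inner ℂ (b - inner ℂ c b • c) (a - x • c) := by rw [hdec]; ring
  rw [h1]
  calc _ ≤ ‖1 - x‖ + ‖x‖ * ‖1 - inner ℂ b c‖ + ‖inner ℂ (b - inner ℂ c b • c) (a - x • c)‖ := by
        refine (norm_sub_le _ _).trans ?_
        gcongr
        refine (norm_add_le _ _).trans ?_
        rw [norm_mul]
    _ ≤ p ^ 2 + 1 * q ^ 2 + 2 * (p * q) := by rw [hp, hq]; gcongr
    _ = _ := by ring

/-- The triangle inequality for `|1 - ⟨a, b⟩|^{1/2}` on the closed unit ball. A middle point inside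
the ball becomes a unit vector after adding one dimension. -/
theorem sqrt_norm_one_sub_inner_le {a b c : E} (ha : ‖a‖ ≤ 1) (hb : ‖b‖ ≤ 1) (hc : ‖c‖ ≤ 1) :
    √‖1 - inner ℂ b a‖ ≤ √‖1 - inner ℂ c a‖ + √‖1 - inner ℂ b c‖ := by
  have hc' : 0 ≤ 1 - ‖c‖ ^ 2 := by nlinarith [norm_nonneg c]
  have h := sqrt_norm_one_sub_inner_le_of_norm_eq_one (E := WithLp 2 (E × ℂ))
    (a := WithLp.toLp 2 (a, 0)) (b := WithLp.toLp 2 (b, 0))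
    (c := WithLp.toLp 2 (c, ((√(1 - ‖c‖ ^ 2) : ℝ) : ℂ))) ?_ ?_ ?_
  · simpa [WithLp.prod_inner_apply] using h
  · simpa [WithLp.prod_norm_eq_of_L2] using ha
  · simpa [WithLp.prod_norm_eq_of_L2] using hb
  · rw [WithLp.prod_norm_eq_of_L2]
    simp [abs_of_nonneg (Real.sqrt_nonneg _), Real.sq_sqrt hc']

end Triangle

theorem herm_smul_left {d : ℕ} (c : ℂ) (z w : Cd d) : herm (c • z) w = c * herm z w := by
  simp [herm]

theorem herm_smul_right {d : ℕ} (c : ℂ) (z w : Cd d) :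
    herm z (c • w) = (starRingEnd ℂ) c * herm z w := by
  simp [herm, mul_comm]

theorem herm_add_left {d : ℕ} (z z' w : Cd d) : herm (z + z') w = herm z w + herm z' w := by
  simp [herm]

theorem herm_sub_left {d : ℕ} (z z' w : Cd d) : herm (z - z') w = herm z w - herm z' w := by
  simp [herm]

theorem norm_herm_le {d : ℕ} (z w : Cd d) : ‖herm z w‖ ≤ ‖z‖ * ‖w‖ := by
  rw [mul_comm]; exact norm_inner_le_norm w z

theorem herm_self {d : ℕ} (z : Cd d) : herm z z = (‖z‖ : ℂ) ^ 2 := inner_self_eq_norm_sq_to_K z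

theorem herm_self_of_norm {d : ℕ} {z : Cd d} (hz : ‖z‖ = 1) : herm z z = 1 := by
  rw [herm_self, hz]; simp

theorem continuous_herm_left {d : ℕ} (w : Cd d) : Continuous fun z => herm z w :=
  continuous_const.inner continuous_id

/-- The nonisotropic distance `|1 - ⟨z, w⟩|^{1/2}`: it satisfies the triangle inequality on the
closed ball and is a metric on the unit sphere. -/
def rho {d : ℕ} (z w : Cd d) : ℝ := √‖1 - herm z w‖

theorem rho_nonneg {d : ℕ} (z w : Cd d) : 0 ≤ rho z w := Real.sqrt_nonneg _

theorem rho_sq {d : ℕ} (z w : Cd d) : rho z w ^ 2 = ‖1 - herm z w‖ :=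
  Real.sq_sqrt (norm_nonneg _)

theorem norm_one_sub_herm_comm {d : ℕ} (z w : Cd d) : ‖1 - herm z w‖ = ‖1 - herm w z‖ := by
  rw [← Complex.norm_conj (1 - herm z w)]
  simp [herm, inner_conj_symm]

theorem rho_comm {d : ℕ} (z w : Cd d) : rho z w = rho w z := by
  rw [rho, rho, norm_one_sub_herm_comm]

theorem rho_self {d : ℕ} {z : Cd d} (hz : ‖z‖ = 1) : rho z z = 0 := by
  simp [rho, herm_self_of_norm hz]

theorem rho_triangle {d : ℕ} {a b c : Cd d} (ha : ‖a‖ ≤ 1) (hb : ‖b‖ ≤ 1) (hc : ‖c‖ ≤ 1) :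
    rho a b ≤ rho a c + rho c b :=
  sqrt_norm_one_sub_inner_le ha hb hc

theorem continuous_rho_left {d : ℕ} (w : Cd d) : Continuous fun z => rho z w :=
  ((continuous_const.sub (continuous_herm_left w)).norm).sqrt

theorem rho_le_two {d : ℕ} {a b : Cd d} (ha : ‖a‖ ≤ 1) (hb : ‖b‖ ≤ 1) : rho a b ≤ 2 := by
  apply Real.sqrt_le_iff.2 ⟨by norm_num, ?_⟩
  have := norm_sub_le (1 : ℂ) (herm a b)
  have h2 := norm_herm_le a b
  have : ‖a‖ * ‖b‖ ≤ 1 := by nlinarith [norm_nonneg a, norm_nonneg b]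
  norm_num at *
  linarith

/-! ### Volumes of nonisotropic regions -/

/-- The complex linear map which multiplies the unit vector `u` by `h` and its orthogonal complement
by `√h`. -/
def aniso {d : ℕ} (u : Cd d) (h : ℝ) : Cd d →ₗ[ℂ] Cd d :=
  ((√h : ℝ) : ℂ) • LinearMap.transvection (innerₛₗ ℂ u) (((√h - 1 : ℝ) : ℂ) • u)

theorem aniso_apply {d : ℕ} (u : Cd d) (h : ℝ) (x : Cd d) :
    aniso u h x = ((√h : ℝ) : ℂ) • (x + herm x u • ((√h - 1 : ℝ) : ℂ) • u) := by
  simp [aniso, LinearMap.transvection, herm]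

theorem det_aniso {d : ℕ} {u : Cd d} (hu : ‖u‖ = 1) (h : ℝ) :
    LinearMap.det (aniso u h) = ((√h ^ (d + 1) : ℝ) : ℂ) := by
  rw [aniso, LinearMap.det_smul, LinearMap.transvection.det]
  have : innerₛₗ ℂ u (((√h - 1 : ℝ) : ℂ) • u) = ((√h - 1 : ℝ) : ℂ) := by
    rw [map_smul]
    have := herm_self_of_norm hu
    simp only [herm] at this
    simp [hu]
  rw [this]
  simp [pow_succ]

theorem volume_image_aniso {d : ℕ} {u : Cd d} (hu : ‖u‖ = 1) {h : ℝ} (hh : 0 ≤ h)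
    (s : Set (Cd d)) :
    volume ((fun x => u + aniso u h x) '' s) = ENNReal.ofReal (h ^ (d + 1)) * volume s := by
  have h1 : (fun x => u + aniso u h x) '' s
      = (fun x => u + x) '' (((aniso u h).restrictScalars ℝ) '' s) := by
    rw [Set.image_image]; rfl
  rw [h1, Set.image_add_left, measure_preimage_add, Measure.addHaar_image_linearMap,
    LinearMap.det_restrictScalars, Algebra.norm_complex_apply, det_aniso hu,
    Complex.normSq_ofReal, ← mul_pow, Real.mul_self_sqrt hh, abs_of_nonneg (by positivity)]

end

theorem aniso_smul_add {d : ℕ} {u v : Cd d} (hu : ‖u‖ = 1) (hv : herm v u = 0) {h : ℝ}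
    (hh : 0 ≤ h) (c : ℂ) :
    aniso u h (c • u + v) = ((h : ℂ) * c) • u + ((√h : ℝ) : ℂ) • v := by
  have h1 : herm (c • u + v) u = c := by
    rw [herm_add_left, herm_smul_left, herm_self_of_norm hu, hv]; simp
  rw [aniso_apply, h1]
  have h2 : (h : ℂ) = ((√h : ℝ) : ℂ) * ((√h : ℝ) : ℂ) := by
    rw [← Complex.ofReal_mul, Real.mul_self_sqrt hh]
  rw [h2]
  push_cast
  module

theorem norm_sq_smul_add {d : ℕ} {u v : Cd d} (hu : ‖u‖ = 1) (hv : herm v u = 0) (c : ℂ) :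
    ‖c • u + v‖ ^ 2 = ‖c‖ ^ 2 + ‖v‖ ^ 2 := by
  have h : inner ℂ (c • u) v = 0 := by
    rw [inner_smul_left]; simp only [herm] at hv; rw [hv, mul_zero]
  have := norm_add_sq_eq_norm_sq_add_norm_sq_of_inner_eq_zero (c • u) v h
  rw [sq, this, norm_smul, hu]; ring

theorem herm_sub_herm_smul {d : ℕ} {u : Cd d} (hu : ‖u‖ = 1) (x : Cd d) :
    herm (x - herm x u • u) u = 0 := by
  rw [herm_sub_left, herm_smul_left, herm_self_of_norm hu]; simp

/-- The points `z` of the ball with `|1 - ⟨z, u⟩| ≤ h`; for unit vectors `u` these are the Carleson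
tents of size `h`. -/
def region {d : ℕ} (u : Cd d) (h : ℝ) : Set (Cd d) :=
  {ζ | ζ ∈ unitBall d ∧ ‖1 - herm ζ u‖ ≤ h}

theorem mem_unitBall {d : ℕ} {z : Cd d} : z ∈ unitBall d ↔ ‖z‖ < 1 := by simp [unitBall]

theorem volume_region_le {d : ℕ} {u : Cd d} (hu : ‖u‖ = 1) {h : ℝ} (hh : 0 < h) :
    volume (region u h) ≤
      ENNReal.ofReal (h ^ (d + 1)) * volume (Metric.closedBall (0 : Cd d) 3) := by
  rw [← volume_image_aniso hu hh.le]
  apply measure_mono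
  rintro ζ ⟨hζ, hζh⟩
  rw [mem_unitBall] at hζ
  set y := herm ζ u with hy
  set v := ζ - y • u with hv
  have hvu : herm v u = 0 := herm_sub_herm_smul hu ζ
  have hs : 0 < √h := Real.sqrt_pos.2 hh
  have hsc : ((√h : ℝ) : ℂ) ≠ 0 := by exact_mod_cast hs.ne'
  have hhc : (h : ℂ) ≠ 0 := by exact_mod_cast hh.ne'
  have hvn : ‖v‖ ^ 2 ≤ 2 * h := (norm_sub_smul_inner_sq_le hζ.le hu).trans (by
    have : ‖1 - inner ℂ u ζ‖ ≤ h := hζh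
    linarith)
  refine ⟨((y - 1) / h) • u + ((√h : ℝ) : ℂ)⁻¹ • v, ?_, ?_⟩
  · have hw : herm (((√h : ℝ) : ℂ)⁻¹ • v) u = 0 := by rw [herm_smul_left, hvu, mul_zero]
    rw [mem_closedBall_zero_iff]
    refine abs_le_of_sq_le_sq' ?_ (by norm_num) |>.2
    rw [norm_sq_smul_add hu hw, norm_smul, norm_div, norm_sub_rev, norm_inv, Complex.norm_real,
      Complex.norm_real, Real.norm_of_nonneg hh.le, Real.norm_of_nonneg hs.le, mul_pow, inv_pow,
      Real.sq_sqrt hh.le]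
    have h1 : ‖1 - y‖ / h ≤ 1 := (div_le_one hh).2 hζh
    have h2 : h⁻¹ * ‖v‖ ^ 2 ≤ 2 := by
      rw [inv_mul_le_iff₀ hh]; linarith
    have h3 : 0 ≤ ‖1 - y‖ / h := by positivity
    nlinarith
  · have hw : herm (((√h : ℝ) : ℂ)⁻¹ • v) u = 0 := by rw [herm_smul_left, hvu, mul_zero]
    simp only []
    rw [aniso_smul_add hu hw hh.le, smul_smul, mul_inv_cancel₀ hsc, mul_div_cancel₀ _ hhc, hv]
    module

/-- A set containing a nonisotropic ball of size `h` has volume at least a multiple of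
`h ^ (d + 1)`. -/
theorem le_volume_of_forall_mem {d : ℕ} {u : Cd d} (hu : ‖u‖ = 1) {h ε b : ℝ} (hh : 0 < h)
    {K : Set (Cd d)}
    (hK : ∀ (c : ℂ) (v : Cd d), ‖c‖ < ε → ‖v‖ < ε → herm v u = 0 →
      ((b : ℂ) + h * c) • u + ((√h : ℝ) : ℂ) • v ∈ K) :
    ENNReal.ofReal (h ^ (d + 1)) * volume (Metric.ball (0 : Cd d) (ε / 2)) ≤ volume K := by
  have hhc : (h : ℂ) ≠ 0 := by exact_mod_cast hh.ne'
  have h0 : volume (Metric.ball (0 : Cd d) (ε / 2))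
      = volume (Metric.ball ((((b - 1) / h : ℝ) : ℂ) • u) (ε / 2)) :=
    (Measure.addHaar_ball_center _ _ _).symm
  rw [h0, ← volume_image_aniso hu hh.le]
  apply measure_mono
  rintro _ ⟨x, hx, rfl⟩
  set e := x - (((b - 1) / h : ℝ) : ℂ) • u with he
  have hen : ‖e‖ < ε / 2 := by rwa [Metric.mem_ball, dist_eq_norm] at hx
  have hc : ‖herm e u‖ ≤ ‖e‖ := by simpa [hu] using norm_herm_le e u
  have hvu := herm_sub_herm_smul hu e
  have hv : ‖e - herm e u • u‖ < ε := by
    refine (norm_sub_le _ _).trans_lt ?_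
    rw [norm_smul, hu, mul_one]; linarith
  have := hK (herm e u) _ (by have := norm_nonneg e; linarith) hv hvu
  convert this using 1
  have hxe : x = ((((b - 1) / h : ℝ) : ℂ) + herm e u) • u + (e - herm e u • u) := by
    rw [he]; module
  have h5 : (h : ℂ) * ((((b - 1) / h : ℝ) : ℂ) + herm e u) = (b : ℂ) - 1 + h * herm e u := by
    push_cast; field_simp
  simp only []
  rw [hxe, aniso_smul_add hu hvu hh.le, h5]
  module

theorem smul_add_mem_region {d : ℕ} {u : Cd d} (hu : ‖u‖ = 1) {h : ℝ} (hh : 0 < h) (h1 : h ≤ 1)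
    {c : ℂ} {v : Cd d} (hc : ‖c‖ < 1 / 8) (hv : ‖v‖ < 1 / 8) (hvu : herm v u = 0) :
    (((1 - h / 2 : ℝ) : ℂ) + h * c) • u + ((√h : ℝ) : ℂ) • v ∈ region u h := by
  have hs : 0 < √h := Real.sqrt_pos.2 hh
  have hw : herm (((√h : ℝ) : ℂ) • v) u = 0 := by rw [herm_smul_left, hvu, mul_zero]
  constructor
  · rw [mem_unitBall]
    refine lt_of_pow_lt_pow_left₀ 2 (by norm_num) ?_
    rw [norm_sq_smul_add hu hw, norm_smul, Complex.norm_real, Real.norm_of_nonneg hs.le, mul_pow,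
      Real.sq_sqrt hh.le]
    have h2 : ‖((1 - h / 2 : ℝ) : ℂ) + h * c‖ ≤ 1 - 3 * h / 8 := by
      refine (norm_add_le _ _).trans ?_
      rw [norm_mul, Complex.norm_real, Complex.norm_real, Real.norm_of_nonneg hh.le,
        Real.norm_of_nonneg (by linarith)]
      nlinarith
    calc _ ≤ (1 - 3 * h / 8) ^ 2 + h * (1 / 8) ^ 2 := by gcongr
      _ < 1 ^ 2 := by nlinarith
  · rw [herm_add_left, herm_smul_left, hw, herm_self_of_norm hu]
    have : (1 : ℂ) - ((((1 - h / 2 : ℝ) : ℂ) + h * c) * 1 + 0) = ((h / 2 : ℝ) : ℂ) - h * c := by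
      push_cast; ring
    rw [this]
    refine (norm_sub_le _ _).trans ?_
    rw [norm_mul, Complex.norm_real, Complex.norm_real, Real.norm_of_nonneg hh.le,
      Real.norm_of_nonneg (by linarith)]
    nlinarith

theorem volume_unitBall_ne_zero (d : ℕ) : volume (unitBall d) ≠ 0 :=
  (Metric.measure_ball_pos _ _ one_pos).ne'

theorem volume_unitBall_ne_top (d : ℕ) : volume (unitBall d) ≠ ∞ := measure_ball_lt_top.ne

theorem nu_apply_of_subset {d : ℕ} {K : Set (Cd d)} (hK : K ⊆ unitBall d) :
    nu d K = (volume (unitBall d))⁻¹ * volume K := by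
  rw [nu, Measure.smul_apply, smul_eq_mul, Measure.restrict_eq_self _ hK]

instance (d : ℕ) : IsProbabilityMeasure (nu d) := by
  constructor
  rw [nu, Measure.smul_apply, smul_eq_mul, Measure.restrict_apply_univ]
  exact ENNReal.inv_mul_cancel (volume_unitBall_ne_zero d) (volume_unitBall_ne_top d)

theorem ae_mem_unitBall (d : ℕ) : ∀ᵐ z ∂(nu d), z ∈ unitBall d :=
  Measure.ae_smul_measure (ae_restrict_mem Metric.isOpen_ball.measurableSet) _

theorem nu_unitBall (d : ℕ) : nu d (unitBall d) = 1 :=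
  (prob_compl_eq_zero_iff Metric.isOpen_ball.measurableSet).1 (ae_mem_unitBall d)

theorem region_subset {d : ℕ} (u : Cd d) (h : ℝ) : region u h ⊆ unitBall d := fun _ hζ => hζ.1

/-- The upper volume bound for regions, normalised. -/
theorem exists_nu_region_le (d : ℕ) : ∃ C : ℝ, 0 < C ∧ ∀ (u : Cd d) (h : ℝ), ‖u‖ = 1 → 0 < h →
    nu d (region u h) ≤ ENNReal.ofReal (C * h ^ (d + 1)) := by
  have hfin : (volume (unitBall d))⁻¹ * volume (Metric.closedBall (0 : Cd d) 3) ≠ ∞ :=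
    ENNReal.mul_ne_top (ENNReal.inv_ne_top.2 (volume_unitBall_ne_zero d))
      measure_closedBall_lt_top.ne
  have hpos : (volume (unitBall d))⁻¹ * volume (Metric.closedBall (0 : Cd d) 3) ≠ 0 :=
    mul_ne_zero (ENNReal.inv_ne_zero.2 (volume_unitBall_ne_top d))
      (Metric.measure_closedBall_pos _ _ (by norm_num)).ne'
  refine ⟨_, ENNReal.toReal_pos hpos hfin, fun u h hu hh => ?_⟩
  rw [nu_apply_of_subset (region_subset u h), ENNReal.ofReal_mul ENNReal.toReal_nonneg,
    ENNReal.ofReal_toReal hfin, mul_assoc, mul_comm (volume (Metric.closedBall _ _))]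
  gcongr
  exact volume_region_le hu hh

/-- The lower volume bound for sets containing a nonisotropic ball, normalised. -/
theorem exists_le_nu_of_forall_mem (d : ℕ) {ε : ℝ} (hε : 0 < ε) :
    ∃ c : ℝ, 0 < c ∧ ∀ (u : Cd d) (h b : ℝ) (K : Set (Cd d)), ‖u‖ = 1 → 0 < h → K ⊆ unitBall d →
    (∀ (c : ℂ) (v : Cd d), ‖c‖ < ε → ‖v‖ < ε → herm v u = 0 →
      ((b : ℂ) + h * c) • u + ((√h : ℝ) : ℂ) • v ∈ K) →
    ENNReal.ofReal (c * h ^ (d + 1)) ≤ nu d K := by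
  have hfin : (volume (unitBall d))⁻¹ * volume (Metric.ball (0 : Cd d) (ε / 2)) ≠ ∞ :=
    ENNReal.mul_ne_top (ENNReal.inv_ne_top.2 (volume_unitBall_ne_zero d)) measure_ball_lt_top.ne
  have hpos : (volume (unitBall d))⁻¹ * volume (Metric.ball (0 : Cd d) (ε / 2)) ≠ 0 :=
    mul_ne_zero (ENNReal.inv_ne_zero.2 (volume_unitBall_ne_top d))
      (Metric.measure_ball_pos _ _ (by linarith)).ne'
  refine ⟨_, ENNReal.toReal_pos hpos hfin, fun u h b K hu hh hK hmem => ?_⟩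
  rw [nu_apply_of_subset hK, ENNReal.ofReal_mul ENNReal.toReal_nonneg,
    ENNReal.ofReal_toReal hfin, mul_assoc, mul_comm (volume (Metric.ball _ _))]
  gcongr
  exact le_volume_of_forall_mem hu hh hmem

theorem exists_le_nu_region (d : ℕ) : ∃ c : ℝ, 0 < c ∧ ∀ (u : Cd d) (h : ℝ), ‖u‖ = 1 → 0 < h →
    h ≤ 1 → ENNReal.ofReal (c * h ^ (d + 1)) ≤ nu d (region u h) := by
  obtain ⟨c, hc, H⟩ := exists_le_nu_of_forall_mem d (ε := 1 / 8) (by norm_num)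
  exact ⟨c, hc, fun u h hu hh h1 => H u h _ _ hu hh (region_subset u h)
    fun _ _ hc hv hvu => smul_add_mem_region hu hh h1 hc hv hvu⟩

theorem norm_unitVec {d : ℕ} {z : Cd d} (hz : z ≠ 0) : ‖unitVec z‖ = 1 := by
  rw [unitVec, norm_smul, norm_inv, Complex.norm_real, norm_norm,
    inv_mul_cancel₀ (norm_ne_zero_iff.2 hz)]

theorem unitVec_zero {d : ℕ} : unitVec (0 : Cd d) = 0 := by simp [unitVec]

theorem norm_smul_unitVec {d : ℕ} (z : Cd d) : (‖z‖ : ℂ) • unitVec z = z := by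
  rcases eq_or_ne z 0 with rfl | hz
  · simp
  · rw [unitVec, smul_smul, mul_inv_cancel₀ (by exact_mod_cast norm_ne_zero_iff.2 hz), one_smul]

theorem unitVec_smul {d : ℕ} {u : Cd d} (hu : ‖u‖ = 1) {r : ℝ} (hr : 0 < r) :
    unitVec ((r : ℂ) • u) = u := by
  have hrc : (r : ℂ) ≠ 0 := by exact_mod_cast hr.ne'
  rw [unitVec, norm_smul, hu, Complex.norm_real, Real.norm_of_nonneg hr.le, mul_one, smul_smul,
    inv_mul_cancel₀ hrc, one_smul]

theorem herm_self_unitVec {d : ℕ} {z : Cd d} (hz : z ≠ 0) : herm z (unitVec z) = ‖z‖ := by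
  have h : (‖z‖ : ℂ) ≠ 0 := by exact_mod_cast norm_ne_zero_iff.2 hz
  rw [unitVec, herm_smul_right, herm_self, map_inv₀, Complex.conj_ofReal]
  field_simp

/-! ### The Bergman metric -/

theorem norm_one_sub_herm_pos {d : ℕ} {z w : Cd d} (hz : ‖z‖ < 1) (hw : ‖w‖ < 1) :
    0 < ‖1 - herm w z‖ := by
  rw [norm_pos_iff, sub_ne_zero]
  intro h
  have h1 := norm_herm_le w z
  rw [← h, norm_one] at h1
  nlinarith [norm_nonneg z, norm_nonneg w]

theorem one_sub_norm_involution_sq {d : ℕ} {z w : Cd d} (hz : ‖z‖ < 1) (hw : ‖w‖ < 1) :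
    1 - ‖involution z w‖ ^ 2 = (1 - ‖z‖ ^ 2) * (1 - ‖w‖ ^ 2) / ‖1 - herm w z‖ ^ 2 := by
  have hpos := norm_one_sub_herm_pos hz hw
  rcases eq_or_ne z 0 with rfl | hz0
  · simp [involution, unitVec_zero, herm]
  have hu := norm_unitVec hz0
  set u := unitVec z with hu_def
  have hzu : z = (‖z‖ : ℂ) • u := (norm_smul_unitVec z).symm
  set r := ‖z‖ with hr
  set x := herm w u with hx
  set v := w - x • u with hv
  have hvu : herm v u = 0 := herm_sub_herm_smul hu w
  have hwz : herm w z = r * x := by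
    rw [hzu, herm_smul_right]; simp [hx]
  have hwn : ‖w‖ ^ 2 = ‖x‖ ^ 2 + ‖v‖ ^ 2 := by
    rw [← norm_sq_smul_add hu hvu]; congr 2; rw [hv]; module
  have hs : 0 ≤ 1 - r ^ 2 := by nlinarith [norm_nonneg z]
  have hnum : ‖z - x • u - (√(1 - r ^ 2) : ℂ) • v‖ ^ 2 =
      ‖(r : ℂ) - x‖ ^ 2 + (1 - r ^ 2) * ‖v‖ ^ 2 := by
    have h1 : z - x • u - (√(1 - r ^ 2) : ℂ) • v
        = ((r : ℂ) - x) • u + (-(√(1 - r ^ 2) : ℂ)) • v := by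
      conv_lhs => rw [hzu]
      module
    rw [h1, norm_sq_smul_add hu (by rw [herm_smul_left, hvu, mul_zero]), norm_smul, norm_neg,
      Complex.norm_real, Real.norm_of_nonneg (Real.sqrt_nonneg _), mul_pow, Real.sq_sqrt hs]
  have hinv : ‖involution z w‖ ^ 2
      = (‖(r : ℂ) - x‖ ^ 2 + (1 - r ^ 2) * ‖v‖ ^ 2) / ‖1 - herm w z‖ ^ 2 := by
    rw [involution, norm_smul, mul_pow, norm_inv, inv_pow, ← hnum, div_eq_inv_mul]
  have hcx : ‖1 - herm w z‖ ^ 2 - ‖(r : ℂ) - x‖ ^ 2 = (1 - r ^ 2) * (1 - ‖x‖ ^ 2) := by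
    rw [hwz]
    simp only [← Complex.normSq_eq_norm_sq, Complex.normSq_apply]
    simp
    ring
  rw [hinv, eq_div_iff (by positivity), sub_mul, div_mul_cancel₀ _ (by positivity), hwn]
  linear_combination hcx

theorem norm_involution_lt_one {d : ℕ} {z w : Cd d} (hz : ‖z‖ < 1) (hw : ‖w‖ < 1) :
    ‖involution z w‖ < 1 := by
  have h := one_sub_norm_involution_sq hz hw
  have h1 : 0 < (1 - ‖z‖ ^ 2) * (1 - ‖w‖ ^ 2) / ‖1 - herm w z‖ ^ 2 := by
    have := norm_one_sub_herm_pos hz hw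
    have h2 : 0 < 1 - ‖z‖ ^ 2 := by nlinarith [norm_nonneg z]
    have h3 : 0 < 1 - ‖w‖ ^ 2 := by nlinarith [norm_nonneg w]
    positivity
  nlinarith [norm_nonneg (involution z w)]

theorem bergmanDist_eq_artanh {d : ℕ} {z w : Cd d} (hz : ‖z‖ < 1) (hw : ‖w‖ < 1) :
    bergmanDist z w = Real.artanh ‖involution z w‖ := by
  have h := norm_involution_lt_one hz hw
  rw [bergmanDist, Real.artanh_eq_half_log ⟨by linarith [norm_nonneg (involution z w)], h.le⟩]

theorem tanh_mem_Ioo (r : ℝ) : Real.tanh r ∈ Set.Ioo (-1 : ℝ) 1 :=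
  ⟨Real.neg_one_lt_tanh r, Real.tanh_lt_one r⟩

theorem bergmanDist_lt_iff {d : ℕ} {z w : Cd d} (hz : ‖z‖ < 1) (hw : ‖w‖ < 1) {r : ℝ} :
    bergmanDist z w < r ↔ ‖involution z w‖ < Real.tanh r := by
  have h := norm_involution_lt_one hz hw
  rw [bergmanDist_eq_artanh hz hw, ← Real.artanh_lt_artanh_iff
    ⟨by linarith [norm_nonneg (involution z w)], h⟩ (tanh_mem_Ioo r), Real.artanh_tanh]

theorem one_sub_tanh_sq (r : ℝ) : 1 - Real.tanh r ^ 2 = (Real.cosh r ^ 2)⁻¹ := by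
  have h := Real.cosh_pos r
  rw [Real.tanh_eq_sinh_div_cosh]
  field_simp
  linarith [Real.cosh_sq r]

/-- Bergman balls in terms of the Hermitian product. -/
theorem bergmanDist_lt_iff_cosh {d : ℕ} {z w : Cd d} (hz : ‖z‖ < 1) (hw : ‖w‖ < 1) {r : ℝ}
    (hr : 0 < r) :
    bergmanDist z w < r ↔
      ‖1 - herm w z‖ ^ 2 < Real.cosh r ^ 2 * ((1 - ‖z‖ ^ 2) * (1 - ‖w‖ ^ 2)) := by
  have hpos := norm_one_sub_herm_pos hz hw
  have ht : 0 < Real.tanh r := by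
    rw [Real.tanh_eq_sinh_div_cosh]; exact div_pos (Real.sinh_pos_iff.2 hr) (Real.cosh_pos r)
  rw [bergmanDist_lt_iff hz hw, ← pow_lt_pow_iff_left₀ (norm_nonneg _) ht.le two_ne_zero,
    ← sub_lt_sub_iff_left 1, one_sub_tanh_sq, one_sub_norm_involution_sq hz hw,
    lt_div_iff₀ (by positivity), inv_mul_lt_iff₀ (pow_pos (Real.cosh_pos r) 2)]

theorem norm_involution_zero {d : ℕ} (w : Cd d) : ‖involution 0 w‖ = ‖w‖ := by
  simp [involution, unitVec_zero, herm]

theorem mem_bBall_zero {d : ℕ} {r : ℝ} {w : Cd d} : w ∈ bBall 0 r ↔ ‖w‖ < Real.tanh r := by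
  simp only [bBall, Set.mem_ofPred_eq, mem_unitBall]
  constructor
  · rintro ⟨h1, h2⟩
    rwa [bergmanDist_lt_iff (by simp) h1, norm_involution_zero] at h2
  · intro h
    have h1 : ‖w‖ < 1 := h.trans (Real.tanh_lt_one r)
    refine ⟨h1, ?_⟩
    rwa [bergmanDist_lt_iff (by simp) h1, norm_involution_zero]

theorem mem_bSphere {d : ℕ} {r : ℝ} {w : Cd d} : w ∈ bSphere d r ↔ ‖w‖ = Real.tanh r := by
  have key : ∀ h : ‖w‖ < 1, bergmanDist 0 w = Real.artanh ‖w‖ := fun h => by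
    rw [bergmanDist_eq_artanh (by simp) h, norm_involution_zero]
  simp only [bSphere, Set.mem_ofPred_eq, mem_unitBall]
  constructor
  · rintro ⟨h1, h2⟩
    rw [← h2, key h1, Real.tanh_artanh ⟨by linarith [norm_nonneg w], h1⟩]
  · intro h
    have h1 : ‖w‖ < 1 := h ▸ Real.tanh_lt_one r
    exact ⟨h1, by rw [key h1, h, Real.artanh_tanh]⟩

section

/-! ### Hyperbolic radii -/

theorem tanh_strictMono : StrictMono Real.tanh := fun x y h => by
  have := (Real.artanh_lt_artanh_iff (tanh_mem_Ioo x) (tanh_mem_Ioo y)).1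
  rw [Real.artanh_tanh, Real.artanh_tanh] at this
  exact this h

theorem tanh_pos {x : ℝ} (hx : 0 < x) : 0 < Real.tanh x := by
  simpa using tanh_strictMono hx

theorem tanh_nonneg {x : ℝ} (hx : 0 ≤ x) : 0 ≤ Real.tanh x := by
  simpa using tanh_strictMono.monotone hx

theorem exp_neg_sq_le_one_sub_tanh_sq (x : ℝ) : Real.exp (-|x|) ^ 2 ≤ 1 - Real.tanh x ^ 2 := by
  rw [one_sub_tanh_sq, Real.exp_neg, inv_pow]
  have h := Real.cosh_pos x
  apply inv_anti₀ (by positivity)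
  gcongr
  rw [← Real.cosh_abs, Real.cosh_eq]
  have : Real.exp (-|x|) ≤ Real.exp |x| := Real.exp_le_exp.2 (by linarith [abs_nonneg x])
  linarith

theorem one_sub_tanh_sq_le (x : ℝ) : 1 - Real.tanh x ^ 2 ≤ 4 * Real.exp (-x) ^ 2 := by
  rw [one_sub_tanh_sq, Real.exp_neg, inv_pow]
  have h := Real.exp_pos x
  have h2 : Real.exp x / 2 ≤ Real.cosh x := by
    rw [Real.cosh_eq]; linarith [Real.exp_pos (-x)]
  calc (Real.cosh x ^ 2)⁻¹ ≤ ((Real.exp x / 2) ^ 2)⁻¹ := by gcongr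
    _ = _ := by field_simp; norm_num

theorem exp_neg_sq_le_one_sub_tanh {x : ℝ} (hx : 0 ≤ x) :
    Real.exp (-x) ^ 2 ≤ 1 - Real.tanh x := by
  rw [Real.tanh_eq, le_sub_iff_add_le, ← le_sub_iff_add_le', div_le_iff₀ (by positivity)]
  have h1 : Real.exp x * Real.exp (-x) = 1 := by rw [← Real.exp_add]; simp
  have h2 : 0 < Real.exp (-x) := Real.exp_pos _
  have h3 : Real.exp (-x) ≤ 1 := Real.exp_le_one_iff.2 (by linarith)
  nlinarith [mul_pos h2 h2]

theorem one_sub_tanh_le (x : ℝ) : 1 - Real.tanh x ≤ 2 * Real.exp (-x) ^ 2 := by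
  rw [Real.tanh_eq, sub_le_iff_le_add, ← sub_le_iff_le_add', le_div_iff₀ (by positivity)]
  have h1 : Real.exp x * Real.exp (-x) = 1 := by rw [← Real.exp_add]; simp
  have h2 : 0 < Real.exp (-x) := Real.exp_pos _
  nlinarith [mul_pos h2 h2, mul_pos (mul_pos h2 h2) h2]

/-- The nonisotropic scale `e^{-nR}` of the kubes of generation `n`. -/
def scale (R : ℝ) (n : ℕ) : ℝ := Real.exp (-(n * R))

theorem scale_pos (R : ℝ) (n : ℕ) : 0 < scale R n := Real.exp_pos _

theorem scale_zero (R : ℝ) : scale R 0 = 1 := by simp [scale]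

theorem scale_succ (R : ℝ) (n : ℕ) : scale R (n + 1) = Real.exp (-R) * scale R n := by
  rw [scale, scale, ← Real.exp_add]; congr 1; push_cast; ring

theorem scale_anti {R : ℝ} (hR : 0 < R) : Antitone (scale R) := fun m n h => by
  apply Real.exp_le_exp.2
  have : (m : ℝ) ≤ n := by exact_mod_cast h
  nlinarith

/-- A Bergman ball around a point of a sphere about the origin, restricted to that sphere. -/
theorem smul_mem_bBall_iff {d : ℕ} {x δ : ℝ} (hδ : 0 < δ) {u η : Cd d} (hu : ‖u‖ = 1)
    (hη : ‖η‖ = 1) :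
    (Real.tanh x : ℂ) • η ∈ bBall ((Real.tanh x : ℂ) • u) δ ↔
      ‖1 - ((Real.tanh x ^ 2 : ℝ) : ℂ) * herm η u‖ < Real.cosh δ * (1 - Real.tanh x ^ 2) := by
  have hn : ∀ v : Cd d, ‖v‖ = 1 → ‖(Real.tanh x : ℂ) • v‖ ^ 2 = Real.tanh x ^ 2 := fun v hv => by
    rw [norm_smul, hv, mul_one, Complex.norm_real, Real.norm_eq_abs, sq_abs]
  have hlt : ∀ v : Cd d, ‖v‖ = 1 → ‖(Real.tanh x : ℂ) • v‖ < 1 := fun v hv => by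
    rw [norm_smul, hv, mul_one, Complex.norm_real, Real.norm_eq_abs, abs_lt]
    exact tanh_mem_Ioo x
  have hpos : 0 < 1 - Real.tanh x ^ 2 := by
    rw [one_sub_tanh_sq]; have := Real.cosh_pos x; positivity
  have hc := Real.cosh_pos δ
  simp only [bBall, Set.mem_ofPred_eq, mem_unitBall, hlt η hη, true_and]
  rw [bergmanDist_lt_iff_cosh (hlt u hu) (hlt η hη) hδ, hn u hu, hn η hη, ← sq, ← mul_pow,
    pow_lt_pow_iff_left₀ (norm_nonneg _) (by positivity) two_ne_zero, herm_smul_left,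
    herm_smul_right, Complex.conj_ofReal, ← mul_assoc, sq]
  push_cast
  rfl

theorem re_one_sub_herm_nonneg {d : ℕ} {u η : Cd d} (hu : ‖u‖ = 1) (hη : ‖η‖ = 1) :
    0 ≤ (1 - herm η u).re := by
  have h1 := norm_herm_le η u
  have h2 := Complex.re_le_norm (herm η u)
  rw [hu, hη] at h1
  simp only [Complex.sub_re, Complex.one_re]
  linarith

/-- On the sphere of Bergman radius `x`, Bergman balls contain nonisotropic balls. -/
theorem smul_mem_bBall_of_rho_lt {d : ℕ} {x δ : ℝ} (hδ : 0 < δ) {u η : Cd d} (hu : ‖u‖ = 1)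
    (hη : ‖η‖ = 1) (h : rho η u ^ 2 < (Real.cosh δ - 1) * (1 - Real.tanh x ^ 2)) :
    (Real.tanh x : ℂ) • η ∈ bBall ((Real.tanh x : ℂ) • u) δ := by
  rw [smul_mem_bBall_iff hδ hu hη]
  have h1 : 1 - ((Real.tanh x ^ 2 : ℝ) : ℂ) * herm η u
      = ((1 - Real.tanh x ^ 2 : ℝ) : ℂ) + ((Real.tanh x ^ 2 : ℝ) : ℂ) * (1 - herm η u) := by
    push_cast; ring
  have ht : Real.tanh x ^ 2 ≤ 1 := by
    have := tanh_mem_Ioo x; nlinarith [this.1, this.2]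
  rw [rho_sq] at h
  rw [h1]
  refine (norm_add_le _ _).trans_lt ?_
  rw [norm_mul, Complex.norm_real, Complex.norm_real, Real.norm_of_nonneg (by linarith),
    Real.norm_of_nonneg (by positivity)]
  nlinarith [norm_nonneg (1 - herm η u)]

/-- On the sphere of Bergman radius `x`, Bergman balls are contained in nonisotropic balls. -/
theorem rho_sq_lt_of_smul_mem_bBall {d : ℕ} {x δ : ℝ} (hδ : 0 < δ) {u η : Cd d} (hu : ‖u‖ = 1)
    (hη : ‖η‖ = 1) (h : (Real.tanh x : ℂ) • η ∈ bBall ((Real.tanh x : ℂ) • u) δ) :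
    Real.tanh x ^ 2 * rho η u ^ 2 < Real.cosh δ * (1 - Real.tanh x ^ 2) := by
  rw [smul_mem_bBall_iff hδ hu hη] at h
  refine lt_of_le_of_lt ?_ h
  have h1 : 1 - ((Real.tanh x ^ 2 : ℝ) : ℂ) * herm η u
      = ((1 - Real.tanh x ^ 2 : ℝ) : ℂ) + ((Real.tanh x ^ 2 : ℝ) : ℂ) * (1 - herm η u) := by
    push_cast; ring
  have hre := re_one_sub_herm_nonneg hu hη
  have ht : Real.tanh x ^ 2 ≤ 1 := by
    have := tanh_mem_Ioo x; nlinarith [this.1, this.2]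
  rw [h1, rho_sq]
  set y := 1 - herm η u
  set a := 1 - Real.tanh x ^ 2
  set b := Real.tanh x ^ 2
  have hb : 0 ≤ b := sq_nonneg _
  have hab : 0 ≤ a := by simp only [a]; linarith
  refine abs_le_of_sq_le_sq' ?_ (norm_nonneg _) |>.2
  rw [mul_pow, ← Complex.normSq_eq_norm_sq, ← Complex.normSq_eq_norm_sq, Complex.normSq_apply,
    Complex.normSq_apply]
  simp only [Complex.add_re, Complex.mul_re, Complex.ofReal_re, Complex.ofReal_im, Complex.add_im,
    Complex.mul_im, zero_mul, sub_zero, add_zero, zero_add]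
  nlinarith [mul_nonneg (mul_nonneg hab hb) hre]

theorem norm_radialProj {d : ℕ} {x : ℝ} (hx : 0 ≤ x) {ζ : Cd d} (h : Real.tanh x ≤ ‖ζ‖) :
    ‖radialProj x ζ‖ = Real.tanh x := by
  have ht := tanh_nonneg hx
  rw [radialProj, norm_smul, Complex.norm_real, Real.norm_of_nonneg ht]
  rcases eq_or_ne ζ 0 with rfl | h0
  · rw [norm_zero] at h
    rw [le_antisymm h ht, zero_mul]
  · rw [norm_unitVec h0, mul_one]

theorem measurable_unitVec {d : ℕ} : Measurable (unitVec : Cd d → Cd d) := by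
  unfold unitVec
  exact ((Complex.measurable_ofReal.comp measurable_norm).inv).smul measurable_id

theorem measurable_radialProj {d : ℕ} (r : ℝ) : Measurable (radialProj r : Cd d → Cd d) :=
  measurable_unitVec.const_smul ((Real.tanh r : ℝ) : ℂ)

namespace BergmanTree

variable {d : ℕ} {R δ : ℝ} (T : BergmanTree d R δ)

/-! ### Kubes and the tree order -/

instance : Countable T.Vertex := inferInstanceAs (Countable (Σ n : ℕ, Fin (T.J n)))

theorem mem_kube {α : T.Vertex} {ζ : Cd d} :
    ζ ∈ T.kube α ↔ Real.tanh (α.1 * R) ≤ ‖ζ‖ ∧ ‖ζ‖ < Real.tanh ((α.1 + 1) * R) ∧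
      radialProj (α.1 * R) ζ ∈ T.Om α.1 α.2 := by
  simp only [kube, Set.mem_ofPred_eq, Set.mem_sdiff, mem_bBall_zero, not_lt]
  tauto

theorem kube_subset_unitBall (α : T.Vertex) : T.kube α ⊆ unitBall d := fun ζ hζ => by
  rw [mem_unitBall]
  exact (T.mem_kube.1 hζ).2.1.trans (Real.tanh_lt_one _)

theorem measurableSet_kube (α : T.Vertex) : MeasurableSet (T.kube α) := by
  have : T.kube α = {ζ | Real.tanh (α.1 * R) ≤ ‖ζ‖} ∩ ({ζ | ‖ζ‖ < Real.tanh ((α.1 + 1) * R)} ∩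
      radialProj (α.1 * R) ⁻¹' T.Om α.1 α.2) := by
    ext ζ; exact T.mem_kube
  rw [this]
  exact (measurableSet_le measurable_const measurable_norm).inter
    ((measurableSet_lt measurable_norm measurable_const).inter
      (measurable_radialProj _ (T.measurable_Om _ _)))

theorem norm_of_mem_Om {n : ℕ} {j : Fin (T.J n)} {x : Cd d} (hx : x ∈ T.Om n j) :
    ‖x‖ = Real.tanh (n * R) :=
  mem_bSphere.1 ((T.subset_ball n j hx).2)

theorem eq_of_mem_Om {n : ℕ} {i j : Fin (T.J n)} {x : Cd d} (hi : x ∈ T.Om n i)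
    (hj : x ∈ T.Om n j) : i = j := by
  by_contra h
  exact Set.disjoint_left.1 (T.disjoint_Om n i j h) hi hj

theorem exists_mem_Om {n : ℕ} {x : Cd d} (hx : ‖x‖ = Real.tanh (n * R)) : ∃ j, x ∈ T.Om n j := by
  have := mem_bSphere.2 hx
  rw [← T.iUnion_Om n] at this
  exact Set.mem_iUnion.1 this

theorem kube_disjoint (hR : 0 < R) {α β : T.Vertex} {ζ : Cd d} (h1 : ζ ∈ T.kube α)
    (h2 : ζ ∈ T.kube β) : α = β := by
  rw [mem_kube] at h1 h2
  have hlt : ∀ {a b : T.Vertex}, Real.tanh (a.1 * R) ≤ ‖ζ‖ → ‖ζ‖ < Real.tanh ((b.1 + 1) * R) →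
      a.1 ≤ b.1 := fun {a b} ha hb => by
    have := tanh_strictMono.lt_iff_lt.1 (ha.trans_lt hb)
    have h3 := lt_of_mul_lt_mul_right this hR.le
    exact Nat.lt_succ_iff.1 (by exact_mod_cast h3)
  obtain ⟨n, i⟩ := α
  obtain ⟨m, j⟩ := β
  obtain rfl : n = m := le_antisymm (hlt h1.1 h2.2.1) (hlt h2.1 h1.2.1)
  obtain rfl := T.eq_of_mem_Om h1.2.2 h2.2.2
  rfl

theorem exists_mem_kube (hR : 0 < R) {ζ : Cd d} (hζ : ‖ζ‖ < 1) : ∃ α, ζ ∈ T.kube α := by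
  have hmem : ‖ζ‖ ∈ Set.Ioo (-1 : ℝ) 1 := ⟨by linarith [norm_nonneg ζ], hζ⟩
  have ha : 0 ≤ Real.artanh ‖ζ‖ := Real.artanh_nonneg (norm_nonneg ζ)
  set n := ⌊Real.artanh ‖ζ‖ / R⌋₊ with hn
  have h1 : n * R ≤ Real.artanh ‖ζ‖ := by
    rw [← le_div_iff₀ hR]; exact Nat.floor_le (by positivity)
  have h2 : Real.artanh ‖ζ‖ < (n + 1) * R := by
    rw [← div_lt_iff₀ hR]; exact Nat.lt_floor_add_one _
  have h1' : Real.tanh (n * R) ≤ ‖ζ‖ := by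
    have := tanh_strictMono.monotone h1
    rwa [Real.tanh_artanh hmem] at this
  have h2' : ‖ζ‖ < Real.tanh ((n + 1) * R) := by
    have := tanh_strictMono h2
    rwa [Real.tanh_artanh hmem] at this
  obtain ⟨j, hj⟩ := T.exists_mem_Om (n := n) (norm_radialProj (by positivity) h1')
  exact ⟨⟨n, j⟩, T.mem_kube.2 ⟨h1', h2', hj⟩⟩

theorem norm_pt (α : T.Vertex) : ‖T.pt α.1 α.2‖ = Real.tanh (α.1 * R) :=
  mem_bSphere.1 (T.pt_mem _ _)

theorem pt_mem_Om (hδ : 0 < δ) (α : T.Vertex) : T.pt α.1 α.2 ∈ T.Om α.1 α.2 := by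
  refine T.ball_subset _ _ ⟨?_, T.pt_mem _ _⟩
  have h : ‖T.pt α.1 α.2‖ < 1 := by rw [norm_pt]; exact Real.tanh_lt_one _
  refine ⟨mem_unitBall.2 h, ?_⟩
  rw [bergmanDist_lt_iff_cosh h h hδ, herm_self]
  have h1 : (1 : ℂ) - (‖T.pt α.1 α.2‖ : ℂ) ^ 2 = ((1 - ‖T.pt α.1 α.2‖ ^ 2 : ℝ) : ℂ) := by
    push_cast; ring
  have h2 : 0 < 1 - ‖T.pt α.1 α.2‖ ^ 2 := by nlinarith [norm_nonneg (T.pt α.1 α.2)]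
  rw [h1, Complex.norm_real, Real.norm_of_nonneg h2.le]
  have h3 : 1 < Real.cosh δ := Real.one_lt_cosh.2 hδ.ne'
  have h4 : 1 < Real.cosh δ ^ 2 := by nlinarith
  nlinarith [mul_pos h2 h2]

/-- The constant in the upper inclusion of the cells is automatically positive. -/
theorem C_mul_pos (hδ : 0 < δ) (α : T.Vertex) : 0 < T.C * δ := by
  have h : ‖T.pt α.1 α.2‖ < 1 := by rw [norm_pt]; exact Real.tanh_lt_one _
  have h1 := (T.subset_ball _ _ (T.pt_mem_Om hδ α)).1.2
  rw [bergmanDist_eq_artanh h h] at h1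
  exact (Real.artanh_nonneg (norm_nonneg _)).trans_lt h1

theorem exists_dir (hd : 0 < d) (α : T.Vertex) :
    ∃ u : Cd d, ‖u‖ = 1 ∧ T.pt α.1 α.2 = (Real.tanh (α.1 * R) : ℂ) • u := by
  rcases eq_or_ne (T.pt α.1 α.2) 0 with h | h
  · refine ⟨EuclideanSpace.single ⟨0, hd⟩ 1, by simp, ?_⟩
    have := T.norm_pt α
    rw [h, norm_zero] at this
    rw [h, ← this]; simp
  · exact ⟨_, norm_unitVec h, by rw [← norm_pt, norm_smul_unitVec]⟩

/-- A unit vector in the direction of the point `z_j^n`; it is arbitrary if that point is zero. -/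
def dir (hd : 0 < d) (α : T.Vertex) : Cd d := (T.exists_dir hd α).choose

theorem norm_dir (hd : 0 < d) (α : T.Vertex) : ‖T.dir hd α‖ = 1 :=
  (T.exists_dir hd α).choose_spec.1

theorem pt_eq (hd : 0 < d) (α : T.Vertex) :
    T.pt α.1 α.2 = (Real.tanh (α.1 * R) : ℂ) • T.dir hd α :=
  (T.exists_dir hd α).choose_spec.2

theorem radialProj_center (hd : 0 < d) (hR : 0 < R) {α : T.Vertex} (hα : α.1 ≠ 0) (x : ℝ) :
    radialProj x (T.center α) = (Real.tanh x : ℂ) • T.dir hd α := by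
  have h0 : (0 : ℝ) < α.1 := by exact_mod_cast Nat.pos_of_ne_zero hα
  have hu := T.norm_dir hd α
  rw [center, T.pt_eq hd, radialProj, radialProj, unitVec_smul hu (tanh_pos (by positivity)),
    unitVec_smul hu (tanh_pos (by positivity))]

theorem isChild_unique {α α' β : T.Vertex} (h : T.IsChild α β) (h' : T.IsChild α' β) : α = α' := by
  obtain ⟨n, i⟩ := α
  obtain ⟨m, j⟩ := α'
  have h1 := h.1
  have h2 := h'.1
  simp only at h1 h2
  obtain rfl : n = m := by omega
  obtain rfl := T.eq_of_mem_Om h.2 h'.2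
  rfl

theorem exists_isChild (hd : 0 < d) (hR : 0 < R) {β : T.Vertex} (hβ : β.1 ≠ 0) :
    ∃ α, T.IsChild α β := by
  obtain ⟨n, hn⟩ := Nat.exists_eq_succ_of_ne_zero hβ
  have : ‖radialProj (n * R) (T.center β)‖ = Real.tanh (n * R) := by
    rw [T.radialProj_center hd hR hβ, norm_smul, norm_dir, mul_one, Complex.norm_real,
      Real.norm_of_nonneg (tanh_nonneg (by positivity))]
  obtain ⟨j, hj⟩ := T.exists_mem_Om this
  exact ⟨⟨n, j⟩, hn, hj⟩

theorem IsDescendant.level_le {T : BergmanTree d R δ} {α β : T.Vertex} (h : T.IsDescendant α β) :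
    α.1 ≤ β.1 := by
  induction h with
  | refl => exact le_rfl
  | tail _ h ih => have := h.1; omega

theorem IsDescendant.eq_of_level {T : BergmanTree d R δ} {α β : T.Vertex} (h : T.IsDescendant α β)
    (hl : β.1 ≤ α.1) : α = β := by
  rcases Relation.ReflTransGen.cases_tail h with h | ⟨γ, h1, h2⟩
  · exact h.symm
  · have h3 := IsDescendant.level_le h1
    have h4 := h2.1
    omega

/-- The tree order: `α ≤ β` if `α` is a descendant of `β`. -/
instance : PartialOrder T.Vertex where
  le α β := T.IsDescendant β α
  le_refl _ := Relation.ReflTransGen.refl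
  le_trans _ _ _ h1 h2 := Relation.ReflTransGen.trans h2 h1
  le_antisymm _ _ h1 h2 := (h2.eq_of_level h1.level_le)

theorem le_def {α β : T.Vertex} : α ≤ β ↔ T.IsDescendant β α := Iff.rfl

/-- The ancestors of a vertex form a chain. -/
theorem le_or_le_of_le {α β γ : T.Vertex} (h1 : γ ≤ α) (h2 : γ ≤ β) : α ≤ β ∨ β ≤ α := by
  rw [le_def] at h1
  induction h1 with
  | refl => exact Or.inl h2
  | @tail b c hab hbc ih =>
    rcases Relation.ReflTransGen.cases_tail (T.le_def.1 h2) with h | ⟨b', h3, h4⟩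
    · exact Or.inr (h ▸ (hab.tail hbc))
    · rw [T.isChild_unique h4 hbc] at h3
      exact ih h3

theorem mem_tent {α : T.Vertex} {ζ : Cd d} : ζ ∈ T.tent α ↔ ∃ β ≤ α, ζ ∈ T.kube β := by
  simp [tent, le_def]

theorem kube_subset_tent {α β : T.Vertex} (h : β ≤ α) : T.kube β ⊆ T.tent α :=
  fun _ hζ => T.mem_tent.2 ⟨β, h, hζ⟩

theorem tent_mono {α β : T.Vertex} (h : α ≤ β) : T.tent α ⊆ T.tent β := fun ζ hζ => by
  obtain ⟨γ, h1, h2⟩ := T.mem_tent.1 hζ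
  exact T.mem_tent.2 ⟨γ, h1.trans h, h2⟩

/-- Two tents of one tree are nested or disjoint. -/
theorem le_or_le_of_mem_tent (hR : 0 < R) {α β : T.Vertex} {ζ : Cd d} (h1 : ζ ∈ T.tent α)
    (h2 : ζ ∈ T.tent β) : α ≤ β ∨ β ≤ α := by
  obtain ⟨γ, h3, h4⟩ := T.mem_tent.1 h1
  obtain ⟨γ', h5, h6⟩ := T.mem_tent.1 h2
  rw [T.kube_disjoint hR h6 h4] at h5
  exact T.le_or_le_of_le h3 h5

theorem measurableSet_tent (α : T.Vertex) : MeasurableSet (T.tent α) := by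
  unfold tent
  exact MeasurableSet.biUnion (Set.to_countable _) fun β _ => T.measurableSet_kube β

theorem tent_subset_unitBall (α : T.Vertex) : T.tent α ⊆ unitBall d := fun ζ hζ => by
  obtain ⟨γ, _, h⟩ := T.mem_tent.1 hζ
  exact T.kube_subset_unitBall γ h

theorem exists_ancestor (hd : 0 < d) (hR : 0 < R) (β : T.Vertex) (n : ℕ)
    (hn : n ≤ β.1) : ∃ α : T.Vertex, α.1 = n ∧ β ≤ α := by
  induction hm : β.1 - n generalizing β with
  | zero => exact ⟨β, by omega, le_rfl⟩
  | succ m ih =>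
    obtain ⟨γ, hγ⟩ := T.exists_isChild hd hR (β := β) (by omega)
    have h1 := hγ.1
    obtain ⟨α, h2, h3⟩ := ih γ (by omega) (by omega)
    exact ⟨α, h2, le_trans (T.le_def.2 (Relation.ReflTransGen.single hγ)) h3⟩

theorem tent_eq_unitBall (hd : 0 < d) (hR : 0 < R) (hδ : 0 < δ) {α : T.Vertex} (hα : α.1 = 0) :
    T.tent α = unitBall d := by
  refine (T.tent_subset_unitBall α).antisymm fun ζ hζ => ?_
  obtain ⟨β, hβ⟩ := T.exists_mem_kube hR (mem_unitBall.1 hζ)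
  obtain ⟨γ, h1, h2⟩ := T.exists_ancestor hd hR β 0 (Nat.zero_le _)
  have : γ = α := by
    obtain ⟨n, i⟩ := γ
    obtain ⟨m, j⟩ := α
    simp only at hα h1
    subst hα h1
    have hz : ∀ k : Fin (T.J 0), (0 : Cd d) ∈ T.Om 0 k := fun k => by
      have h := T.pt_mem_Om hδ ⟨0, k⟩
      have h0 := T.norm_of_mem_Om h
      simp only [Nat.cast_zero, zero_mul, Real.tanh_zero, norm_eq_zero] at h0
      rwa [h0] at h
    obtain rfl := T.eq_of_mem_Om (hz i) (hz j)
    rfl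
  exact T.mem_tent.2 ⟨β, this ▸ h2, hβ⟩

end BergmanTree

end

section

variable {d : ℕ}

theorem abs_norm_sq_smul_add_sub_le {u v : Cd d} (hu : ‖u‖ = 1) (hvu : herm v u = 0) {b h ε : ℝ}
    (hb0 : 0 ≤ b) (hb1 : b ≤ 1) (hh0 : 0 < h) (hh1 : h ≤ 1) (hε : ε ≤ 1 / 16) {c : ℂ}
    (hc : ‖c‖ < ε) (hv : ‖v‖ < ε) :
    |‖((b : ℂ) + (h : ℝ) * c) • u + ((√h : ℝ) : ℂ) • v‖ ^ 2 - b ^ 2| ≤ 3 * h * ε := by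
  have hw : herm (((√h : ℝ) : ℂ) • v) u = 0 := by rw [herm_smul_left, hvu, mul_zero]
  have hcre : |c.re| < ε := (Complex.abs_re_le_norm c).trans_lt hc
  have hcsq : ‖c‖ ^ 2 ≤ ε ^ 2 := by gcongr
  have hvsq : ‖v‖ ^ 2 ≤ ε ^ 2 := by gcongr
  have hε0 : 0 ≤ ε := (norm_nonneg c).trans hc.le
  have hnorm : ‖((b : ℂ) + (h : ℝ) * c) • u + ((√h : ℝ) : ℂ) • v‖ ^ 2
      = b ^ 2 + 2 * h * (b * c.re) + h ^ 2 * ‖c‖ ^ 2 + h * ‖v‖ ^ 2 := by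
    rw [norm_sq_smul_add hu hw, norm_smul, Complex.norm_real,
      Real.norm_of_nonneg (Real.sqrt_nonneg _), mul_pow, Real.sq_sqrt hh0.le]
    rw [← Complex.normSq_eq_norm_sq, ← Complex.normSq_eq_norm_sq, Complex.normSq_apply,
      Complex.normSq_apply]
    simp
    ring
  have hbc : |b * c.re| ≤ ε := by
    rw [abs_mul, abs_of_nonneg hb0]
    nlinarith [abs_nonneg c.re]
  obtain ⟨hbc1, hbc2⟩ := abs_le.1 hbc
  have h1 : h ^ 2 * ‖c‖ ^ 2 ≤ h * ε ^ 2 := by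
    have : h ^ 2 ≤ h := by nlinarith
    calc _ ≤ h * ‖c‖ ^ 2 := by gcongr
      _ ≤ _ := by gcongr
  have h2 : h * ‖v‖ ^ 2 ≤ h * ε ^ 2 := by gcongr
  have h3 : h * ε ^ 2 ≤ h * (ε / 16) := by gcongr; nlinarith
  have h4 : 0 ≤ h ^ 2 * ‖c‖ ^ 2 := by positivity
  have h5 : 0 ≤ h * ‖v‖ ^ 2 := by positivity
  have h6 : h * (b * c.re) ≤ h * ε := by gcongr
  have h7 : h * -ε ≤ h * (b * c.re) := by gcongr
  have h8 : 0 ≤ h * ε := by positivity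
  rw [hnorm, abs_le]
  constructor <;> nlinarith

theorem norm_one_sub_mul_herm_unitVec_le {u v : Cd d} (hu : ‖u‖ = 1) (hvu : herm v u = 0)
    {b h ε r : ℝ} {c : ℂ} (hr0 : 0 ≤ r) (hb0 : 0 ≤ b) (hh0 : 0 < h) (hh : h = 1 - r ^ 2)
    (h0 : ((b : ℂ) + (h : ℝ) * c) • u + ((√h : ℝ) : ℂ) • v ≠ 0)
    (hr : r ≤ ‖((b : ℂ) + (h : ℝ) * c) • u + ((√h : ℝ) : ℂ) • v‖)
    (hdiff : |‖((b : ℂ) + (h : ℝ) * c) • u + ((√h : ℝ) : ℂ) • v‖ ^ 2 - b ^ 2| ≤ 3 * h * ε)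
    (hc : ‖c‖ ≤ ε) :
    ‖1 - ((r ^ 2 : ℝ) : ℂ) * herm (unitVec (((b : ℂ) + (h : ℝ) * c) • u + ((√h : ℝ) : ℂ) • v)) u‖
      ≤ h * (1 + 4 * ε) := by
  have hw : herm (((√h : ℝ) : ℂ) • v) u = 0 := by rw [herm_smul_left, hvu, mul_zero]
  have h1 : herm (((b : ℂ) + (h : ℝ) * c) • u + ((√h : ℝ) : ℂ) • v) u = (b : ℂ) + (h : ℝ) * c := by
    rw [herm_add_left, herm_smul_left, hw, herm_self_of_norm hu, mul_one, add_zero]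
  generalize ((b : ℂ) + (h : ℝ) * c) • u + ((√h : ℝ) : ℂ) • v = ζ at *
  have hζn : 0 < ‖ζ‖ := norm_pos_iff.2 h0
  have hζc : (‖ζ‖ : ℂ) ≠ 0 := by exact_mod_cast hζn.ne'
  have hr1 : r ≤ 1 := by nlinarith
  have h2 : 1 - ((r ^ 2 : ℝ) : ℂ) * herm (unitVec ζ) u
      = (h : ℂ) + ((r ^ 2 / ‖ζ‖ : ℝ) : ℂ) * (((‖ζ‖ - b : ℝ) : ℂ) - h * c) := by
    have hhc : (h : ℂ) = 1 - (r : ℂ) ^ 2 := by rw [hh]; push_cast; ring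
    rw [unitVec, herm_smul_left, h1]; push_cast; field_simp; rw [hhc]; ring
  rw [h2]
  have h3 : r * |‖ζ‖ - b| ≤ 3 * h * ε := by
    calc r * |‖ζ‖ - b| ≤ (‖ζ‖ + b) * |‖ζ‖ - b| := by gcongr; linarith
      _ = |‖ζ‖ ^ 2 - b ^ 2| := by
        rw [sq_sub_sq, abs_mul, abs_of_nonneg (by positivity : 0 ≤ ‖ζ‖ + b)]
      _ ≤ _ := hdiff
  have h4 : r ^ 2 / ‖ζ‖ ≤ r := by
    rw [div_le_iff₀ hζn]; nlinarith
  have h5 : 0 ≤ h * ‖c‖ := by positivity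
  calc _ ≤ h + (r ^ 2 / ‖ζ‖) * (|‖ζ‖ - b| + h * ‖c‖) := by
        refine (norm_add_le _ _).trans ?_
        rw [norm_mul, Complex.norm_real, Complex.norm_real, Real.norm_of_nonneg hh0.le,
          Real.norm_of_nonneg (by positivity : 0 ≤ r ^ 2 / ‖ζ‖)]
        gcongr
        refine (norm_sub_le _ _).trans ?_
        rw [norm_mul, Complex.norm_real, Complex.norm_real, Real.norm_of_nonneg hh0.le,
          Real.norm_eq_abs]
    _ ≤ h + r * (|‖ζ‖ - b| + h * ‖c‖) := by gcongr
    _ ≤ h + (3 * h * ε + 1 * (h * ε)) := by rw [mul_add]; gcongr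
    _ = _ := by ring

namespace BergmanTree

variable {R δ : ℝ} (T : BergmanTree d R δ)

/-! ### The size of kubes and tents -/

theorem exists_rho_dir_le (hd : 0 < d) (hR : 0 < R) (hδ : 0 < δ) : ∃ K : ℝ, 2 ≤ K ∧
    ∀ (α : T.Vertex) (η : Cd d), ‖η‖ = 1 → (Real.tanh (α.1 * R) : ℂ) • η ∈ T.Om α.1 α.2 →
      rho η (T.dir hd α) ≤ K * scale R α.1 := by
  have ht := tanh_pos hR
  have hc := Real.cosh_pos (T.C * δ)
  set L := 4 * Real.cosh (T.C * δ) / Real.tanh R ^ 2 with hL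
  have hL0 : 0 < L := by positivity
  refine ⟨2 + L, by linarith, fun α η hη hmem => ?_⟩
  have hs := scale_pos R α.1
  rcases Nat.eq_zero_or_pos α.1 with h0 | h0
  · rw [h0, scale_zero]
    have := rho_le_two hη.le (T.norm_dir hd α).le
    linarith
  · have h1 := (T.subset_ball _ _ hmem).1
    rw [T.pt_eq hd] at h1
    have h2 := rho_sq_lt_of_smul_mem_bBall (T.C_mul_pos hδ α) (T.norm_dir hd α) hη h1
    have h3 : Real.tanh R ≤ Real.tanh (α.1 * R) := by
      apply tanh_strictMono.monotone
      have : (1 : ℝ) ≤ α.1 := by exact_mod_cast h0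
      nlinarith
    have h4 : 1 - Real.tanh (α.1 * R) ^ 2 ≤ 4 * scale R α.1 ^ 2 := one_sub_tanh_sq_le _
    have h5 : rho η (T.dir hd α) ^ 2 ≤ L * scale R α.1 ^ 2 := by
      rw [hL, div_mul_eq_mul_div, le_div_iff₀ (by positivity)]
      calc _ ≤ Real.tanh (α.1 * R) ^ 2 * rho η (T.dir hd α) ^ 2 := by
            rw [mul_comm]; gcongr
        _ ≤ Real.cosh (T.C * δ) * (4 * scale R α.1 ^ 2) := h2.le.trans (by gcongr)
        _ = _ := by ring
    refine abs_le_of_sq_le_sq' (h5.trans ?_) (by positivity) |>.2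
    rw [mul_pow]
    gcongr
    nlinarith

/-- The distances between consecutive centres along a branch form a geometric series. -/
theorem rho_dir_le_of_le (hd : 0 < d) (hR : 0 < R) {K : ℝ} {m : ℕ}
    (H : ∀ (α : T.Vertex) (η : Cd d), m ≤ α.1 → ‖η‖ = 1 →
      (Real.tanh (α.1 * R) : ℂ) • η ∈ T.Om α.1 α.2 → rho η (T.dir hd α) ≤ K * scale R α.1)
    {α β : T.Vertex} (hα : m ≤ α.1) (h : β ≤ α) :
    rho (T.dir hd β) (T.dir hd α) ≤ K / (1 - Real.exp (-R)) * (scale R α.1 - scale R β.1) := by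
  have hq : 0 < 1 - Real.exp (-R) := by
    have : Real.exp (-R) < 1 := by simpa using hR
    linarith
  rw [le_def] at h
  induction h with
  | refl => rw [rho_self (T.norm_dir hd α)]; simp
  | @tail b c hab hbc ih =>
    have h1 := hbc.2
    rw [T.radialProj_center hd hR (by have := hbc.1; omega)] at h1
    have h2 := H b _ (hα.trans (IsDescendant.level_le hab)) (T.norm_dir hd c) h1
    have h3 := rho_triangle (T.norm_dir hd c).le (T.norm_dir hd α).le (T.norm_dir hd b).le
    have h4 : scale R c.1 = Real.exp (-R) * scale R b.1 := by rw [hbc.1, scale_succ]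
    rw [h4]
    have h5 : K * scale R b.1 =
        K / (1 - Real.exp (-R)) * (scale R b.1 - Real.exp (-R) * scale R b.1) := by
      field_simp
    linarith

theorem exists_rho_dir_le_of_le (hd : 0 < d) (hR : 0 < R) (hδ : 0 < δ) : ∃ K : ℝ, 0 ≤ K ∧
    ∀ α β : T.Vertex, β ≤ α →
      rho (T.dir hd β) (T.dir hd α) ≤ K * (scale R α.1 - scale R β.1) := by
  obtain ⟨K, hK, H⟩ := T.exists_rho_dir_le hd hR hδ
  have hq : 0 < 1 - Real.exp (-R) := by
    have : Real.exp (-R) < 1 := by simpa using hR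
    linarith
  exact ⟨K / (1 - Real.exp (-R)), by positivity, fun α β h =>
    T.rho_dir_le_of_le hd hR (m := 0) (fun α η _ => H α η) (Nat.zero_le _) h⟩

theorem rho_unitVec_le {n : ℕ} {ζ : Cd d} (hζ : ‖ζ‖ < 1) (h0 : ζ ≠ 0)
    (h : Real.tanh (n * R) ≤ ‖ζ‖) : rho ζ (unitVec ζ) ≤ 2 * scale R n := by
  have hu := norm_unitVec h0
  have h1 := herm_self_unitVec h0
  have hs := scale_pos R n
  refine abs_le_of_sq_le_sq' ?_ (by positivity) |>.2
  have h2 : 1 - Real.tanh (n * R) ≤ 2 * scale R n ^ 2 := one_sub_tanh_le _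
  rw [rho_sq, h1, ← Complex.ofReal_one, ← Complex.ofReal_sub, Complex.norm_real,
    Real.norm_of_nonneg (by linarith)]
  nlinarith [sq_nonneg (scale R n)]

/-- A tent of generation `n` is contained in a nonisotropic ball of radius comparable to
`e^{-nR}`. -/
theorem exists_tent_subset_region (hd : 0 < d) (hR : 0 < R) (hδ : 0 < δ) : ∃ K : ℝ, 0 < K ∧
    ∀ α : T.Vertex, T.tent α ⊆ region (T.dir hd α) (K * scale R α.1 ^ 2) := by
  obtain ⟨K₀, hK₀, H₀⟩ := T.exists_rho_dir_le hd hR hδ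
  obtain ⟨K₁, hK₁, H₁⟩ := T.exists_rho_dir_le_of_le hd hR hδ
  refine ⟨(2 + K₀ + K₁) ^ 2, by positivity, fun α ζ hζ => ?_⟩
  have hb := T.tent_subset_unitBall α hζ
  refine ⟨hb, ?_⟩
  rw [mem_unitBall] at hb
  obtain ⟨β, hβ, hk⟩ := T.mem_tent.1 hζ
  rw [mem_kube] at hk
  rw [← mul_pow, ← rho_sq]
  have hsα := scale_pos R α.1
  have hsβ := scale_pos R β.1
  have hle : scale R β.1 ≤ scale R α.1 := scale_anti hR (T.le_def.1 hβ).level_le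
  have hur : rho ζ (T.dir hd β) ≤ (2 + K₀) * scale R β.1 := by
    rcases Nat.eq_zero_or_pos β.1 with h0 | h0
    · rw [h0, scale_zero]
      have := rho_le_two hb.le (T.norm_dir hd β).le
      linarith
    · have h1 : (0 : ℝ) < β.1 := by exact_mod_cast h0
      have hζ0 : ζ ≠ 0 := by
        rintro rfl
        have := tanh_pos (mul_pos h1 hR)
        rw [norm_zero] at hk
        linarith [hk.1]
      have h2 := H₀ β _ (norm_unitVec hζ0) hk.2.2
      have h3 := rho_unitVec_le hb hζ0 hk.1
      have h4 := rho_triangle hb.le (T.norm_dir hd β).le (norm_unitVec hζ0).le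
      linarith
  have h1 := H₁ α β hβ
  have h2 := rho_triangle hb.le (T.norm_dir hd α).le (T.norm_dir hd β).le
  apply pow_le_pow_left₀ (rho_nonneg _ _)
  nlinarith

/-- A kube of generation `n` contains a nonisotropic ball of radius comparable to `e^{-nR}`. -/
theorem exists_smul_add_mem_kube (hd : 0 < d) (hR : 0 < R) (hδ : 0 < δ) : ∃ ε : ℝ, 0 < ε ∧
    ∀ α : T.Vertex, ∃ b : ℝ, ∀ (c : ℂ) (v : Cd d), ‖c‖ < ε → ‖v‖ < ε → herm v (T.dir hd α) = 0 →
      ((b : ℂ) + (1 - Real.tanh (α.1 * R) ^ 2 : ℝ) * c) • T.dir hd α +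
        ((√(1 - Real.tanh (α.1 * R) ^ 2) : ℝ) : ℂ) • v ∈ T.kube α := by
  have hcR : 1 < Real.cosh R := Real.one_lt_cosh.2 hR.ne'
  have hcδ : 1 < Real.cosh δ := Real.one_lt_cosh.2 hδ.ne'
  obtain ⟨q, hq⟩ : ∃ q, q = (Real.cosh R ^ 2)⁻¹ := ⟨_, rfl⟩
  have hq1 : q < 1 := hq ▸ inv_lt_one_of_one_lt₀ (by nlinarith)
  have hq0 : 0 < q := hq ▸ by positivity
  obtain ⟨ε, hε0, hε1, hε2⟩ : ∃ ε : ℝ, 0 < ε ∧ ε ≤ (1 - q) / 16 ∧ ε ≤ (Real.cosh δ - 1) / 8 :=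
    ⟨min ((1 - q) / 16) ((Real.cosh δ - 1) / 8), lt_min (by linarith) (by linarith),
      min_le_left _ _, min_le_right _ _⟩
  refine ⟨ε, hε0, fun α => ?_⟩
  have hu : ‖T.dir hd α‖ = 1 := T.norm_dir hd α
  have hpt := T.pt_eq hd α
  generalize T.dir hd α = u at hu hpt
  have hradii : 1 - Real.tanh ((α.1 + 1) * R) ^ 2 ≤ q * (1 - Real.tanh (α.1 * R) ^ 2) := by
    rw [one_sub_tanh_sq, one_sub_tanh_sq, hq, ← mul_inv, ← mul_pow]
    have hc0 := Real.cosh_pos (α.1 * R)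
    apply inv_anti₀ (by positivity)
    gcongr
    rw [add_mul, one_mul, Real.cosh_add, mul_comm]
    have h1 := Real.sinh_nonneg_iff.2 hR.le
    have h2 := Real.sinh_nonneg_iff.2 (show 0 ≤ α.1 * R by positivity)
    nlinarith [mul_nonneg h1 h2]
  have hr0 : 0 ≤ Real.tanh (α.1 * R) := tanh_nonneg (by positivity)
  have hr1 : Real.tanh (α.1 * R) < 1 := Real.tanh_lt_one _
  have hsph := fun ζ => norm_radialProj (d := d) (x := α.1 * R) (by positivity) (ζ := ζ)
  have hball := fun η => smul_mem_bBall_iff (d := d) (x := α.1 * R) (η := η) hδ hu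
  have hproj : ∀ ζ : Cd d, radialProj (α.1 * R) ζ = (Real.tanh (α.1 * R) : ℂ) • unitVec ζ :=
    fun _ => rfl
  have hmem := fun ζ => T.mem_kube (α := α) (ζ := ζ)
  have hsub := T.ball_subset α.1 α.2
  have hsphere : ∀ ζ : Cd d, ζ ∈ bSphere d (α.1 * R) ↔ ‖ζ‖ = Real.tanh (α.1 * R) :=
    fun ζ => mem_bSphere
  rw [hpt] at hsub
  generalize Real.tanh (α.1 * R) = r at *
  obtain ⟨h, hh⟩ : ∃ h, h = 1 - r ^ 2 := ⟨_, rfl⟩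
  rw [← hh] at hradii ⊢
  simp only [← hh] at hball
  have hh0 : 0 < h := by nlinarith
  have hh1 : h ≤ 1 := by nlinarith [sq_nonneg r]
  -- the centre has `1 - b ^ 2` halfway between the values at the two bounding spheres
  have hb0 : 0 ≤ 1 - (1 + q) / 2 * h := by nlinarith
  obtain ⟨b, hb⟩ : ∃ b, b = √(1 - (1 + q) / 2 * h) := ⟨_, rfl⟩
  have hbsq : b ^ 2 = 1 - (1 + q) / 2 * h := hb ▸ Real.sq_sqrt hb0
  have hbn : 0 ≤ b := hb ▸ Real.sqrt_nonneg _
  have hb1 : b ≤ 1 := by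
    refine abs_le_of_sq_le_sq' ?_ zero_le_one |>.2
    rw [hbsq]; nlinarith
  refine ⟨b, fun c v hc hv hvu => ?_⟩
  have hdiff := abs_norm_sq_smul_add_sub_le hu hvu hbn hb1 hh0 hh1 (by linarith) hc hv
  have hcos := norm_one_sub_mul_herm_unitVec_le (c := c) (ε := ε) hu hvu hr0 hbn hh0 hh
  obtain ⟨hd1, hd2⟩ := abs_le.1 hdiff
  generalize ((b : ℂ) + (h : ℝ) * c) • u + ((√h : ℝ) : ℂ) • v = ζ at *
  have hrn : r ≤ ‖ζ‖ := by
    refine abs_le_of_sq_le_sq' ?_ (norm_nonneg _) |>.2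
    have : r ^ 2 = 1 - h := by rw [hh]; ring
    rw [this]
    nlinarith
  rw [hmem]
  refine ⟨hrn, ?_, ?_⟩
  · refine lt_of_pow_lt_pow_left₀ 2 (tanh_nonneg (by positivity)) ?_
    nlinarith
  · refine hsub ⟨?_, (hsphere _).2 (hsph ζ hrn)⟩
    rcases eq_or_ne ζ 0 with h0 | h0
    · -- the origin occurs only in generation zero, whose only cell is a point
      have hr00 : r = 0 := le_antisymm (by rw [h0, norm_zero] at hrn; exact hrn) hr0
      rw [h0, hr00, hproj, unitVec_zero, smul_zero, Complex.ofReal_zero, zero_smul, mem_bBall_zero,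
        norm_zero]
      exact tanh_pos hδ
    · rw [hproj, hball _ (norm_unitVec h0)]
      refine (hcos h0 hrn hdiff hc.le).trans_lt ?_
      nlinarith

/-- Kubes and tents of generation `n` have volume comparable to `e^{-2n(d+1)R}`. -/
theorem exists_nu_kube_tent_bounds (hd : 0 < d) (hR : 0 < R) (hδ : 0 < δ) :
    ∃ c C : ℝ, 0 < c ∧ 0 < C ∧ ∀ α : T.Vertex,
      ENNReal.ofReal (c * (scale R α.1 ^ 2) ^ (d + 1)) ≤ nu d (T.kube α) ∧
      nu d (T.tent α) ≤ ENNReal.ofReal (C * (scale R α.1 ^ 2) ^ (d + 1)) := by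
  obtain ⟨K, hK, HK⟩ := T.exists_tent_subset_region hd hR hδ
  obtain ⟨C, hC, HC⟩ := exists_nu_region_le d
  obtain ⟨ε, hε, Hε⟩ := T.exists_smul_add_mem_kube hd hR hδ
  obtain ⟨c, hc, Hc⟩ := exists_le_nu_of_forall_mem d hε
  refine ⟨c, C * K ^ (d + 1), hc, by positivity, fun α => ⟨?_, ?_⟩⟩
  · obtain ⟨b, hb⟩ := Hε α
    have h1 := exp_neg_sq_le_one_sub_tanh_sq (α.1 * R)
    rw [abs_of_nonneg (by positivity)] at h1
    have h2 : scale R α.1 ^ 2 ≤ 1 - Real.tanh (α.1 * R) ^ 2 := h1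
    have hs := scale_pos R α.1
    refine le_trans ?_ (Hc (T.dir hd α) _ b _ (T.norm_dir hd α) (lt_of_lt_of_le (by positivity) h2)
      (T.kube_subset_unitBall α) hb)
    gcongr
  · have hs := scale_pos R α.1
    refine (measure_mono (HK α)).trans ((HC _ _ (T.norm_dir hd α) (by positivity)).trans ?_)
    rw [mul_pow, mul_assoc]

/-- The volume of a tent is dominated by the volume of its top kube. -/
theorem exists_nu_tent_le_nu_kube (hd : 0 < d) (hR : 0 < R) (hδ : 0 < δ) :
    ∃ C : ℝ, 0 < C ∧ ∀ α : T.Vertex, nu d (T.tent α) ≤ ENNReal.ofReal C * nu d (T.kube α) := by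
  obtain ⟨c, C, hc, hC, H⟩ := T.exists_nu_kube_tent_bounds hd hR hδ
  refine ⟨C / c, by positivity, fun α => (H α).2.trans ?_⟩
  calc _ = ENNReal.ofReal (C / c) * ENNReal.ofReal (c * (scale R α.1 ^ 2) ^ (d + 1)) := by
        rw [← ENNReal.ofReal_mul (by positivity), ← mul_assoc, div_mul_cancel₀ _ hc.ne']
    _ ≤ _ := by gcongr; exact (H α).1

theorem nu_kube_pos (hd : 0 < d) (hR : 0 < R) (hδ : 0 < δ) (α : T.Vertex) :
    0 < nu d (T.kube α) := by
  obtain ⟨c, C, hc, hC, H⟩ := T.exists_nu_kube_tent_bounds hd hR hδ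
  have hs := scale_pos R α.1
  exact lt_of_lt_of_le (ENNReal.ofReal_pos.2 (by positivity)) (H α).1

end BergmanTree

end

section

/-! ### A two-weight inequality on finite forests

The order is that of inclusion of tents: `β ≤ α` means that `β` is a descendant of `α`, and the
hypothesis `forest` says that the ancestors of a vertex form a chain. -/

section Forest

open scoped Classical

open Finset

theorem sum_two_zpow_le (K : Finset ℤ) : ∀ L : ℤ, (∀ k ∈ K, k ≤ L) →
    ∑ k ∈ K, (2 : ℝ) ^ k ≤ 2 * 2 ^ L := by
  induction K using Finset.induction_on_max with
  | empty => intro L _; simp; positivity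
  | insert m s hm ih =>
    intro L hL
    rw [sum_insert (fun h => (hm m h).false)]
    have h1 := ih (m - 1) (fun k hk => by have := hm k hk; omega)
    have h2 : (2 : ℝ) ^ m ≤ 2 ^ L := zpow_le_zpow_right₀ (by norm_num) (hL m (mem_insert_self _ _))
    have h3 : (2 : ℝ) * 2 ^ (m - 1) = 2 ^ m := by
      rw [zpow_sub_one₀ (by norm_num)]; ring
    linarith

variable {V : Type*} [Fintype V] [PartialOrder V]

/-- The total mass of `s` on the descendants of `α`. -/
def lowSum (s : V → ℝ) (α : V) : ℝ := ∑ β with β ≤ α, s β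

theorem lowSum_nonneg {s : V → ℝ} (hs : ∀ β, 0 ≤ s β) (α : V) : 0 ≤ lowSum s α :=
  sum_nonneg fun β _ => hs β

theorem lowSum_pos {s : V → ℝ} (hs : ∀ β, 0 < s β) (α : V) : 0 < lowSum s α :=
  sum_pos (fun β _ => hs β) ⟨α, by simp⟩

theorem sum_mul_lowSum (B : Finset V) (u s : V → ℝ) :
    ∑ α ∈ B, u α * lowSum s α = ∑ β, s β * ∑ α ∈ B with β ≤ α, u α := by
  simp only [lowSum, mul_sum, sum_filter]
  rw [sum_comm]
  refine sum_congr rfl fun β _ => sum_congr rfl fun α _ => ?_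
  split_ifs <;> ring

/-- Expanding the square of a sum along branches. -/
theorem sum_mul_sq_sum_le (forest : ∀ x y z : V, x ≤ y → x ≤ z → y ≤ z ∨ z ≤ y)
    (B : Finset V) {u t : V → ℝ} (hu : ∀ α, 0 ≤ u α) (ht : ∀ α, 0 ≤ t α) :
    ∑ β, t β * (∑ α ∈ B with β ≤ α, u α) ^ 2 ≤
      2 * ∑ α ∈ B, u α * ∑ α' ∈ B with α' ≤ α, u α' * lowSum t α' := by
  have h1 : ∀ β, (∑ α ∈ B with β ≤ α, u α) ^ 2 ≤
      2 * ∑ α ∈ B, u α * ∑ α' ∈ B with α' ≤ α, if β ≤ α' then u α' else 0 := by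
    intro β
    have h2 : (∑ α ∈ B with β ≤ α, u α) ^ 2
        ≤ ∑ i ∈ B with β ≤ i, ∑ j ∈ B with β ≤ j,
          ((if j ≤ i then u i * u j else 0) + (if i ≤ j then u i * u j else 0)) := by
      rw [sq, sum_mul_sum]
      refine sum_le_sum fun i hi => sum_le_sum fun j hj => ?_
      have h0 : 0 ≤ u i * u j := mul_nonneg (hu i) (hu j)
      rcases forest β i j (mem_filter.1 hi).2 (mem_filter.1 hj).2 with h | h
      · rw [if_pos h]; split_ifs <;> linarith
      · rw [if_pos h]; split_ifs <;> linarith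
    refine h2.trans (le_of_eq ?_)
    simp only [sum_add_distrib]
    have h3 : ∑ i ∈ B with β ≤ i, ∑ j ∈ B with β ≤ j, (if i ≤ j then u i * u j else 0)
        = ∑ i ∈ B with β ≤ i, ∑ j ∈ B with β ≤ j, (if j ≤ i then u i * u j else 0) := by
      rw [sum_comm]
      refine sum_congr rfl fun i _ => sum_congr rfl fun j _ => ?_
      rw [mul_comm]
    rw [h3, ← two_mul]
    congr 1
    simp only [sum_filter, mul_sum]
    refine sum_congr rfl fun i _ => ?_
    by_cases h : β ≤ i
    · rw [if_pos h]
      refine sum_congr rfl fun j _ => ?_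
      split_ifs <;> simp
    · rw [if_neg h]
      symm
      refine sum_eq_zero fun j _ => ?_
      split_ifs with h4 h5
      · exact absurd (h5.trans h4) h
      · simp
      · simp
  calc _ ≤ ∑ β, t β * (2 * ∑ α ∈ B, u α * ∑ α' ∈ B with α' ≤ α, if β ≤ α' then u α' else 0) :=
        sum_le_sum fun β _ => mul_le_mul_of_nonneg_left (h1 β) (ht β)
    _ = _ := by
        simp only [mul_sum, lowSum, sum_filter]
        rw [sum_comm]
        refine sum_congr rfl fun α _ => ?_
        rw [sum_comm]
        refine sum_congr rfl fun α' _ => ?_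
        by_cases h : α' ≤ α
        · simp only [if_pos h, mul_sum]
          refine sum_congr rfl fun β _ => ?_
          split_ifs <;> ring
        · simp [if_neg h]

/-- The testing inequality: below a vertex `F`, the dyadic operator maps the indicator function to a
function of norm at most `(2 Q c D S(F))^{1/2}`. -/
theorem testing_le (forest : ∀ x y z : V, x ≤ y → x ≤ z → y ≤ z ∨ z ≤ y)
    {s t N : V → ℝ} {Q c D : ℝ} (hs : ∀ α, 0 < s α) (ht : ∀ α, 0 < t α)
    (hN : ∀ α, 0 < N α) (hQ : 0 ≤ Q) (hc : 0 ≤ c)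
    (h1 : ∀ α, ∑ β with β ≤ α, N β ≤ c * N α)
    (h2 : ∀ α, lowSum s α * lowSum t α ≤ Q * N α ^ 2)
    (h3 : ∀ α, ∑ β with β ≤ α, lowSum s β ≤ D * lowSum s α)
    (F : V) (B : Finset V) (hB : ∀ α ∈ B, α ≤ F) :
    ∑ β, t β * (∑ α ∈ B with β ≤ α, lowSum s α / N α) ^ 2 ≤ 2 * Q * c * D * lowSum s F := by
  have hS : ∀ α, 0 < lowSum s α := lowSum_pos hs
  refine (sum_mul_sq_sum_le forest B (fun α => (div_pos (hS α) (hN α)).le)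
    (fun α => (ht α).le)).trans ?_
  have h4 : ∀ α, ∑ α' ∈ B with α' ≤ α, lowSum s α' / N α' * lowSum t α' ≤ Q * c * N α := by
    intro α
    calc _ ≤ ∑ α' ∈ B with α' ≤ α, Q * N α' := by
          refine sum_le_sum fun α' _ => ?_
          rw [div_mul_eq_mul_div, div_le_iff₀ (hN α')]
          refine (h2 α').trans (le_of_eq (by ring))
      _ ≤ ∑ α' with α' ≤ α, Q * N α' :=
          sum_le_sum_of_subset_of_nonneg (filter_subset_filter _ (subset_univ _))
            fun i _ _ => mul_nonneg hQ (hN i).le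
      _ ≤ Q * c * N α := by
          rw [← mul_sum, mul_assoc]
          exact mul_le_mul_of_nonneg_left (h1 α) hQ
  calc _ ≤ 2 * ∑ α ∈ B, lowSum s α / N α * (Q * c * N α) := by
        gcongr with α _
        · exact (div_pos (hS α) (hN α)).le
        · exact h4 α
    _ = 2 * (Q * c) * ∑ α ∈ B, lowSum s α := by
        rw [mul_sum, mul_sum]
        refine sum_congr rfl fun α _ => ?_
        have := (hN α).ne'
        field_simp
    _ ≤ 2 * (Q * c) * ∑ α with α ≤ F, lowSum s α := by
        gcongr 2 * (Q * c) * ?_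
        exact sum_le_sum_of_subset_of_nonneg (fun α h => by simpa using hB α h)
          fun i _ _ => (hS i).le
    _ ≤ 2 * (Q * c) * (D * lowSum s F) := by gcongr; exact h3 F
    _ = _ := by ring

/-- The Carleson embedding for a stopping family along which the dyadic size of the averages
strictly increases. -/
theorem carleson_stopping (forest : ∀ x y z : V, x ≤ y → x ≤ z → y ≤ z ∨ z ≤ y)
    {s f a : V → ℝ} (hs : ∀ α, 0 ≤ s α) (hf : ∀ α, 0 ≤ f α)
    (𝓕 : Finset V) (ha : ∀ F ∈ 𝓕, 0 < a F)
    (haS : ∀ F ∈ 𝓕, a F * lowSum s F = lowSum (fun β => f β * s β) F)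
    (hgrow : ∀ F ∈ 𝓕, ∀ G ∈ 𝓕, F < G → Int.log 2 (a G) < Int.log 2 (a F)) :
    ∑ F ∈ 𝓕, a F ^ 2 * lowSum s F ≤ 16 * ∑ β, f β ^ 2 * s β := by
  -- the part of `f` below `a F / 2` carries at most half of the sum defining the average `a F`
  have h1 : ∀ F ∈ 𝓕, a F ^ 2 * lowSum s F ≤
      2 * ∑ β, if β ≤ F ∧ a F ≤ 2 * f β then a F * (f β * s β) else 0 := by
    intro F hF
    have h2 : lowSum (fun β => f β * s β) F ≤
        (∑ β, if β ≤ F ∧ a F ≤ 2 * f β then f β * s β else 0) + a F / 2 * lowSum s F := by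
      simp only [lowSum, sum_filter]
      rw [mul_sum, ← sum_add_distrib]
      refine sum_le_sum fun β _ => ?_
      have := hs β
      have := hf β
      have := ha F hF
      by_cases hβ : β ≤ F
      · by_cases h : a F ≤ 2 * f β
        · simp only [hβ, h, and_self, if_true]
          have : 0 ≤ a F / 2 * s β := by positivity
          linarith
        · simp only [hβ, h, and_false, if_true, if_false, zero_add]
          gcongr
          linarith
      · simp [hβ]
    have h3 : a F * lowSum s F ≤ 2 * ∑ β, if β ≤ F ∧ a F ≤ 2 * f β then f β * s β else 0 := by
      have := haS F hF
      linarith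
    calc a F ^ 2 * lowSum s F = a F * (a F * lowSum s F) := by ring
      _ ≤ a F * (2 * ∑ β, if β ≤ F ∧ a F ≤ 2 * f β then f β * s β else 0) :=
          mul_le_mul_of_nonneg_left h3 (ha F hF).le
      _ = _ := by
          simp only [mul_sum]
          refine sum_congr rfl fun β _ => ?_
          split_ifs <;> ring
  -- along a branch the averages run through distinct dyadic sizes, so the largest one dominates
  have h4 : ∀ β, ∑ F ∈ 𝓕 with β ≤ F ∧ a F ≤ 2 * f β, a F ≤ 8 * f β := by
    intro β
    set P := {F ∈ 𝓕 | β ≤ F ∧ a F ≤ 2 * f β} with hP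
    rcases P.eq_empty_or_nonempty with h | ⟨F₀, hF₀⟩
    · rw [h]; simpa using hf β
    have hP' : ∀ F ∈ P, F ∈ 𝓕 ∧ β ≤ F ∧ a F ≤ 2 * f β := fun F hF => mem_filter.1 hF
    have hfpos : 0 < 2 * f β := (ha F₀ (hP' F₀ hF₀).1).trans_le (hP' F₀ hF₀).2.2
    have hinj : Set.InjOn (fun F => Int.log 2 (a F)) (P : Set V) := by
      intro F hF G hG hFG
      have hF := hP' F hF
      have hG := hP' G hG
      by_contra hne
      simp only at hFG
      rcases forest β F G hF.2.1 hG.2.1 with h | h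
      · have := hgrow F hF.1 G hG.1 (lt_of_le_of_ne h hne); omega
      · have := hgrow G hG.1 F hF.1 (lt_of_le_of_ne h (Ne.symm hne)); omega
    calc ∑ F ∈ P, a F ≤ ∑ F ∈ P, 2 * (2 : ℝ) ^ Int.log 2 (a F) := by
          refine sum_le_sum fun F hF => ?_
          have := Int.lt_zpow_succ_log_self (b := 2) (by norm_num) (a F)
          rw [zpow_add_one₀ (by norm_num)] at this
          push_cast at this
          linarith
      _ = 2 * ∑ k ∈ P.image (fun F => Int.log 2 (a F)), (2 : ℝ) ^ k := by
          rw [sum_image hinj, mul_sum]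
      _ ≤ 2 * (2 * 2 ^ Int.log 2 (2 * f β)) := by
          gcongr
          apply sum_two_zpow_le
          intro k hk
          obtain ⟨F, hF, rfl⟩ := mem_image.1 hk
          exact Int.log_mono_right (ha F (hP' F hF).1) (hP' F hF).2.2
      _ ≤ 2 * (2 * (2 * f β)) := by
          gcongr
          exact_mod_cast Int.zpow_log_le_self (b := 2) (by norm_num) hfpos
      _ = 8 * f β := by ring
  calc _ ≤ ∑ F ∈ 𝓕, 2 * ∑ β, if β ≤ F ∧ a F ≤ 2 * f β then a F * (f β * s β) else 0 :=
        sum_le_sum h1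
    _ = 2 * ∑ β, (f β * s β) * ∑ F ∈ 𝓕 with β ≤ F ∧ a F ≤ 2 * f β, a F := by
        rw [← mul_sum, sum_comm]
        congr 1
        refine sum_congr rfl fun β _ => ?_
        rw [mul_sum, sum_filter]
        refine sum_congr rfl fun F _ => ?_
        split_ifs <;> ring
    _ ≤ 2 * ∑ β, (f β * s β) * (8 * f β) := by
        gcongr with β _
        · exact mul_nonneg (hf β) (hs β)
        · exact h4 β
    _ = _ := by
        rw [mul_sum, mul_sum]
        refine sum_congr rfl fun β _ => by ring

/-- Pairing `g` with a function `Φ` which is constant below each vertex of `ch`: only the averages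
of `g` below these vertices matter. -/
theorem sum_mul_le_of_const {t g b Φ : V → ℝ} (ht : ∀ β, 0 ≤ t β) (hg : ∀ β, 0 ≤ g β)
    (hΦ : ∀ β, 0 ≤ Φ β) (E ch : Finset V)
    (hcover : ∀ β, Φ β ≠ 0 → β ∈ E ∨ ∃ F ∈ ch, β ≤ F)
    (hconst : ∀ F ∈ ch, ∀ β ≤ F, Φ β = Φ F)
    (hdisj : ∀ β, ∀ F ∈ ch, ∀ G ∈ ch, β ≤ F → β ≤ G → F = G)
    (hb : ∀ F ∈ ch, b F * lowSum t F = lowSum (fun β => g β * t β) F) :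
    ∑ β, g β * t β * Φ β ≤ √(∑ β, t β * Φ β ^ 2) *
      (√(∑ β ∈ E, g β ^ 2 * t β) + √(∑ F ∈ ch, b F ^ 2 * lowSum t F)) := by
  have h1 : ∑ β, g β * t β * Φ β ≤ ∑ β ∈ E, g β * t β * Φ β +
      ∑ F ∈ ch, Φ F * lowSum (fun β => g β * t β) F := by
    rw [sum_mul_lowSum, ← sum_filter_add_sum_filter_not univ (· ∈ E), filter_mem_eq_inter,
      univ_inter]
    gcongr ∑ β ∈ E, g β * t β * Φ β + ?_
    have hnn : ∀ β, 0 ≤ g β * t β * ∑ F ∈ ch with β ≤ F, Φ F := fun β =>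
      mul_nonneg (mul_nonneg (hg β) (ht β)) (sum_nonneg fun F _ => hΦ F)
    refine (sum_le_sum fun β hβ => ?_).trans
      (sum_le_sum_of_subset_of_nonneg (filter_subset _ _) fun i _ _ => hnn i)
    by_cases h0 : Φ β = 0
    · rw [h0, mul_zero]; exact hnn β
    obtain h | ⟨F, hF, hle⟩ := hcover β h0
    · exact absurd h (mem_filter.1 hβ).2
    · refine mul_le_mul_of_nonneg_left ?_ (mul_nonneg (hg β) (ht β))
      rw [hconst F hF β hle]
      exact single_le_sum (f := Φ) (fun G _ => hΦ G) (mem_filter.2 ⟨hF, hle⟩)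
  have h2 : ∑ β ∈ E, g β * t β * Φ β ≤
      √(∑ β, t β * Φ β ^ 2) * √(∑ β ∈ E, g β ^ 2 * t β) := by
    calc _ = ∑ β ∈ E, (√(t β) * Φ β) * (g β * √(t β)) := by
          refine sum_congr rfl fun β _ => ?_
          have := Real.mul_self_sqrt (ht β)
          linear_combination -(g β * Φ β) * this
      _ ≤ √(∑ β ∈ E, (√(t β) * Φ β) ^ 2) * √(∑ β ∈ E, (g β * √(t β)) ^ 2) :=
          Real.sum_mul_le_sqrt_mul_sqrt _ _ _
      _ ≤ _ := by
          simp only [mul_pow, Real.sq_sqrt (ht _)]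
          gcongr
          · exact fun i _ _ => mul_nonneg (ht i) (sq_nonneg _)
          · exact subset_univ _
  have h3 : ∑ F ∈ ch, Φ F * lowSum (fun β => g β * t β) F ≤
      √(∑ β, t β * Φ β ^ 2) * √(∑ F ∈ ch, b F ^ 2 * lowSum t F) := by
    have hT := lowSum_nonneg ht
    calc _ = ∑ F ∈ ch, (Φ F * √(lowSum t F)) * (b F * √(lowSum t F)) := by
          refine sum_congr rfl fun F hF => ?_
          have := Real.mul_self_sqrt (hT F)
          rw [← hb F hF]
          linear_combination -(b F * Φ F) * this
      _ ≤ √(∑ F ∈ ch, (Φ F * √(lowSum t F)) ^ 2) * √(∑ F ∈ ch, (b F * √(lowSum t F)) ^ 2) :=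
          Real.sum_mul_le_sqrt_mul_sqrt _ _ _
      _ ≤ _ := by
          simp only [mul_pow, Real.sq_sqrt (hT _)]
          gcongr
          rw [sum_mul_lowSum]
          refine sum_le_sum fun β _ => mul_le_mul_of_nonneg_left ?_ (ht β)
          rcases (ch.filter (β ≤ ·)).eq_empty_or_nonempty with h | ⟨F, hF⟩
          · rw [h, sum_empty]; positivity
          · have hF' := mem_filter.1 hF
            rw [sum_eq_single_of_mem F hF fun G hG hne => absurd
              (hdisj β G (mem_filter.1 hG).1 F hF'.1 (mem_filter.1 hG).2 hF'.2) hne,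
              hconst F hF'.1 β hF'.2]
  linarith

/-- The stopping vertex of `α`: the topmost among the ancestors in `A` at which `ℓ` is largest. -/
theorem exists_stopping_ancestor {V : Type*} [PartialOrder V] (A : Finset V) (ℓ : V → ℤ) {α : V}
    (hα : α ∈ A) :
    ∃ F ∈ A, α ≤ F ∧ (∀ γ ∈ A, α ≤ γ → ℓ γ ≤ ℓ F) ∧ ∀ γ ∈ A, F < γ → ℓ γ < ℓ F := by
  obtain ⟨m, hm, hmax⟩ := exists_max_image (A.filter (α ≤ ·)) ℓ ⟨α, by simp [hα]⟩
  obtain ⟨F, hF, hFmax⟩ := ((A.filter (α ≤ ·)).filter (ℓ · = ℓ m)).exists_maximal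
    ⟨m, by simpa using hm⟩
  simp only [mem_filter] at hm hmax hF hFmax
  refine ⟨F, hF.1.1, hF.1.2, fun γ hγ hle => hF.2 ▸ hmax γ ⟨hγ, hle⟩, fun γ hγ hlt => ?_⟩
  have hγα := hF.1.2.trans hlt.le
  refine lt_of_le_of_ne (hF.2 ▸ hmax γ ⟨hγ, hγα⟩) fun h => ?_
  exact absurd (hFmax ⟨⟨hγ, hγα⟩, h.trans hF.2⟩ hlt.le) (not_le_of_gt hlt)

/-- The part of the bilinear form on which the averages `a` of `f` and `b` of `g` satisfy
`b² t(α) ≤ a² s(α)`. Stopping vertices record the growth of the averages of `f`; those of `g` on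
them are controlled by those of `f`. -/
theorem sum_le_of_dominated (forest : ∀ x y z : V, x ≤ y → x ≤ z → y ≤ z ∨ z ≤ y)
    {s t N f g a b : V → ℝ} {Q c D : ℝ} (hs : ∀ α, 0 < s α)
    (ht : ∀ α, 0 < t α) (hN : ∀ α, 0 < N α) (hQ : 0 ≤ Q) (hc : 0 ≤ c) (hD : 0 ≤ D)
    (h1 : ∀ α, ∑ β with β ≤ α, N β ≤ c * N α)
    (h2 : ∀ α, lowSum s α * lowSum t α ≤ Q * N α ^ 2)
    (h3 : ∀ α, ∑ β with β ≤ α, lowSum s β ≤ D * lowSum s α)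
    (hf : ∀ α, 0 ≤ f α) (hg : ∀ α, 0 ≤ g α)
    (haS : ∀ F, a F * lowSum s F = lowSum (fun β => f β * s β) F)
    (hbT : ∀ F, b F * lowSum t F = lowSum (fun β => g β * t β) F)
    (A : Finset V) (hA : ∀ α ∈ A, 0 < a α ∧ b α ^ 2 * lowSum t α ≤ a α ^ 2 * lowSum s α) :
    ∑ α ∈ A, lowSum (fun β => f β * s β) α * lowSum (fun β => g β * t β) α / N α ≤
      8 * √(2 * Q * c * D) * (√(∑ β, f β ^ 2 * s β) * √(∑ β, g β ^ 2 * t β) +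
        4 * ∑ β, f β ^ 2 * s β) := by
  set ℓ : V → ℤ := fun α => Int.log 2 (a α) with hℓ
  have hS : ∀ α, 0 < lowSum s α := lowSum_pos hs
  have hT : ∀ α, 0 < lowSum t α := lowSum_pos ht
  have hgt : ∀ α, 0 ≤ lowSum (fun β => g β * t β) α :=
    lowSum_nonneg fun β => mul_nonneg (hg β) (ht β).le
  set u : V → ℝ := fun α => lowSum s α / N α with hu_def
  have hu : ∀ α, 0 ≤ u α := fun α => (div_pos (hS α) (hN α)).le
  choose! p hpA hple hpmax hptop using fun α (hα : α ∈ A) => exists_stopping_ancestor A ℓ hα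
  set 𝓕 := A.filter fun F => ∀ γ ∈ A, F < γ → ℓ γ < ℓ F with h𝓕
  have hm𝓕 : ∀ F, F ∈ 𝓕 ↔ F ∈ A ∧ ∀ γ ∈ A, F < γ → ℓ γ < ℓ F := fun F => mem_filter
  have hp𝓕 : ∀ α ∈ A, p α ∈ 𝓕 := fun α hα => (hm𝓕 _).2 ⟨hpA α hα, hptop α hα⟩
  have hcarl : ∑ F ∈ 𝓕, a F ^ 2 * lowSum s F ≤ 16 * ∑ β, f β ^ 2 * s β :=
    carleson_stopping forest (fun α => (hs α).le) hf 𝓕 (fun F hF => (hA F ((hm𝓕 F).1 hF).1).1)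
      (fun F _ => haS F) fun F hF G hG h => ((hm𝓕 F).1 hF).2 G ((hm𝓕 G).1 hG).1 h
  -- `ch F` are the stopping vertices next below `F`; `E F` is what they leave uncovered below `F`
  set E : V → Finset V := fun F => {β | β ≤ F ∧ ¬∃ G ∈ 𝓕, β ≤ G ∧ G < F} with hE
  set ch : V → Finset V := fun F => {G ∈ 𝓕 | G < F ∧ ∀ H ∈ 𝓕, G < H → F ≤ H} with hch
  have hmE : ∀ F β, β ∈ E F ↔ β ≤ F ∧ ¬∃ G ∈ 𝓕, β ≤ G ∧ G < F := fun F β => by simp [hE]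
  have hmch : ∀ F G, G ∈ ch F ↔ G ∈ 𝓕 ∧ G < F ∧ ∀ H ∈ 𝓕, G < H → F ≤ H := fun F G => mem_filter
  -- the dyadic operator of the vertices stopped at `F`, applied to the constant function
  set Φ : V → V → ℝ := fun F β => ∑ α ∈ A.filter (p · = F) with β ≤ α, u α with hΦ_def
  have hΦ0 : ∀ F β, 0 ≤ Φ F β := fun F β => sum_nonneg fun α _ => hu α
  have hlocal : ∀ F ∈ 𝓕, ∑ β, g β * t β * Φ F β ≤ √(2 * Q * c * D * lowSum s F) *
      (√(∑ β ∈ E F, g β ^ 2 * t β) + √(∑ G ∈ ch F, b G ^ 2 * lowSum t G)) := by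
    intro F hF
    have htest := testing_le forest hs ht hN hQ hc h1 h2 h3 F (A.filter (p · = F)) fun α hα => by
      obtain ⟨hαA, rfl⟩ := mem_filter.1 hα
      exact hple α hαA
    refine (sum_mul_le_of_const (b := b) (fun β => (ht β).le) hg (hΦ0 F) (E F) (ch F) ?_ ?_ ?_
      fun G _ => hbT G).trans ?_
    · intro β hβ
      obtain ⟨α, hα, _⟩ := exists_ne_zero_of_sum_ne_zero hβ
      simp only [mem_filter] at hα
      have hβF : β ≤ F := hα.2.trans (hα.1.2 ▸ hple α hα.1.1)
      by_cases h : ∃ G ∈ 𝓕, β ≤ G ∧ G < F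
      · right
        obtain ⟨G₀, hG₀⟩ := h
        obtain ⟨G, hG, hGmax⟩ := (𝓕.filter fun G => β ≤ G ∧ G < F).exists_maximal
          ⟨G₀, mem_filter.2 hG₀⟩
        simp only [mem_filter] at hG hGmax
        refine ⟨G, (hmch F G).2 ⟨hG.1, hG.2.2, fun H hH hGH => ?_⟩, hG.2.1⟩
        have hβH := hG.2.1.trans hGH.le
        rcases forest β F H hβF hβH with h | h
        · exact h
        · rcases h.eq_or_lt with h | h
          · exact h.ge
          · exact absurd (hGmax ⟨hH, hβH, h⟩ hGH.le) (not_le_of_gt hGH)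
      · exact Or.inl ((hmE F β).2 ⟨hβF, h⟩)
    · intro G hG β hβ
      obtain ⟨hG𝓕, hGF, -⟩ := (hmch F G).1 hG
      simp only [hΦ_def]
      congr 1
      ext α
      simp only [mem_filter]
      refine and_congr_right fun hα => ⟨fun hβα => ?_, fun h => hβ.trans h⟩
      -- otherwise `G` would be an ancestor of `α`, with larger averages than its stopping vertex
      rcases forest β α G hβα hβ with h | h
      · have h4 := hpmax α hα.1 G ((hm𝓕 G).1 hG𝓕).1 h
        rw [hα.2] at h4
        have h5 := ((hm𝓕 G).1 hG𝓕).2 F ((hm𝓕 F).1 hF).1 hGF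
        omega
      · exact h
    · intro β G hG H hH hβG hβH
      have hG := (hmch F G).1 hG
      have hH := (hmch F H).1 hH
      by_contra hne
      rcases forest β G H hβG hβH with h | h
      · exact absurd (hG.2.2 H hH.1 (lt_of_le_of_ne h hne)) (not_le_of_gt hH.2.1)
      · exact absurd (hH.2.2 G hG.1 (lt_of_le_of_ne h (Ne.symm hne))) (not_le_of_gt hG.2.1)
    · gcongr
  have hsumE : ∑ F ∈ 𝓕, ∑ β ∈ E F, g β ^ 2 * t β ≤ ∑ β, g β ^ 2 * t β := by
    rw [← sum_biUnion]
    · exact sum_le_sum_of_subset_of_nonneg (subset_univ _)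
        fun i _ _ => mul_nonneg (sq_nonneg _) (ht i).le
    · intro F hF G hG hne
      rw [Function.onFun, disjoint_left]
      intro β hβF hβG
      rw [hmE] at hβF hβG
      rcases forest β F G hβF.1 hβG.1 with h | h
      · exact hβG.2 ⟨F, hF, hβF.1, lt_of_le_of_ne h hne⟩
      · exact hβF.2 ⟨G, hG, hβG.1, lt_of_le_of_ne h (Ne.symm hne)⟩
  have hsumch : ∑ F ∈ 𝓕, ∑ G ∈ ch F, b G ^ 2 * lowSum t G ≤ 16 * ∑ β, f β ^ 2 * s β := by
    rw [← sum_biUnion]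
    · calc _ ≤ ∑ G ∈ 𝓕, b G ^ 2 * lowSum t G :=
            sum_le_sum_of_subset_of_nonneg
              (biUnion_subset.2 fun F _ G hG => ((hmch F G).1 hG).1)
              fun i _ _ => mul_nonneg (sq_nonneg _) (hT i).le
        _ ≤ ∑ G ∈ 𝓕, a G ^ 2 * lowSum s G :=
            sum_le_sum fun G hG => (hA G ((hm𝓕 G).1 hG).1).2
        _ ≤ _ := hcarl
    · intro F hF G hG hne
      rw [Function.onFun, disjoint_left]
      intro H hHF hHG
      rw [hmch] at hHF hHG
      exact hne (le_antisymm (hHF.2.2 G hG hHG.2.1) (hHG.2.2 F hF hHF.2.1))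
  set X := ∑ β, f β ^ 2 * s β with hX
  set Y := ∑ β, g β ^ 2 * t β with hY
  have hX0 : 0 ≤ X := sum_nonneg fun β _ => mul_nonneg (sq_nonneg _) (hs β).le
  have hsqrt16 : √(16 * X) = 4 * √X := by
    rw [Real.sqrt_mul (by norm_num), show (16 : ℝ) = 4 ^ 2 by norm_num,
      Real.sqrt_sq (by norm_num)]
  have hCS : ∀ e : V → ℝ, (∀ F, 0 ≤ e F) → ∀ Z, ∑ F ∈ 𝓕, e F ≤ Z →
      ∑ F ∈ 𝓕, a F * √(lowSum s F) * √(e F) ≤ 4 * √X * √Z := by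
    intro e he Z hZ
    refine (Real.sum_mul_le_sqrt_mul_sqrt _ _ _).trans ?_
    simp only [mul_pow, Real.sq_sqrt (hS _).le, Real.sq_sqrt (he _)]
    rw [← hsqrt16]
    gcongr
  calc _ = ∑ α ∈ A, a α * (u α * lowSum (fun β => g β * t β) α) := by
        refine sum_congr rfl fun α _ => ?_
        rw [← haS α, hu_def]; ring
    _ = ∑ F ∈ 𝓕, ∑ α ∈ A with p α = F, a α * (u α * lowSum (fun β => g β * t β) α) :=
        (sum_fiberwise_of_maps_to hp𝓕 _).symm
    _ ≤ ∑ F ∈ 𝓕, 2 * a F * ∑ β, g β * t β * Φ F β := by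
        refine sum_le_sum fun F hF => ?_
        rw [hΦ_def, ← sum_mul_lowSum (A.filter (p · = F)) u fun β => g β * t β, mul_sum]
        refine sum_le_sum fun α hα => ?_
        obtain ⟨hαA, rfl⟩ := mem_filter.1 hα
        refine mul_le_mul_of_nonneg_right ?_ (mul_nonneg (hu α) (hgt α))
        -- `a α ≤ 2 * a (p α)`, as the dyadic size is largest at the stopping vertex
        have h4 := Int.lt_zpow_succ_log_self (b := 2) (by norm_num) (a α)
        have h5 : (2 : ℝ) ^ (Int.log 2 (a α) + 1) ≤ 2 ^ (Int.log 2 (a (p α)) + 1) :=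
          zpow_le_zpow_right₀ (by norm_num) (by
            have := hpmax α hαA α hαA le_rfl
            simp only [hℓ] at this; omega)
        have h6 : (2 : ℝ) ^ Int.log 2 (a (p α)) ≤ a (p α) := by
          exact_mod_cast Int.zpow_log_le_self (b := 2) (by norm_num) (hA _ (hpA α hαA)).1
        rw [zpow_add_one₀ (by norm_num) (Int.log 2 (a (p α)))] at h5
        push_cast at h4
        linarith
    _ ≤ ∑ F ∈ 𝓕, 2 * a F * (√(2 * Q * c * D * lowSum s F) *
          (√(∑ β ∈ E F, g β ^ 2 * t β) + √(∑ G ∈ ch F, b G ^ 2 * lowSum t G))) := by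
        refine sum_le_sum fun F hF => mul_le_mul_of_nonneg_left (hlocal F hF) ?_
        have := (hA F ((hm𝓕 F).1 hF).1).1
        linarith
    _ = 2 * √(2 * Q * c * D) * (∑ F ∈ 𝓕, a F * √(lowSum s F) * √(∑ β ∈ E F, g β ^ 2 * t β) +
          ∑ F ∈ 𝓕, a F * √(lowSum s F) * √(∑ G ∈ ch F, b G ^ 2 * lowSum t G)) := by
        rw [← sum_add_distrib, mul_sum]
        refine sum_congr rfl fun F _ => ?_
        rw [Real.sqrt_mul (by positivity)]
        ring
    _ ≤ 2 * √(2 * Q * c * D) * (4 * √X * √Y + 4 * √X * √(16 * X)) := by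
        gcongr
        · exact hCS _ (fun F => sum_nonneg fun β _ => mul_nonneg (sq_nonneg _) (ht β).le) _ hsumE
        · exact hCS _ (fun F => sum_nonneg fun β _ => mul_nonneg (sq_nonneg _) (hT β).le) _ hsumch
    _ = _ := by
        rw [hsqrt16]
        have := Real.mul_self_sqrt hX0
        linear_combination 32 * √(2 * Q * c * D) * this

/-- The two-weight inequality for the positive dyadic operator on a finite forest. -/
theorem sum_sq_dyadic_le (forest : ∀ x y z : V, x ≤ y → x ≤ z → y ≤ z ∨ z ≤ y)
    {s t N f : V → ℝ} {Q c D D' : ℝ} (hs : ∀ α, 0 < s α) (ht : ∀ α, 0 < t α) (hN : ∀ α, 0 < N α)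
    (h1 : ∀ α, ∑ β with β ≤ α, N β ≤ c * N α)
    (h2 : ∀ α, lowSum s α * lowSum t α ≤ Q * N α ^ 2)
    (h3 : ∀ α, ∑ β with β ≤ α, lowSum s β ≤ D * lowSum s α)
    (h3' : ∀ α, ∑ β with β ≤ α, lowSum t β ≤ D' * lowSum t α)
    (hf : ∀ α, 0 ≤ f α) :
    ∑ β, (∑ α with β ≤ α, lowSum (fun γ => f γ * s γ) α / N α) ^ 2 * t β ≤
      25600 * (Q * c * (D + D')) * ∑ β, f β ^ 2 * s β := by
  rcases isEmpty_or_nonempty V with hV | ⟨⟨v⟩⟩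
  · simp
  have hS : ∀ α, 0 < lowSum s α := lowSum_pos hs
  have hT : ∀ α, 0 < lowSum t α := lowSum_pos ht
  have hone : ∀ {m : V → ℝ} {K : ℝ}, (∀ α, 0 < m α) → (∑ β with β ≤ v, m β ≤ K * m v) → 0 < K := by
    intro m K hm h
    have h4 : m v ≤ K * m v :=
      (single_le_sum (f := m) (fun i _ => (hm i).le) (by simp)).trans h
    exact pos_of_mul_pos_left ((hm v).trans_le h4) (hm v).le
  have hc : 0 < c := hone hN (h1 v)
  have hD : 0 < D := hone hS (h3 v)
  have hD' : 0 < D' := hone hT (h3' v)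
  have hQ : 0 < Q :=
    pos_of_mul_pos_left ((mul_pos (hS v) (hT v)).trans_le (h2 v)) (sq_nonneg _)
  have hfs : ∀ α, 0 ≤ lowSum (fun γ => f γ * s γ) α :=
    lowSum_nonneg fun β => mul_nonneg (hf β) (hs β).le
  set τ : V → ℝ := fun β => ∑ α with β ≤ α, lowSum (fun γ => f γ * s γ) α / N α with hτ
  have hτ0 : ∀ β, 0 ≤ τ β := fun β => sum_nonneg fun α _ => div_nonneg (hfs α) (hN α).le
  set X := ∑ β, f β ^ 2 * s β with hX
  set Y := ∑ β, τ β ^ 2 * t β with hY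
  have hX0 : 0 ≤ X := sum_nonneg fun β _ => mul_nonneg (sq_nonneg _) (hs β).le
  have hY0 : 0 ≤ Y := sum_nonneg fun β _ => mul_nonneg (sq_nonneg _) (ht β).le
  have hYeq : Y = ∑ α, lowSum (fun γ => f γ * s γ) α * lowSum (fun γ => τ γ * t γ) α / N α := by
    have := sum_mul_lowSum univ (fun α => lowSum (fun γ => f γ * s γ) α / N α) fun γ => τ γ * t γ
    calc Y = ∑ β, τ β * t β * τ β := sum_congr rfl fun β _ => by ring
      _ = _ := by
        rw [← this]
        exact sum_congr rfl fun α _ => by ring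
  -- the bilinear form at `f` and `l • τ`, where the scalar `l` is chosen at the end
  have key : ∀ l : ℝ, 0 < l → l * Y ≤ (8 * √(2 * Q * c * D) + 8 * √(2 * Q * c * D')) *
      (√X * √(l ^ 2 * Y) + 4 * X + 4 * (l ^ 2 * Y)) := by
    intro l hl
    set g : V → ℝ := fun β => l * τ β with hg_def
    have hg : ∀ β, 0 ≤ g β := fun β => mul_nonneg hl.le (hτ0 β)
    have hgY : ∑ β, g β ^ 2 * t β = l ^ 2 * Y := by
      rw [hY, mul_sum]; exact sum_congr rfl fun β _ => by rw [hg_def]; ring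
    have hgl : ∀ α, lowSum (fun γ => g γ * t γ) α = l * lowSum (fun γ => τ γ * t γ) α := fun α => by
      rw [lowSum, lowSum, mul_sum]; exact sum_congr rfl fun β _ => by rw [hg_def]; ring
    set a : V → ℝ := fun α => lowSum (fun γ => f γ * s γ) α / lowSum s α with ha
    set b : V → ℝ := fun α => lowSum (fun γ => g γ * t γ) α / lowSum t α with hb
    have hgt : ∀ α, 0 ≤ lowSum (fun γ => g γ * t γ) α :=
      lowSum_nonneg fun β => mul_nonneg (hg β) (ht β).le
    have haS : ∀ α, a α * lowSum s α = lowSum (fun γ => f γ * s γ) α := fun α =>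
      div_mul_cancel₀ _ (hS α).ne'
    have hbT : ∀ α, b α * lowSum t α = lowSum (fun γ => g γ * t γ) α := fun α =>
      div_mul_cancel₀ _ (hT α).ne'
    have ha0 : ∀ α, 0 ≤ a α := fun α => div_nonneg (hfs α) (hS α).le
    have hb0 : ∀ α, 0 ≤ b α := fun α => div_nonneg (hgt α) (hT α).le
    set A : Finset V := {α | 0 < a α ∧ b α ^ 2 * lowSum t α ≤ a α ^ 2 * lowSum s α} with hA
    set A' : Finset V := {α | 0 < b α ∧ a α ^ 2 * lowSum s α ≤ b α ^ 2 * lowSum t α} with hA'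
    have hXA := sum_le_of_dominated forest hs ht hN hQ.le hc.le hD.le h1 h2 h3 hf hg haS hbT A
      fun α hα => (mem_filter.1 hα).2
    have hXA' := sum_le_of_dominated forest ht hs hN hQ.le hc.le hD'.le h1
      (fun α => by rw [mul_comm]; exact h2 α) h3' hg hf hbT haS A' fun α hα => (mem_filter.1 hα).2
    rw [hgY] at hXA hXA'
    have hsplit : l * Y ≤
        ∑ α ∈ A, lowSum (fun β => f β * s β) α * lowSum (fun β => g β * t β) α / N α +
        ∑ α ∈ A', lowSum (fun β => g β * t β) α * lowSum (fun β => f β * s β) α / N α := by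
      have e : l * Y =
          ∑ α, lowSum (fun β => f β * s β) α * lowSum (fun β => g β * t β) α / N α := by
        rw [hYeq, mul_sum]
        exact sum_congr rfl fun α _ => by rw [hgl]; ring
      rw [e, hA, hA', sum_filter, sum_filter, ← sum_add_distrib]
      refine sum_le_sum fun α _ => ?_
      have hnn : 0 ≤ lowSum (fun β => f β * s β) α * lowSum (fun β => g β * t β) α / N α :=
        div_nonneg (mul_nonneg (hfs α) (hgt α)) (hN α).le
      have hnn' := hnn
      rw [mul_comm (lowSum (fun β => f β * s β) α)] at hnn'
      rcases (ha0 α).eq_or_lt with h | h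
      · rw [← haS α, ← h, zero_mul, zero_mul, mul_zero, zero_div]; simp
      rcases (hb0 α).eq_or_lt with h' | h'
      · rw [← hbT α, ← h', zero_mul, zero_mul, mul_zero, zero_div]; simp
      rcases le_total (b α ^ 2 * lowSum t α) (a α ^ 2 * lowSum s α) with h5 | h5
      · rw [if_pos ⟨h, h5⟩]; split_ifs <;> linarith
      · rw [if_pos (⟨h', h5⟩ : 0 < b α ∧ _), mul_comm (lowSum (fun β => f β * s β) α)]
        split_ifs <;> linarith
    have p1 := Real.sqrt_nonneg (2 * Q * c * D)
    have p2 := Real.sqrt_nonneg (2 * Q * c * D')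
    have hlY : 0 ≤ l ^ 2 * Y := by positivity
    have q1 := mul_nonneg p1 hlY
    have q2 := mul_nonneg p2 hX0
    rw [mul_comm (√(l ^ 2 * Y))] at hXA'
    nlinarith
  set κ := 8 * √(2 * Q * c * D) + 8 * √(2 * Q * c * D') with hκ
  have hκ0 : 0 < κ := by positivity
  have hκ2 : κ ^ 2 ≤ 256 * (Q * c * (D + D')) := by
    have e1 : √(2 * Q * c * D) ^ 2 = 2 * Q * c * D := Real.sq_sqrt (by positivity)
    have e2 : √(2 * Q * c * D') ^ 2 = 2 * Q * c * D' := Real.sq_sqrt (by positivity)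
    nlinarith [sq_nonneg (√(2 * Q * c * D) - √(2 * Q * c * D'))]
  have hfin := key (1 / (8 * κ)) (by positivity)
  rw [Real.sqrt_mul (by positivity), Real.sqrt_sq (by positivity)] at hfin
  have hx := Real.sq_sqrt hX0
  have hy := Real.sq_sqrt hY0
  have h6 : Y ≤ 100 * κ ^ 2 * X := by
    set x := √X
    set y := √Y
    rw [← hx, ← hy] at hfin ⊢
    field_simp at hfin
    nlinarith [sq_nonneg (y - 4 * κ * x), sq_nonneg (κ * x)]
  calc Y ≤ 100 * κ ^ 2 * X := h6
    _ ≤ 100 * (256 * (Q * c * (D + D'))) * X := by gcongr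
    _ = _ := by ring

end Forest

end

section

/-! ### The dyadic operator of one tree -/

theorem sq_lintegral_le {X : Type*} [MeasurableSpace X] {μ : Measure X} {f : X → ℝ≥0∞}
    (hf : AEMeasurable f μ) :
    (∫⁻ x, f x ∂μ) ^ 2 ≤ μ Set.univ * ∫⁻ x, f x ^ 2 ∂μ := by
  have h := ENNReal.lintegral_mul_le_Lp_mul_Lq μ Real.HolderConjugate.two_two
    (aemeasurable_const (b := (1 : ℝ≥0∞))) hf
  simp only [Pi.mul_apply, one_mul, ENNReal.rpow_two, one_pow, lintegral_one] at h
  calc _ ≤ (μ Set.univ ^ (1 / 2 : ℝ) * (∫⁻ x, f x ^ 2 ∂μ) ^ (1 / 2 : ℝ)) ^ 2 := by gcongr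
    _ = _ := by
      rw [mul_pow, ← ENNReal.rpow_natCast, ← ENNReal.rpow_natCast, ← ENNReal.rpow_mul,
        ← ENNReal.rpow_mul]
      norm_num

theorem sq_setLIntegral_le {X : Type*} [MeasurableSpace X] {μ : Measure X} {f : X → ℝ≥0∞}
    (hf : AEMeasurable f μ) (E : Set X) :
    (∫⁻ z in E, f z ∂μ) ^ 2 ≤ μ E * ∫⁻ z in E, f z ^ 2 ∂μ := by
  simpa using sq_lintegral_le (μ := μ.restrict E) hf.restrict

namespace BergmanTree

variable {d : ℕ} {R δ : ℝ} (T : BergmanTree d R δ)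

theorem sum_measure_kube_le (hR : 0 < R) (μ : Measure (Cd d)) {α : T.Vertex} {B : Finset T.Vertex}
    (hB : ∀ β ∈ B, β ≤ α) : ∑ β ∈ B, μ (T.kube β) ≤ μ (T.tent α) := by
  rw [← measure_biUnion_finset]
  · exact measure_mono (Set.iUnion₂_subset fun β hβ => T.kube_subset_tent (hB β hβ))
  · intro β _ γ _ hne
    rw [Function.onFun, Set.disjoint_left]
    exact fun x h1 h2 => hne (T.kube_disjoint hR h1 h2)
  · exact fun β _ => T.measurableSet_kube β

theorem sum_lintegral_kube_le (hR : 0 < R) (μ : Measure (Cd d)) (f : Cd d → ℝ≥0∞) {α : T.Vertex}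
    {B : Finset T.Vertex} (hB : ∀ β ∈ B, β ≤ α) :
    ∑ β ∈ B, ∫⁻ z in T.kube β, f z ∂μ ≤ ∫⁻ z in T.tent α, f z ∂μ := by
  rw [← lintegral_biUnion_finset]
  · exact lintegral_mono_set (Set.iUnion₂_subset fun β hβ => T.kube_subset_tent (hB β hβ))
  · intro β _ γ _ hne
    rw [Function.onFun, Set.disjoint_left]
    exact fun x h1 h2 => hne (T.kube_disjoint hR h1 h2)
  · exact fun β _ => T.measurableSet_kube β

/-- The part of the tent over `β` which is not covered by smaller tents from `S`. -/
def cell (S : Finset T.Vertex) (β : T.Vertex) : Set (Cd d) :=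
  T.tent β \ ⋃ γ ∈ {γ | γ ∈ S ∧ γ < β}, T.tent γ

variable {S : Finset T.Vertex}

theorem measurableSet_cell (β : T.Vertex) : MeasurableSet (T.cell S β) :=
  (T.measurableSet_tent β).diff (MeasurableSet.biUnion (Set.to_countable _)
    fun γ _ => T.measurableSet_tent γ)

theorem kube_subset_cell (hR : 0 < R) (β : T.Vertex) : T.kube β ⊆ T.cell S β := fun x hx => by
  refine ⟨T.kube_subset_tent le_rfl hx, fun h => ?_⟩
  simp only [Set.mem_iUnion] at h
  obtain ⟨γ, ⟨_, hγ⟩, h⟩ := h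
  obtain ⟨β', h1, h2⟩ := T.mem_tent.1 h
  rw [T.kube_disjoint hR h2 hx] at h1
  exact absurd h1 (not_le_of_gt hγ)

theorem mem_tent_iff_of_mem_cell (hR : 0 < R) {α β : T.Vertex} (hα : α ∈ S) {x : Cd d}
    (hx : x ∈ T.cell S β) : x ∈ T.tent α ↔ β ≤ α := by
  refine ⟨fun h => ?_, fun h => T.tent_mono h hx.1⟩
  rcases T.le_or_le_of_mem_tent hR hx.1 h with h1 | h1
  · exact h1
  · rcases h1.eq_or_lt with h1 | h1
    · exact h1.ge
    · exact absurd (Set.mem_biUnion (show α ∈ {γ | γ ∈ S ∧ γ < β} from ⟨hα, h1⟩) h) hx.2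

theorem exists_mem_cell {α : T.Vertex} (hα : α ∈ S) {x : Cd d} (hx : x ∈ T.tent α) :
    ∃ β ∈ S, β ≤ α ∧ x ∈ T.cell S β := by
  classical
  obtain ⟨β, hβ, hmin⟩ := (S.filter fun β => β ≤ α ∧ x ∈ T.tent β).exists_minimal
    ⟨α, Finset.mem_filter.2 ⟨hα, le_rfl, hx⟩⟩
  simp only [Finset.mem_filter] at hβ hmin
  refine ⟨β, hβ.1, hβ.2.1, hβ.2.2, fun h => ?_⟩
  simp only [Set.mem_iUnion] at h
  obtain ⟨γ, ⟨hγS, hγ⟩, h⟩ := h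
  exact absurd (hmin ⟨hγS, hγ.le.trans hβ.2.1, h⟩ hγ.le) (not_le_of_gt hγ)

theorem cell_disjoint (hR : 0 < R) {β γ : T.Vertex} (hβ : β ∈ S) (hγ : γ ∈ S) (hne : β ≠ γ) :
    Disjoint (T.cell S β) (T.cell S γ) := by
  rw [Set.disjoint_left]
  intro x h1 h2
  exact hne (le_antisymm ((T.mem_tent_iff_of_mem_cell hR hγ h1).1 h2.1)
    ((T.mem_tent_iff_of_mem_cell hR hβ h2).1 h1.1))

open scoped Classical in
theorem tent_eq_biUnion_cell (α : S) :
    T.tent α = ⋃ β ∈ (Finset.univ.filter (· ≤ α) : Finset S), T.cell S β := by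
  ext x
  simp only [Finset.mem_filter, Finset.mem_univ, true_and, Set.mem_iUnion, exists_prop]
  constructor
  · intro h
    obtain ⟨β, h1, h2, h3⟩ := T.exists_mem_cell α.2 h
    exact ⟨⟨β, h1⟩, h2, h3⟩
  · rintro ⟨β, h1, h2⟩
    exact T.tent_mono h1 h2.1

open scoped Classical in
theorem lintegral_tent_eq_sum_cell (hR : 0 < R) (α : S) (μ : Measure (Cd d)) (f : Cd d → ℝ≥0∞) :
    ∫⁻ z in T.tent α, f z ∂μ = ∑ β : S with β ≤ α, ∫⁻ z in T.cell S β, f z ∂μ := by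
  rw [T.tent_eq_biUnion_cell, lintegral_biUnion_finset]
  · exact fun β _ γ _ hne => T.cell_disjoint hR β.2 γ.2 fun h => hne (Subtype.ext h)
  · exact fun β _ => T.measurableSet_cell β

/-- The coefficient of `1_{K̂}` in the positive dyadic operator applied to `f dμ`. -/
def coeff (μ : Measure (Cd d)) (f : Cd d → ℝ≥0∞) (α : T.Vertex) : ℝ≥0∞ :=
  (∫⁻ z in T.tent α, f z ∂μ) / nu d (T.tent α)

/-- The positive dyadic operator of the tree, applied to `f dμ`. -/
def dyadicOp (μ : Measure (Cd d)) (f : Cd d → ℝ≥0∞) (z : Cd d) : ℝ≥0∞ :=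
  ∑' α : T.Vertex, (T.tent α).indicator (fun _ => T.coeff μ f α) z

/-- The finite version of the two-weight inequality for the dyadic operator: the cells of a finite
set of tents carry the masses of the finite forest inequality. -/
theorem lintegral_sum_sq_le (hR : 0 < R) {μ₁ μ₂ : Measure (Cd d)}
    [IsFiniteMeasure μ₁] [IsFiniteMeasure μ₂] (hpos₁ : ∀ α, 0 < μ₁ (T.kube α))
    (hpos₂ : ∀ α, 0 < μ₂ (T.kube α)) (hposν : ∀ α, 0 < nu d (T.kube α)) {Q c D₁ D₂ : ℝ}
    (hQ : 0 ≤ Q) (hc : 0 ≤ c) (hD₁ : 0 ≤ D₁) (hD₂ : 0 ≤ D₂)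
    (h1 : ∀ α (B : Finset T.Vertex), (∀ β ∈ B, β ≤ α) →
      ∑ β ∈ B, nu d (T.tent β) ≤ ENNReal.ofReal c * nu d (T.tent α))
    (h2 : ∀ α, μ₁ (T.tent α) * μ₂ (T.tent α) ≤ ENNReal.ofReal Q * nu d (T.tent α) ^ 2)
    (h3 : ∀ α (B : Finset T.Vertex), (∀ β ∈ B, β ≤ α) →
      ∑ β ∈ B, μ₁ (T.tent β) ≤ ENNReal.ofReal D₁ * μ₁ (T.tent α))
    (h3' : ∀ α (B : Finset T.Vertex), (∀ β ∈ B, β ≤ α) →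
      ∑ β ∈ B, μ₂ (T.tent β) ≤ ENNReal.ofReal D₂ * μ₂ (T.tent α))
    {f : Cd d → ℝ≥0∞} (hf : AEMeasurable f μ₁) (hf2 : ∫⁻ z, f z ^ 2 ∂μ₁ ≠ ∞)
    (S : Finset T.Vertex) :
    ∫⁻ z, (∑ α ∈ S, (T.tent α).indicator (fun _ => T.coeff μ₁ f α) z) ^ 2 ∂μ₂ ≤
      ENNReal.ofReal (25600 * (Q * c * (D₁ + D₂))) * ∫⁻ z, f z ^ 2 ∂μ₁ := by
  classical
  have hfE : ∀ E : Set (Cd d), ∫⁻ z in E, f z ∂μ₁ ≠ ∞ := fun E h => by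
    have := sq_setLIntegral_le hf E
    rw [h] at this
    have h4 : μ₁ E * ∫⁻ z in E, f z ^ 2 ∂μ₁ ≠ ∞ :=
      ENNReal.mul_ne_top (measure_ne_top _ _)
        (ne_top_of_le_ne_top hf2 (setLIntegral_le_lintegral _ _))
    exact h4 (top_le_iff.1 (by simpa using this))
  have hcell : ∀ (μ : Measure (Cd d)) [IsFiniteMeasure μ], (∀ α, 0 < μ (T.kube α)) →
      ∀ β : S, 0 < (μ (T.cell S β)).toReal := fun μ _ hμ β =>
    ENNReal.toReal_pos ((hμ β).trans_le (measure_mono (T.kube_subset_cell hR _))).ne'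
      (measure_ne_top _ _)
  have hlow : ∀ (μ : Measure (Cd d)) [IsFiniteMeasure μ] (α : S),
      lowSum (fun β : S => (μ (T.cell S β)).toReal) α = (μ (T.tent α)).toReal := fun μ _ α => by
    have := T.lintegral_tent_eq_sum_cell hR α μ fun _ => 1
    simp only [setLIntegral_one] at this
    rw [this, ENNReal.toReal_sum fun β _ => measure_ne_top _ _]
    rfl
  have hsum : ∀ (μ : Measure (Cd d)) [IsFiniteMeasure μ] {D : ℝ}, 0 ≤ D →
      (∀ α (B : Finset T.Vertex), (∀ β ∈ B, β ≤ α) →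
        ∑ β ∈ B, μ (T.tent β) ≤ ENNReal.ofReal D * μ (T.tent α)) →
      ∀ α : S, ∑ β : S with β ≤ α, (μ (T.tent β)).toReal ≤ D * (μ (T.tent α)).toReal := by
    intro μ _ D hD h α
    have h4 := h α ((Finset.univ.filter (· ≤ α) : Finset S).map (Function.Embedding.subtype _))
      (by
        intro β hβ
        obtain ⟨γ, hγ, rfl⟩ := Finset.mem_map.1 hβ
        exact (Finset.mem_filter.1 hγ).2)
    rw [Finset.sum_map] at h4
    have h5 := ENNReal.toReal_mono
      (ENNReal.mul_ne_top ENNReal.ofReal_ne_top (measure_ne_top _ _)) h4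
    rwa [ENNReal.toReal_sum fun β _ => measure_ne_top _ _, ENNReal.toReal_mul,
      ENNReal.toReal_ofReal hD] at h5
  set s : S → ℝ := fun β => (μ₁ (T.cell S β)).toReal with hs
  set t : S → ℝ := fun β => (μ₂ (T.cell S β)).toReal with ht
  set N : S → ℝ := fun β => (nu d (T.tent β)).toReal with hN
  set I : S → ℝ≥0∞ := fun β => ∫⁻ z in T.cell S β, f z ∂μ₁ with hI
  -- `F β` is the average of `f` over the cell of `β`
  set F : S → ℝ := fun β => (I β).toReal / s β with hF
  have hs0 : ∀ β, 0 < s β := hcell μ₁ hpos₁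
  have ht0 : ∀ β, 0 < t β := hcell μ₂ hpos₂
  have hνtent : ∀ α, 0 < nu d (T.tent α) := fun α =>
    (hposν α).trans_le (measure_mono (T.kube_subset_tent le_rfl))
  have hN0 : ∀ β, 0 < N β := fun β => ENNReal.toReal_pos (hνtent β).ne' (measure_ne_top _ _)
  have hF0 : ∀ β, 0 ≤ F β := fun β => div_nonneg ENNReal.toReal_nonneg (hs0 β).le
  have hcoeff : ∀ α : S, T.coeff μ₁ f α =
      ENNReal.ofReal (lowSum (fun γ => F γ * s γ) α / N α) := fun α => by
    have h4 : lowSum (fun γ => F γ * s γ) α = (∫⁻ z in T.tent α, f z ∂μ₁).toReal := by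
      rw [T.lintegral_tent_eq_sum_cell hR, ENNReal.toReal_sum fun β _ => hfE _]
      refine Finset.sum_congr rfl fun β _ => ?_
      rw [hF]; exact div_mul_cancel₀ _ (hs0 β).ne'
    rw [h4, coeff, ENNReal.ofReal_div_of_pos (hN0 α), ENNReal.ofReal_toReal (hfE _),
      ENNReal.ofReal_toReal (measure_ne_top _ _)]
  have main := sum_sq_dyadic_le (V := S) (s := s) (t := t) (N := N) (f := F) (Q := Q) (c := c)
    (D := D₁) (D' := D₂) (fun x y z h h' => T.le_or_le_of_le h h') hs0 ht0 hN0
    (hsum (nu d) hc h1) (fun α => by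
      rw [hs, ht, hlow, hlow]
      have := ENNReal.toReal_mono (ENNReal.mul_ne_top ENNReal.ofReal_ne_top
        (ENNReal.pow_ne_top (measure_ne_top _ _))) (h2 α)
      rwa [ENNReal.toReal_mul, ENNReal.toReal_mul, ENNReal.toReal_pow,
        ENNReal.toReal_ofReal hQ] at this)
    (fun α => by simp only [hs, hlow]; exact hsum μ₁ hD₁ h3 α)
    (fun α => by simp only [ht, hlow]; exact hsum μ₂ hD₂ h3' α) hF0
  set τ : S → ℝ := fun β => ∑ α with β ≤ α, lowSum (fun γ => F γ * s γ) α / N α with hτ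
  have hlowF : ∀ α, 0 ≤ lowSum (fun γ => F γ * s γ) α / N α := fun α =>
    div_nonneg (lowSum_nonneg (fun β => mul_nonneg (hF0 β) (hs0 β).le) α) (hN0 α).le
  have hval : ∀ β : S, ∀ z ∈ T.cell S β,
      ∑ α ∈ S, (T.tent α).indicator (fun _ => T.coeff μ₁ f α) z = ENNReal.ofReal (τ β) := by
    intro β z hz
    rw [hτ, ENNReal.ofReal_sum_of_nonneg fun α _ => hlowF α, Finset.sum_filter,
      ← Finset.sum_coe_sort S fun α => (T.tent α).indicator (fun _ => T.coeff μ₁ f α) z]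
    refine Finset.sum_congr rfl fun α _ => ?_
    have h4 := T.mem_tent_iff_of_mem_cell hR α.2 hz
    by_cases h : β ≤ α
    · rw [if_pos h, Set.indicator_of_mem (h4.2 h), hcoeff]
    · rw [if_neg h, Set.indicator_of_notMem fun h5 => h (h4.1 h5)]
  have hdisj : Set.PairwiseDisjoint ((Finset.univ : Finset S) : Set S) fun β : S => T.cell S β :=
    fun β _ γ _ hne => T.cell_disjoint hR β.2 γ.2 fun h => hne (Subtype.ext h)
  have hLHS : ∫⁻ z, (∑ α ∈ S, (T.tent α).indicator (fun _ => T.coeff μ₁ f α) z) ^ 2 ∂μ₂ =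
      ENNReal.ofReal (∑ β, τ β ^ 2 * t β) := by
    have hsupp : Function.support (fun z =>
        (∑ α ∈ S, (T.tent α).indicator (fun _ => T.coeff μ₁ f α) z) ^ 2) ⊆
        ⋃ β ∈ (Finset.univ : Finset S), T.cell S β := by
      intro z hz
      have h4 : ∑ α ∈ S, (T.tent α).indicator (fun _ => T.coeff μ₁ f α) z ≠ 0 :=
        fun h => hz (by simp [h])
      obtain ⟨α, hα, h5⟩ := Finset.exists_ne_zero_of_sum_ne_zero h4
      obtain ⟨β, hβ, _, h6⟩ := T.exists_mem_cell hα (Set.mem_of_indicator_ne_zero h5)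
      simp only [Finset.mem_univ, Set.iUnion_true, Set.mem_iUnion]
      exact ⟨⟨β, hβ⟩, h6⟩
    rw [← setLIntegral_eq_of_support_subset hsupp, lintegral_biUnion_finset hdisj
      fun β _ => T.measurableSet_cell β, ENNReal.ofReal_sum_of_nonneg fun β _ =>
        mul_nonneg (sq_nonneg _) (ht0 β).le]
    refine Finset.sum_congr rfl fun β _ => ?_
    rw [setLIntegral_congr_fun (T.measurableSet_cell β)
      (g := fun _ => ENNReal.ofReal (τ β) ^ 2) (fun z hz => by simp only [hval β z hz]),
      setLIntegral_const,
      ENNReal.ofReal_mul (sq_nonneg _), ENNReal.ofReal_toReal (measure_ne_top _ _),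
      ENNReal.ofReal_pow (Finset.sum_nonneg fun α _ => hlowF α)]
  have hRHS : ENNReal.ofReal (∑ β, F β ^ 2 * s β) ≤ ∫⁻ z, f z ^ 2 ∂μ₁ := by
    calc _ = ∑ β, ENNReal.ofReal (F β ^ 2 * s β) :=
          ENNReal.ofReal_sum_of_nonneg fun β _ => mul_nonneg (sq_nonneg _) (hs0 β).le
      _ ≤ ∑ β : S, ∫⁻ z in T.cell S β, f z ^ 2 ∂μ₁ := by
          refine Finset.sum_le_sum fun β _ => ?_
          have hJ : ∫⁻ z in T.cell S β, f z ^ 2 ∂μ₁ ≠ ∞ :=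
            ne_top_of_le_ne_top hf2 (setLIntegral_le_lintegral _ _)
          refine ENNReal.ofReal_le_of_le_toReal ?_
          have h4 := ENNReal.toReal_mono (ENNReal.mul_ne_top (measure_ne_top _ _) hJ)
            (sq_setLIntegral_le hf (T.cell S β))
          rw [ENNReal.toReal_pow, ENNReal.toReal_mul] at h4
          have h5 : F β ^ 2 * s β = (I β).toReal ^ 2 / s β := by
            have := (hs0 β).ne'
            rw [hF]; field_simp
          rw [h5, div_le_iff₀ (hs0 β), mul_comm]
          exact h4
      _ = ∫⁻ z in ⋃ β ∈ (Finset.univ : Finset S), T.cell S β, f z ^ 2 ∂μ₁ :=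
          (lintegral_biUnion_finset hdisj (fun β _ => T.measurableSet_cell β) _).symm
      _ ≤ _ := setLIntegral_le_lintegral _ _
  rw [hLHS]
  refine (ENNReal.ofReal_le_ofReal main).trans ?_
  rw [ENNReal.ofReal_mul (by positivity)]
  gcongr

/-- The two-weight inequality for the dyadic operator of one tree. -/
theorem lintegral_dyadicOp_sq_le (hR : 0 < R) {μ₁ μ₂ : Measure (Cd d)}
    [IsFiniteMeasure μ₁] [IsFiniteMeasure μ₂] (hpos₁ : ∀ α, 0 < μ₁ (T.kube α))
    (hpos₂ : ∀ α, 0 < μ₂ (T.kube α)) (hposν : ∀ α, 0 < nu d (T.kube α)) {Q c D₁ D₂ : ℝ}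
    (hQ : 0 ≤ Q) (hc : 0 ≤ c) (hD₁ : 0 ≤ D₁) (hD₂ : 0 ≤ D₂)
    (h1 : ∀ α (B : Finset T.Vertex), (∀ β ∈ B, β ≤ α) →
      ∑ β ∈ B, nu d (T.tent β) ≤ ENNReal.ofReal c * nu d (T.tent α))
    (h2 : ∀ α, μ₁ (T.tent α) * μ₂ (T.tent α) ≤ ENNReal.ofReal Q * nu d (T.tent α) ^ 2)
    (h3 : ∀ α (B : Finset T.Vertex), (∀ β ∈ B, β ≤ α) →
      ∑ β ∈ B, μ₁ (T.tent β) ≤ ENNReal.ofReal D₁ * μ₁ (T.tent α))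
    (h3' : ∀ α (B : Finset T.Vertex), (∀ β ∈ B, β ≤ α) →
      ∑ β ∈ B, μ₂ (T.tent β) ≤ ENNReal.ofReal D₂ * μ₂ (T.tent α))
    {f : Cd d → ℝ≥0∞} (hf : AEMeasurable f μ₁) (hf2 : ∫⁻ z, f z ^ 2 ∂μ₁ ≠ ∞) :
    ∫⁻ z, T.dyadicOp μ₁ f z ^ 2 ∂μ₂ ≤
      ENNReal.ofReal (25600 * (Q * c * (D₁ + D₂))) * ∫⁻ z, f z ^ 2 ∂μ₁ := by
  have hmeas : ∀ S : Finset T.Vertex, Measurable fun z =>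
      (∑ α ∈ S, (T.tent α).indicator (fun _ => T.coeff μ₁ f α) z) ^ 2 := fun S =>
    (Finset.measurable_fun_sum S fun α _ =>
      measurable_const.indicator (T.measurableSet_tent α)).pow_const 2
  have hmono : Monotone fun (S : Finset T.Vertex) (z : Cd d) =>
      (∑ α ∈ S, (T.tent α).indicator (fun _ => T.coeff μ₁ f α) z) ^ 2 := fun S S' h z => by
    simp only
    gcongr
  simp only [dyadicOp, ENNReal.tsum_eq_iSup_sum, ENNReal.iSup_pow]
  rw [lintegral_iSup_directed (fun S => (hmeas S).aemeasurable) hmono.directed_le]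
  exact iSup_le fun S => T.lintegral_sum_sq_le hR hpos₁ hpos₂ hposν hQ hc hD₁ hD₂ h1 h2 h3 h3' hf
    hf2 S

theorem measurable_dyadicOp (μ : Measure (Cd d)) (f : Cd d → ℝ≥0∞) :
    Measurable (T.dyadicOp μ f) :=
  Measurable.tsum fun α => measurable_const.indicator (T.measurableSet_tent α)

end BergmanTree

end

section

/-! ### Weights -/

section Weight

variable {d : ℕ} {σ : Cd d → ℝ}

theorem IsWeight.aestronglyMeasurable (hσ : IsWeight σ) : AEStronglyMeasurable σ (nu d) := by
  have h := hσ.1.aestronglyMeasurable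
  rwa [Measure.restrict_eq_self_of_ae_mem (ae_mem_unitBall d)] at h

theorem IsWeight.aemeasurable_ofReal (hσ : IsWeight σ) :
    AEMeasurable (fun z => ENNReal.ofReal (σ z)) (nu d) :=
  hσ.aestronglyMeasurable.aemeasurable.ennreal_ofReal

theorem weightMeasure_absolutelyContinuous (σ : Cd d → ℝ) : weightMeasure σ ≪ nu d :=
  withDensity_absolutelyContinuous _ _

theorem IsWeight.absolutelyContinuous (hσ : IsWeight σ) : nu d ≪ weightMeasure σ := by
  refine withDensity_absolutelyContinuous' hσ.aemeasurable_ofReal ?_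
  filter_upwards [hσ.2] with z hz
  exact (ENNReal.ofReal_pos.2 hz).ne'

theorem weightMeasure_apply {K : Set (Cd d)} (hK : MeasurableSet K) :
    weightMeasure σ K = ∫⁻ z in K, ENNReal.ofReal (σ z) ∂(nu d) :=
  withDensity_apply _ hK

theorem IsWeight.weightMeasure_pos (hσ : IsWeight σ) {K : Set (Cd d)} (hK : 0 < nu d K) :
    0 < weightMeasure σ K :=
  pos_iff_ne_zero.2 fun h => hK.ne' (hσ.absolutelyContinuous h)

theorem weightMeasure_univ (σ : Cd d → ℝ) :
    weightMeasure σ Set.univ = weightMeasure σ (unitBall d) := by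
  refine (measure_congr ?_).symm
  rw [Filter.eventuallyEq_univ]
  exact (weightMeasure_absolutelyContinuous σ).ae_le (ae_mem_unitBall d)

theorem IsWeight.lintegral_weightMeasure (hσ : IsWeight σ) {g : Cd d → ℝ≥0∞}
    (hg : AEMeasurable g (nu d)) :
    ∫⁻ z, g z ∂(weightMeasure σ) = ∫⁻ z, ENNReal.ofReal (σ z) * g z ∂(nu d) :=
  lintegral_withDensity_eq_lintegral_mul₀ hσ.aemeasurable_ofReal hg

end Weight

namespace BergmanTree

variable {d N : ℕ} {R δ : ℝ}

theorem tent_mem_tents (T : Fin N → BergmanTree d R δ) (ℓ : Fin N) (α : (T ℓ).Vertex) :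
    (T ℓ).tent α ∈ tents T := ⟨ℓ, α, rfl⟩

theorem mul_weightMeasure_tent_le (hd : 0 < d) (hR : 0 < R) (hδ : 0 < δ)
    (T : Fin N → BergmanTree d R δ) (ℓ : Fin N) (α : (T ℓ).Vertex) (w σ : Cd d → ℝ) :
    weightMeasure σ ((T ℓ).tent α) * weightMeasure w ((T ℓ).tent α) ≤
      jointBp (tents T) 2 w σ * nu d ((T ℓ).tent α) ^ 2 := by
  have hm := (T ℓ).measurableSet_tent α
  have h0 : nu d ((T ℓ).tent α) ≠ 0 :=
    (((T ℓ).nu_kube_pos hd hR hδ α).trans_le (measure_mono ((T ℓ).kube_subset_tent le_rfl))).ne'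
  have ht : nu d ((T ℓ).tent α) ≠ ∞ := measure_ne_top _ _
  have h : weightMeasure w ((T ℓ).tent α) / nu d ((T ℓ).tent α) *
      (weightMeasure σ ((T ℓ).tent α) / nu d ((T ℓ).tent α)) ^ ((2 : ℝ) - 1) ≤
        jointBp (tents T) 2 w σ := by
    rw [weightMeasure_apply hm, weightMeasure_apply hm]
    exact le_iSup₂_of_le _ (tent_mem_tents T ℓ α) le_rfl
  rw [show (2 : ℝ) - 1 = 1 by norm_num, ENNReal.rpow_one] at h
  calc _ = (weightMeasure w ((T ℓ).tent α) / nu d ((T ℓ).tent α) *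
      (weightMeasure σ ((T ℓ).tent α) / nu d ((T ℓ).tent α))) * nu d ((T ℓ).tent α) ^ 2 := by
        rw [sq, mul_mul_mul_comm, ENNReal.div_mul_cancel h0 ht, ENNReal.div_mul_cancel h0 ht,
          mul_comm]
    _ ≤ _ := by gcongr

theorem sum_nu_tent_le (hR : 0 < R) (T : BergmanTree d R δ) {C : ℝ}
    (hC : ∀ α : T.Vertex, nu d (T.tent α) ≤ ENNReal.ofReal C * nu d (T.kube α)) (α : T.Vertex)
    (B : Finset T.Vertex) (hB : ∀ β ∈ B, β ≤ α) :
    ∑ β ∈ B, nu d (T.tent β) ≤ ENNReal.ofReal C * nu d (T.tent α) := by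
  calc _ ≤ ∑ β ∈ B, ENNReal.ofReal C * nu d (T.kube β) := Finset.sum_le_sum fun β _ => hC β
    _ ≤ _ := by
      rw [← Finset.mul_sum]
      gcongr
      exact T.sum_measure_kube_le hR _ hB

/-- The Carleson condition for a weight in `B_∞`: on the kube of `β` the maximal function of
`σ 1_{K̂_α}` is at least the average of `σ` over the tent of `β`. -/
theorem sum_weightMeasure_tent_le (hd : 0 < d) (hR : 0 < R) (hδ : 0 < δ)
    (T : Fin N → BergmanTree d R δ) (ℓ : Fin N) {C : ℝ}
    (hC : ∀ α : (T ℓ).Vertex, nu d ((T ℓ).tent α) ≤ ENNReal.ofReal C * nu d ((T ℓ).kube α))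
    {σ : Cd d → ℝ} (hσ : IsWeight σ) (hfin : weightMeasure σ Set.univ ≠ ∞) (α : (T ℓ).Vertex)
    (B : Finset (T ℓ).Vertex) (hB : ∀ β ∈ B, β ≤ α) :
    ∑ β ∈ B, weightMeasure σ ((T ℓ).tent β) ≤
      ENNReal.ofReal C * charBinf (tents T) σ * weightMeasure σ ((T ℓ).tent α) := by
  have hν0 : ∀ β, nu d ((T ℓ).tent β) ≠ 0 := fun β =>
    (((T ℓ).nu_kube_pos hd hR hδ β).trans_le (measure_mono ((T ℓ).kube_subset_tent le_rfl))).ne'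
  have hσ0 : weightMeasure σ ((T ℓ).tent α) ≠ 0 :=
    (hσ.weightMeasure_pos (pos_iff_ne_zero.2 (hν0 α))).ne'
  have hσt : weightMeasure σ ((T ℓ).tent α) ≠ ∞ :=
    ne_top_of_le_ne_top hfin (measure_mono (Set.subset_univ _))
  set f := ((T ℓ).tent α).indicator σ with hf
  have hstep : ∀ β ∈ B, weightMeasure σ ((T ℓ).tent β) ≤
      ENNReal.ofReal C * ∫⁻ z in (T ℓ).kube β, maximalFn (tents T) f z ∂(nu d) := by
    intro β hβ
    have hsub := (T ℓ).tent_mono (hB β hβ)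
    have hmax : ∀ z ∈ (T ℓ).kube β,
        weightMeasure σ ((T ℓ).tent β) / nu d ((T ℓ).tent β) ≤ maximalFn (tents T) f z := by
      intro z hz
      refine le_iSup₂_of_le _ (tent_mem_tents T ℓ β) ?_
      rw [Set.indicator_of_mem ((T ℓ).kube_subset_tent le_rfl hz),
        weightMeasure_apply ((T ℓ).measurableSet_tent β)]
      refine ENNReal.div_le_div_right
        (setLIntegral_mono' ((T ℓ).measurableSet_tent β) fun ζ hζ => ?_) _
      rw [hf, Set.indicator_of_mem (hsub hζ)]
      exact Real.ofReal_le_enorm _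
    calc weightMeasure σ ((T ℓ).tent β)
        = weightMeasure σ ((T ℓ).tent β) / nu d ((T ℓ).tent β) * nu d ((T ℓ).tent β) :=
          (ENNReal.div_mul_cancel (hν0 β) (measure_ne_top _ _)).symm
      _ ≤ weightMeasure σ ((T ℓ).tent β) / nu d ((T ℓ).tent β) *
            (ENNReal.ofReal C * nu d ((T ℓ).kube β)) := by gcongr; exact hC β
      _ = ENNReal.ofReal C * ∫⁻ _ in (T ℓ).kube β,
            weightMeasure σ ((T ℓ).tent β) / nu d ((T ℓ).tent β) ∂(nu d) := by
          rw [setLIntegral_const]; ring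
      _ ≤ _ := by
          gcongr 1
          exact setLIntegral_mono' ((T ℓ).measurableSet_kube β) hmax
  calc _ ≤ ∑ β ∈ B, ENNReal.ofReal C * ∫⁻ z in (T ℓ).kube β, maximalFn (tents T) f z ∂(nu d) :=
        Finset.sum_le_sum hstep
    _ ≤ ENNReal.ofReal C * ∫⁻ z in (T ℓ).tent α, maximalFn (tents T) f z ∂(nu d) := by
        rw [← Finset.mul_sum]
        gcongr
        exact (T ℓ).sum_lintegral_kube_le hR _ _ hB
    _ ≤ ENNReal.ofReal C * (charBinf (tents T) σ * weightMeasure σ ((T ℓ).tent α)) := by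
        gcongr
        rw [← ENNReal.div_le_iff hσ0 hσt, weightMeasure_apply ((T ℓ).measurableSet_tent α)]
        exact le_iSup₂_of_le _ (tent_mem_tents T ℓ α) le_rfl
    _ = _ := (mul_assoc _ _ _).symm

/-! ### Domination of the Bergman kernel -/

theorem carlesonTent_smul {u : Cd d} (hu : ‖u‖ = 1) {h : ℝ} (h1 : h < 1) :
    carlesonTent (((1 - h : ℝ) : ℂ) • u) = region u h := by
  have hn : ‖((1 - h : ℝ) : ℂ) • u‖ = 1 - h := by
    rw [norm_smul, hu, mul_one, Complex.norm_real, Real.norm_of_nonneg (by linarith)]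
  have hne : ((1 - h : ℝ) : ℂ) • u ≠ 0 := by
    rw [← norm_ne_zero_iff, hn]; linarith
  rw [carlesonTent, if_neg hne, unitVec_smul hu (by linarith), hn, sub_sub_cancel]
  rfl

/-- The Bergman kernel at `(z, ζ)` is dominated by the reciprocal volume of a dyadic tent containing
both points: the Carleson tent of size `4 |1 - ⟨z, ζ⟩|` in the direction of `z` contains them. -/
theorem exists_kernel_le {T : Fin N → BergmanTree d R δ} (hT : Admissible T) :
    ∃ C : ℝ≥0, ∀ z ∈ unitBall d, ∀ ζ ∈ unitBall d, ∃ ℓ, ∃ α : (T ℓ).Vertex,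
      z ∈ (T ℓ).tent α ∧ ζ ∈ (T ℓ).tent α ∧
      ENNReal.ofReal ((‖1 - herm z ζ‖ ^ (d + 1))⁻¹) ≤ C * (nu d ((T ℓ).tent α))⁻¹ := by
  obtain ⟨A, hA⟩ := hT
  obtain ⟨C, hC, HC⟩ := exists_nu_region_le d
  refine ⟨Real.toNNReal (4 ^ (d + 1)) + A * Real.toNNReal (C * 4 ^ (d + 1)), fun z hz ζ hζ => ?_⟩
  rw [mem_unitBall] at hz hζ
  have hm : 0 < ‖1 - herm z ζ‖ := norm_one_sub_herm_pos hζ hz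
  set m := ‖1 - herm z ζ‖ with hm_def
  rcases le_or_gt (1 / 4) m with h4 | h4
  · obtain ⟨_, ⟨ℓ, α, rfl⟩, hsub, -⟩ := hA 0 (by simp [mem_unitBall])
    rw [carlesonTent, if_pos rfl] at hsub
    refine ⟨ℓ, α, hsub (mem_unitBall.2 hz), hsub (mem_unitBall.2 hζ), ?_⟩
    have h5 : (1 : ℝ≥0∞) ≤ (nu d ((T ℓ).tent α))⁻¹ := ENNReal.one_le_inv.2 prob_le_one
    have h6 : (m ^ (d + 1))⁻¹ ≤ 4 ^ (d + 1) := by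
      rw [inv_le_comm₀ (by positivity) (by positivity), ← inv_pow]
      gcongr
      linarith
    calc ENNReal.ofReal ((m ^ (d + 1))⁻¹) ≤ ENNReal.ofReal (4 ^ (d + 1)) :=
          ENNReal.ofReal_le_ofReal h6
      _ ≤ ((Real.toNNReal (4 ^ (d + 1)) + A * Real.toNNReal (C * 4 ^ (d + 1)) : ℝ≥0) : ℝ≥0∞) := by
          rw [ENNReal.ofReal]; exact_mod_cast le_self_add
      _ = _ * 1 := (mul_one _).symm
      _ ≤ _ := by gcongr
  · have hz0 : z ≠ 0 := by
      rintro rfl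
      simp [herm] at hm_def
      linarith
    set u := unitVec z with hu_def
    have hu : ‖u‖ = 1 := norm_unitVec hz0
    have hzu : herm z u = ‖z‖ := herm_self_unitVec hz0
    have hzm : ‖1 - herm z u‖ ≤ m := by
      rw [hzu, ← Complex.ofReal_one, ← Complex.ofReal_sub, Complex.norm_real,
        Real.norm_of_nonneg (by linarith), hm_def]
      have h5 := norm_sub_norm_le (1 : ℂ) (herm z ζ)
      have h6 := norm_herm_le z ζ
      rw [norm_one] at h5
      nlinarith [norm_nonneg z]
    have hζm : ‖1 - herm ζ u‖ ≤ 4 * m := by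
      have h5 := rho_triangle hζ.le hu.le hz.le
      have h6 : rho z u ≤ √m := Real.sqrt_le_sqrt hzm
      have h7 : rho ζ z = √m := by rw [rho_comm]; rfl
      have h8 : rho ζ u ≤ 2 * √m := by linarith
      rw [← rho_sq]
      calc _ ≤ (2 * √m) ^ 2 := pow_le_pow_left₀ (rho_nonneg _ _) h8 2
        _ = _ := by rw [mul_pow, Real.sq_sqrt hm.le]; norm_num
    have hmem : ((1 - 4 * m : ℝ) : ℂ) • u ∈ unitBall d := by
      rw [mem_unitBall, norm_smul, hu, mul_one, Complex.norm_real,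
        Real.norm_of_nonneg (by linarith)]
      linarith
    obtain ⟨_, ⟨ℓ, α, rfl⟩, hsub, hvol⟩ := hA _ hmem
    rw [carlesonTent_smul hu (by linarith)] at hsub hvol
    refine ⟨ℓ, α, hsub ⟨mem_unitBall.2 hz, by linarith⟩, hsub ⟨mem_unitBall.2 hζ, hζm⟩, ?_⟩
    set B : ℝ≥0∞ :=
      ((Real.toNNReal (4 ^ (d + 1)) + A * Real.toNNReal (C * 4 ^ (d + 1)) : ℝ≥0) : ℝ≥0∞)
      with hB
    have hB0 : B ≠ 0 := by
      rw [hB, ENNReal.coe_ne_zero]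
      have : 0 < Real.toNNReal (4 ^ (d + 1)) := Real.toNNReal_pos.2 (by positivity)
      exact (add_pos_of_pos_of_nonneg this zero_le).ne'
    have h5 : nu d ((T ℓ).tent α) ≤ B * ENNReal.ofReal (m ^ (d + 1)) := by
      calc _ ≤ (A : ℝ≥0∞) * nu d (region u (4 * m)) := hvol
        _ ≤ A * (ENNReal.ofReal (C * 4 ^ (d + 1)) * ENNReal.ofReal (m ^ (d + 1))) := by
            gcongr
            refine (HC u (4 * m) hu (by linarith)).trans (le_of_eq ?_)
            rw [mul_pow, ← mul_assoc, ENNReal.ofReal_mul (by positivity)]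
        _ = ((A * Real.toNNReal (C * 4 ^ (d + 1)) : ℝ≥0) : ℝ≥0∞) *
            ENNReal.ofReal (m ^ (d + 1)) := by
            rw [ENNReal.coe_mul, mul_assoc]; rfl
        _ ≤ _ := by
            gcongr
            rw [hB, ENNReal.coe_le_coe]
            exact le_add_self
    calc ENNReal.ofReal ((m ^ (d + 1))⁻¹) = (ENNReal.ofReal (m ^ (d + 1)))⁻¹ :=
          ENNReal.ofReal_inv_of_pos (by positivity)
      _ = B * (B * ENNReal.ofReal (m ^ (d + 1)))⁻¹ := by
          rw [ENNReal.mul_inv (Or.inl hB0) (Or.inl ENNReal.coe_ne_top), ← mul_assoc,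
            ENNReal.mul_inv_cancel hB0 ENNReal.coe_ne_top, one_mul]
      _ ≤ _ := by gcongr

/-- The Bergman kernel integral of a nonnegative function is dominated by the dyadic operators. -/
theorem exists_lintegral_kernel_le {T : Fin N → BergmanTree d R δ} (hT : Admissible T) :
    ∃ C : ℝ≥0, ∀ (μ : Measure (Cd d)), μ ≪ nu d → ∀ f : Cd d → ℝ≥0∞, AEMeasurable f μ →
      ∀ z ∈ unitBall d, ∫⁻ ζ, f ζ * ENNReal.ofReal ((‖1 - herm z ζ‖ ^ (d + 1))⁻¹) ∂μ ≤
        C * ∑ ℓ, (T ℓ).dyadicOp μ f z := by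
  obtain ⟨C, hC⟩ := exists_kernel_le hT
  refine ⟨C, fun μ hμ f hf z hz => ?_⟩
  have hm : ∀ ℓ (α : (T ℓ).Vertex), AEMeasurable (fun ζ => ((T ℓ).tent α).indicator
      (fun _ => ((T ℓ).tent α).indicator f ζ * (nu d ((T ℓ).tent α))⁻¹) z) μ := fun ℓ α => by
    by_cases h : z ∈ (T ℓ).tent α
    · simp only [Set.indicator_of_mem h]
      exact (hf.indicator ((T ℓ).measurableSet_tent α)).mul_const _
    · simp only [Set.indicator_of_notMem h]
      exact aemeasurable_const
  calc _ ≤ ∫⁻ ζ, C * ∑ ℓ, ∑' α : (T ℓ).Vertex, ((T ℓ).tent α).indicator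
        (fun _ => ((T ℓ).tent α).indicator f ζ * (nu d ((T ℓ).tent α))⁻¹) z ∂μ := by
        refine lintegral_mono_ae ?_
        filter_upwards [hμ.ae_le (ae_mem_unitBall d)] with ζ hζ
        obtain ⟨ℓ, α, h1, h2, h3⟩ := hC z hz ζ hζ
        calc _ ≤ f ζ * (C * (nu d ((T ℓ).tent α))⁻¹) := by gcongr
          _ = C * (((T ℓ).tent α).indicator
              (fun _ => ((T ℓ).tent α).indicator f ζ * (nu d ((T ℓ).tent α))⁻¹) z) := by
            rw [Set.indicator_of_mem h1, Set.indicator_of_mem h2]; ring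
          _ ≤ _ := by
            gcongr
            refine le_trans ?_ (Finset.single_le_sum (f := fun ℓ => ∑' α : (T ℓ).Vertex,
              ((T ℓ).tent α).indicator (fun _ => ((T ℓ).tent α).indicator f ζ *
                (nu d ((T ℓ).tent α))⁻¹) z) (fun _ _ => zero_le) (Finset.mem_univ ℓ))
            exact ENNReal.le_tsum α
    _ = C * ∑ ℓ, ∑' α : (T ℓ).Vertex, ∫⁻ ζ, ((T ℓ).tent α).indicator
        (fun _ => ((T ℓ).tent α).indicator f ζ * (nu d ((T ℓ).tent α))⁻¹) z ∂μ := by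
        rw [lintegral_const_mul' _ _ ENNReal.coe_ne_top, lintegral_finsetSum' _ fun ℓ _ =>
          AEMeasurable.tsum (hm ℓ)]
        congr 1
        exact Finset.sum_congr rfl fun ℓ _ => lintegral_tsum (hm ℓ)
    _ = _ := by
        congr 1
        refine Finset.sum_congr rfl fun ℓ _ => tsum_congr fun α => ?_
        by_cases h : z ∈ (T ℓ).tent α
        · simp only [Set.indicator_of_mem h]
          rw [lintegral_mul_const'' _ (hf.indicator ((T ℓ).measurableSet_tent α)),
            lintegral_indicator ((T ℓ).measurableSet_tent α)]
          rfl
        · simp only [Set.indicator_of_notMem h, lintegral_zero]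

end BergmanTree

end

section

/-! ### The weighted bound for the Bergman projection -/

section Projection

variable {d N : ℕ} {R δ : ℝ}

theorem exists_vertex_level_zero (hd : 0 < d) (hR : 0 < R) {T : Fin N → BergmanTree d R δ}
    (hT : Admissible T) : ∃ ℓ, ∃ α : (T ℓ).Vertex, α.1 = 0 := by
  obtain ⟨A, hA⟩ := hT
  obtain ⟨_, ⟨ℓ, β, rfl⟩, -⟩ := hA 0 (by simp [mem_unitBall])
  obtain ⟨α, h, -⟩ := (T ℓ).exists_ancestor hd hR β 0 (Nat.zero_le _)
  exact ⟨ℓ, α, h⟩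

/-- If the joint characteristic is finite, both weights are integrable, since the whole ball is a
dyadic tent. -/
theorem weightMeasure_univ_ne_top (hd : 0 < d) (hR : 0 < R) (hδ : 0 < δ)
    {T : Fin N → BergmanTree d R δ} (hT : Admissible T) {σ w : Cd d → ℝ} (hσ : IsWeight σ)
    (hw : IsWeight w) (hJ : jointBp (tents T) 2 w σ < ∞) :
    weightMeasure σ Set.univ ≠ ∞ ∧ weightMeasure w Set.univ ≠ ∞ := by
  obtain ⟨ℓ, α, hα⟩ := exists_vertex_level_zero hd hR hT
  have h := BergmanTree.mul_weightMeasure_tent_le hd hR hδ T ℓ α w σ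
  rw [(T ℓ).tent_eq_unitBall hd hR hδ hα, nu_unitBall, one_pow, mul_one, ← weightMeasure_univ,
    ← weightMeasure_univ] at h
  have hpos : ∀ {v : Cd d → ℝ}, IsWeight v → weightMeasure v Set.univ ≠ 0 := fun hv =>
    (hv.weightMeasure_pos (by simp)).ne'
  have h' := ne_top_of_le_ne_top hJ.ne h
  constructor
  · intro h1
    rw [h1, ENNReal.top_mul (hpos hw)] at h'
    exact h' rfl
  · intro h1
    rw [h1, ENNReal.mul_top (hpos hσ)] at h'
    exact h' rfl

/-- The two-weight inequality for the sum of the dyadic operators of an admissible collection. -/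
theorem exists_lintegral_dyadicOp_le (hd : 0 < d) (hR : 0 < R) (hδ : 0 < δ)
    {T : Fin N → BergmanTree d R δ} (hT : Admissible T) :
    ∃ C : ℝ≥0, ∀ σ w : Cd d → ℝ, IsWeight σ → IsWeight w → charBinf (tents T) σ < ∞ →
      charBinf (tents T) w < ∞ → jointBp (tents T) 2 w σ < ∞ →
      ∀ f : Cd d → ℝ≥0∞, AEMeasurable f (weightMeasure σ) → ∫⁻ z, f z ^ 2 ∂(weightMeasure σ) ≠ ∞ →
      ∀ ℓ, ∫⁻ z, (T ℓ).dyadicOp (weightMeasure σ) f z ^ 2 ∂(weightMeasure w) ≤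
        C * (jointBp (tents T) 2 w σ * (charBinf (tents T) w + charBinf (tents T) σ)) *
          ∫⁻ z, f z ^ 2 ∂(weightMeasure σ) := by
  choose c hc hkube using fun ℓ => (T ℓ).exists_nu_tent_le_nu_kube hd hR hδ
  set M := ∑ ℓ, c ℓ with hM
  have hM0 : 0 ≤ M := Finset.sum_nonneg fun ℓ _ => (hc ℓ).le
  have hcM : ∀ ℓ, c ℓ ≤ M := fun ℓ =>
    Finset.single_le_sum (f := c) (fun ℓ _ => (hc ℓ).le) (Finset.mem_univ ℓ)
  have hM' : ∀ ℓ (α : (T ℓ).Vertex),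
      nu d ((T ℓ).tent α) ≤ ENNReal.ofReal M * nu d ((T ℓ).kube α) := fun ℓ α =>
    (hkube ℓ α).trans (by gcongr; exact hcM ℓ)
  refine ⟨Real.toNNReal (25600 * M ^ 2), fun σ w hσ hw hBσ hBw hJ f hf hf2 ℓ => ?_⟩
  obtain ⟨hσfin, hwfin⟩ := weightMeasure_univ_ne_top hd hR hδ hT hσ hw hJ
  have : IsFiniteMeasure (weightMeasure σ) := ⟨hσfin.lt_top⟩
  have : IsFiniteMeasure (weightMeasure w) := ⟨hwfin.lt_top⟩
  have hpos := (T ℓ).nu_kube_pos hd hR hδ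
  set J := jointBp (tents T) 2 w σ
  set a := charBinf (tents T) σ
  set b := charBinf (tents T) w
  have hof : ∀ {x : ℝ≥0∞}, x < ∞ → ENNReal.ofReal M * x = ENNReal.ofReal (M * x.toReal) :=
    fun {x} hx => by rw [ENNReal.ofReal_mul hM0, ENNReal.ofReal_toReal hx.ne]
  have main := (T ℓ).lintegral_dyadicOp_sq_le hR (fun α => hσ.weightMeasure_pos (hpos α))
    (fun α => hw.weightMeasure_pos (hpos α)) hpos (Q := J.toReal) (c := M) (D₁ := M * a.toReal)
    (D₂ := M * b.toReal) ENNReal.toReal_nonneg hM0 (by positivity) (by positivity)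
    ((T ℓ).sum_nu_tent_le hR (hM' ℓ))
    (fun α => by
      rw [ENNReal.ofReal_toReal hJ.ne]
      exact BergmanTree.mul_weightMeasure_tent_le hd hR hδ T ℓ α w σ)
    (fun α B hB => by
      rw [← hof hBσ]
      exact BergmanTree.sum_weightMeasure_tent_le hd hR hδ T ℓ (hM' ℓ) hσ hσfin α B hB)
    (fun α B hB => by
      rw [← hof hBw]
      exact BergmanTree.sum_weightMeasure_tent_le hd hR hδ T ℓ (hM' ℓ) hw hwfin α B hB) hf hf2
  refine main.trans (le_of_eq ?_)
  congr 1
  calc _ = ENNReal.ofReal ((25600 * M ^ 2) * (J.toReal * (b.toReal + a.toReal))) := by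
        congr 1; ring
    _ = _ := by
      rw [ENNReal.ofReal_mul (by positivity), ENNReal.ofReal_mul ENNReal.toReal_nonneg,
        ENNReal.ofReal_add ENNReal.toReal_nonneg ENNReal.toReal_nonneg,
        ENNReal.ofReal_toReal hJ.ne, ENNReal.ofReal_toReal hBσ.ne, ENNReal.ofReal_toReal hBw.ne]
      rfl

theorem sq_sum_le_card_mul {ι : Type*} (s : Finset ι) (x : ι → ℝ≥0∞) :
    (∑ i ∈ s, x i) ^ 2 ≤ s.card * ∑ i ∈ s, x i ^ 2 := by
  have h := ENNReal.rpow_sum_le_const_mul_sum_rpow s x (p := 2) (by norm_num)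
  norm_num at h
  exact h

theorem lintegral_enorm_sq_eq {X : Type*} [MeasurableSpace X] (μ : Measure X) (f : X → ℂ) :
    ∫⁻ z, ‖f z‖ₑ ^ 2 ∂μ = eLpNorm f 2 μ ^ 2 := by
  rw [eLpNorm_eq_lintegral_rpow_enorm_toReal (by norm_num) (by norm_num), ENNReal.toReal_ofNat,
    ← ENNReal.rpow_natCast, ← ENNReal.rpow_mul]
  norm_num

theorem enorm_bergmanIntegrand_eq {σ : Cd d → ℝ} (f : Cd d → ℂ) (z ζ : Cd d) (hσ : 0 < σ ζ) :
    ‖bergmanIntegrand (fun ζ => (σ ζ : ℂ) * f ζ) z ζ‖ₑ =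
      ENNReal.ofReal (σ ζ) * (‖f ζ‖ₑ * ENNReal.ofReal ((‖1 - herm z ζ‖ ^ (d + 1))⁻¹)) := by
  rw [bergmanIntegrand, div_eq_mul_inv, enorm_mul, enorm_mul, mul_assoc, ← ofReal_norm,
    Complex.norm_real, Real.norm_of_nonneg hσ.le, ← ofReal_norm ((1 - herm z ζ) ^ (d + 1))⁻¹,
    norm_inv, norm_pow]

theorem measurable_herm : Measurable fun p : Cd d × Cd d => herm p.1 p.2 := by
  unfold herm
  exact (continuous_snd.inner continuous_fst).measurable

theorem measurable_kernel (z : Cd d) :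
    Measurable fun ζ : Cd d => ENNReal.ofReal ((‖1 - herm z ζ‖ ^ (d + 1))⁻¹) :=
  ((((measurable_const.sub
    (measurable_herm.comp (measurable_const.prodMk measurable_id))).norm).pow_const
    _).inv).ennreal_ofReal

variable {σ : Cd d → ℝ}

theorem IsWeight.lintegral_enorm_bergmanIntegrand (hσ : IsWeight σ) {f : Cd d → ℂ}
    (hf : AEStronglyMeasurable f (weightMeasure σ)) (z : Cd d) :
    ∫⁻ ζ, ‖bergmanIntegrand (fun ζ => (σ ζ : ℂ) * f ζ) z ζ‖ₑ ∂(nu d) =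
      ∫⁻ ζ, ‖f ζ‖ₑ * ENNReal.ofReal ((‖1 - herm z ζ‖ ^ (d + 1))⁻¹) ∂(weightMeasure σ) := by
  have hf' := hf.mono_ac hσ.absolutelyContinuous
  rw [hσ.lintegral_weightMeasure
    (g := fun ζ => ‖f ζ‖ₑ * ENNReal.ofReal ((‖1 - herm z ζ‖ ^ (d + 1))⁻¹))
    (hf'.enorm.mul (measurable_kernel z).aemeasurable)]
  refine lintegral_congr_ae ?_
  filter_upwards [hσ.2] with ζ hζ
  exact enorm_bergmanIntegrand_eq f z ζ hζ

theorem IsWeight.aestronglyMeasurable_mul (hσ : IsWeight σ) {f : Cd d → ℂ}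
    (hf : AEStronglyMeasurable f (weightMeasure σ)) :
    AEStronglyMeasurable (fun ζ => (σ ζ : ℂ) * f ζ) (nu d) :=
  (Complex.continuous_ofReal.comp_aestronglyMeasurable hσ.aestronglyMeasurable).mul
    (hf.mono_ac hσ.absolutelyContinuous)

/-- The Bergman kernel at a fixed point of the ball is bounded, and `L²(σ) ⊆ L¹(σ)` for a finite
measure `σ dν`. -/
theorem IsWeight.integrable_bergmanIntegrand (hσ : IsWeight σ)
    (hfin : weightMeasure σ Set.univ ≠ ∞) {f : Cd d → ℂ} (hf : MemLp f 2 (weightMeasure σ))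
    {z : Cd d} (hz : z ∈ unitBall d) :
    Integrable (bergmanIntegrand (fun ζ => (σ ζ : ℂ) * f ζ) z) (nu d) := by
  have : IsFiniteMeasure (weightMeasure σ) := ⟨hfin.lt_top⟩
  rw [mem_unitBall] at hz
  refine ⟨?_, ?_⟩
  · refine (hσ.aestronglyMeasurable_mul hf.1).aemeasurable.div ?_ |>.aestronglyMeasurable
    exact ((measurable_const.sub (measurable_herm.comp
      (measurable_const.prodMk measurable_id))).pow_const _).aemeasurable
  · rw [HasFiniteIntegral, hσ.lintegral_enorm_bergmanIntegrand hf.1]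
    have h1 : ∫⁻ ζ, ‖f ζ‖ₑ ∂(weightMeasure σ) < ∞ := (hf.integrable (by norm_num)).2
    refine lt_of_le_of_lt (lintegral_mono_ae (g := fun ζ => ‖f ζ‖ₑ *
      ENNReal.ofReal (((1 - ‖z‖) ^ (d + 1))⁻¹)) ?_) ?_
    · filter_upwards [(weightMeasure_absolutelyContinuous σ).ae_le (ae_mem_unitBall d)] with ζ hζ
      rw [mem_unitBall] at hζ
      have h2 : 0 < 1 - ‖z‖ := by linarith
      have h3 : 1 - ‖z‖ ≤ ‖1 - herm z ζ‖ := by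
        have h4 := norm_sub_norm_le (1 : ℂ) (herm z ζ)
        have h5 := norm_herm_le z ζ
        rw [norm_one] at h4
        nlinarith [norm_nonneg z]
      gcongr
    · rw [lintegral_mul_const' _ _ ENNReal.ofReal_ne_top]
      exact ENNReal.mul_lt_top h1 ENNReal.ofReal_lt_top

theorem IsWeight.aestronglyMeasurable_bergmanP (hσ : IsWeight σ) {f : Cd d → ℂ}
    (hf : AEStronglyMeasurable f (weightMeasure σ)) (μ : Measure (Cd d)) [SFinite μ] :
    AEStronglyMeasurable (bergmanP fun ζ => (σ ζ : ℂ) * f ζ) μ := by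
  have h1 : AEStronglyMeasurable (fun p : Cd d × Cd d => (σ p.2 : ℂ) * f p.2) (μ.prod (nu d)) :=
    (hσ.aestronglyMeasurable_mul hf).comp_snd
  have h2 : AEStronglyMeasurable (fun p : Cd d × Cd d =>
      bergmanIntegrand (fun ζ => (σ ζ : ℂ) * f ζ) p.1 p.2) (μ.prod (nu d)) :=
    (h1.aemeasurable.div
      ((measurable_const.sub measurable_herm).pow_const _).aemeasurable).aestronglyMeasurable
  exact h2.integral_prod_right'

/-- The weighted norm inequality for `P(σ ·)`. -/
theorem exists_eLpNorm_bergmanP_le (hd : 0 < d) (hR : 0 < R) (hδ : 0 < δ)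
    {T : Fin N → BergmanTree d R δ} (hT : Admissible T) :
    ∃ C : ℝ≥0, 0 < C ∧ ∀ σ w : Cd d → ℝ, IsWeight σ → IsWeight w → charBinf (tents T) σ < ∞ →
      charBinf (tents T) w < ∞ → jointBp (tents T) 2 w σ < ∞ →
      ∀ f : Cd d → ℂ, MemLp f 2 (weightMeasure σ) →
      eLpNorm (bergmanP fun ζ => (σ ζ : ℂ) * f ζ) 2 (weightMeasure w) ≤
        C * jointBp (tents T) 2 w σ ^ (1 / 2 : ℝ) *
          (charBinf (tents T) w ^ (1 / 2 : ℝ) + charBinf (tents T) σ ^ (1 / 2 : ℝ)) *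
          eLpNorm f 2 (weightMeasure σ) := by
  obtain ⟨C₁, h₁⟩ := BergmanTree.exists_lintegral_kernel_le hT
  obtain ⟨C₂, h₂⟩ := exists_lintegral_dyadicOp_le hd hR hδ hT
  set K : ℝ≥0 := C₁ ^ 2 * (N * (N * C₂)) + 1 with hK
  have hK0 : 0 < K := by positivity
  refine ⟨K ^ (1 / 2 : ℝ), NNReal.rpow_pos hK0, fun σ w hσ hw hBσ hBw hJ f hf => ?_⟩
  set g : Cd d → ℝ≥0∞ := fun ζ => ‖f ζ‖ₑ with hg
  have hg2 : ∫⁻ z, g z ^ 2 ∂(weightMeasure σ) = eLpNorm f 2 (weightMeasure σ) ^ 2 :=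
    lintegral_enorm_sq_eq _ _
  have hgm : AEMeasurable g (weightMeasure σ) := hf.1.enorm
  have hgfin : ∫⁻ z, g z ^ 2 ∂(weightMeasure σ) ≠ ∞ := by
    rw [hg2]; exact ENNReal.pow_ne_top hf.2.ne
  set J := jointBp (tents T) 2 w σ
  set a := charBinf (tents T) σ
  set b := charBinf (tents T) w
  set F := eLpNorm f 2 (weightMeasure σ)
  have hpt : ∀ z ∈ unitBall d, ‖bergmanP (fun ζ => (σ ζ : ℂ) * f ζ) z‖ₑ ≤
      C₁ * ∑ ℓ, (T ℓ).dyadicOp (weightMeasure σ) g z := fun z hz => by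
    refine (enorm_integral_le_lintegral_enorm _).trans ?_
    rw [hσ.lintegral_enorm_bergmanIntegrand hf.1]
    exact h₁ _ (weightMeasure_absolutelyContinuous σ) g hgm z hz
  have hsq : eLpNorm (bergmanP fun ζ => (σ ζ : ℂ) * f ζ) 2 (weightMeasure w) ^ 2 ≤
      K * (J * (b + a)) * F ^ 2 := by
    rw [← lintegral_enorm_sq_eq]
    calc _ ≤ ∫⁻ z, (C₁ : ℝ≥0∞) ^ 2 * (N * ∑ ℓ, (T ℓ).dyadicOp (weightMeasure σ) g z ^ 2)
          ∂(weightMeasure w) := by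
          refine lintegral_mono_ae ?_
          filter_upwards [(weightMeasure_absolutelyContinuous w).ae_le (ae_mem_unitBall d)]
            with z hz
          calc _ ≤ (C₁ * ∑ ℓ, (T ℓ).dyadicOp (weightMeasure σ) g z) ^ 2 := by
                gcongr; exact hpt z hz
            _ ≤ _ := by
                rw [mul_pow]
                gcongr
                simpa using sq_sum_le_card_mul Finset.univ
                  fun ℓ => (T ℓ).dyadicOp (weightMeasure σ) g z
      _ = (C₁ : ℝ≥0∞) ^ 2 * (N * ∑ ℓ, ∫⁻ z, (T ℓ).dyadicOp (weightMeasure σ) g z ^ 2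
          ∂(weightMeasure w)) := by
          rw [lintegral_const_mul' _ _ (by finiteness), lintegral_const_mul' _ _ (by finiteness),
            lintegral_finsetSum _ fun ℓ _ => ((T ℓ).measurable_dyadicOp _ _).pow_const 2]
      _ ≤ (C₁ : ℝ≥0∞) ^ 2 * (N * ∑ _ℓ : Fin N, C₂ * (J * (b + a)) * F ^ 2) := by
          gcongr with ℓ _
          rw [← hg2]
          exact h₂ σ w hσ hw hBσ hBw hJ g hgm hgfin ℓ
      _ = ((C₁ ^ 2 * (N * (N * C₂)) : ℝ≥0) : ℝ≥0∞) * (J * (b + a)) * F ^ 2 := by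
          rw [Finset.sum_const, Finset.card_univ, Fintype.card_fin, nsmul_eq_mul]
          push_cast
          ring
      _ ≤ _ := by
          gcongr
          exact le_self_add
  have hroot : ∀ x : ℝ≥0∞, (x ^ 2) ^ (1 / 2 : ℝ) = x := fun x => by
    rw [← ENNReal.rpow_natCast, ← ENNReal.rpow_mul]; norm_num
  calc _ = (eLpNorm (bergmanP fun ζ => (σ ζ : ℂ) * f ζ) 2 (weightMeasure w) ^ 2) ^ (1 / 2 : ℝ) :=
        (hroot _).symm
    _ ≤ (K * (J * (b + a)) * F ^ 2) ^ (1 / 2 : ℝ) := by gcongr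
    _ = (K : ℝ≥0∞) ^ (1 / 2 : ℝ) * (J ^ (1 / 2 : ℝ) * (b + a) ^ (1 / 2 : ℝ)) * F := by
        rw [ENNReal.mul_rpow_of_nonneg _ _ (by norm_num),
          ENNReal.mul_rpow_of_nonneg _ _ (by norm_num),
          ENNReal.mul_rpow_of_nonneg _ _ (by norm_num), hroot]
    _ ≤ (K : ℝ≥0∞) ^ (1 / 2 : ℝ) * (J ^ (1 / 2 : ℝ) * (b ^ (1 / 2 : ℝ) + a ^ (1 / 2 : ℝ))) * F := by
        gcongr
        exact ENNReal.rpow_add_le_add_rpow _ _ (by norm_num) (by norm_num)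
    _ = _ := by
        rw [ENNReal.coe_rpow_of_nonneg _ (by norm_num : (0 : ℝ) ≤ 1 / 2)]
        ring

theorem IsWeight.bergmanP_congr (hσ : IsWeight σ) {f g : Cd d → ℂ}
    (h : f =ᵐ[weightMeasure σ] g) (z : Cd d) :
    bergmanP (fun ζ => (σ ζ : ℂ) * f ζ) z = bergmanP (fun ζ => (σ ζ : ℂ) * g ζ) z := by
  refine integral_congr_ae ?_
  filter_upwards [hσ.absolutelyContinuous.ae_le h] with ζ hζ
  simp only [bergmanIntegrand, hζ]

theorem IsWeight.bergmanP_add (hσ : IsWeight σ) (hfin : weightMeasure σ Set.univ ≠ ∞)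
    {f g : Cd d → ℂ} (hf : MemLp f 2 (weightMeasure σ)) (hg : MemLp g 2 (weightMeasure σ))
    {z : Cd d} (hz : z ∈ unitBall d) :
    bergmanP (fun ζ => (σ ζ : ℂ) * (f + g) ζ) z =
      bergmanP (fun ζ => (σ ζ : ℂ) * f ζ) z + bergmanP (fun ζ => (σ ζ : ℂ) * g ζ) z := by
  rw [bergmanP, bergmanP, bergmanP, ← integral_add (hσ.integrable_bergmanIntegrand hfin hf hz)
    (hσ.integrable_bergmanIntegrand hfin hg hz)]
  congr 1
  ext ζ
  simp only [bergmanIntegrand, Pi.add_apply]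
  ring

theorem bergmanP_smul (c : ℂ) (f : Cd d → ℂ) (z : Cd d) :
    bergmanP (fun ζ => (σ ζ : ℂ) * (c • f) ζ) z = c * bergmanP (fun ζ => (σ ζ : ℂ) * f ζ) z := by
  rw [bergmanP, bergmanP, ← integral_const_mul]
  congr 1
  ext ζ
  simp only [bergmanIntegrand, Pi.smul_apply, smul_eq_mul]
  ring

/-- A weighted norm inequality for `P(σ ·)` yields a bounded operator from `L²(σ)` to `L²(w)`. -/
theorem IsWeight.exists_clm (hσ : IsWeight σ) (hσfin : weightMeasure σ Set.univ ≠ ∞)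
    {w : Cd d → ℝ} (hwfin : weightMeasure w Set.univ ≠ ∞) {K : ℝ≥0∞} (hK : K ≠ ∞)
    (hbd : ∀ f : Cd d → ℂ, MemLp f 2 (weightMeasure σ) →
      eLpNorm (bergmanP fun ζ => (σ ζ : ℂ) * f ζ) 2 (weightMeasure w) ≤
        K * eLpNorm f 2 (weightMeasure σ)) :
    ∃ S : Lp ℂ 2 (weightMeasure σ) →L[ℂ] Lp ℂ 2 (weightMeasure w),
      (∀ f : Lp ℂ 2 (weightMeasure σ), ∀ᵐ z ∂(weightMeasure w),
        S f z = bergmanP (fun ζ => (σ ζ : ℂ) * f ζ) z) ∧ ‖S‖ₑ ≤ K := by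
  have : IsFiniteMeasure (weightMeasure w) := ⟨hwfin.lt_top⟩
  have hmem : ∀ f : Lp ℂ 2 (weightMeasure σ),
      MemLp (bergmanP fun ζ => (σ ζ : ℂ) * f ζ) 2 (weightMeasure w) := fun f =>
    ⟨hσ.aestronglyMeasurable_bergmanP (Lp.aestronglyMeasurable f) _,
      (hbd f (Lp.memLp f)).trans_lt (ENNReal.mul_lt_top hK.lt_top (Lp.memLp f).2)⟩
  have hball := (weightMeasure_absolutelyContinuous w).ae_le (ae_mem_unitBall d)
  let L : Lp ℂ 2 (weightMeasure σ) →ₗ[ℂ] Lp ℂ 2 (weightMeasure w) :=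
    { toFun := fun f => (hmem f).toLp _
      map_add' := fun f g => by
        refine Lp.ext ?_
        filter_upwards [(hmem (f + g)).coeFn_toLp, (hmem f).coeFn_toLp, (hmem g).coeFn_toLp,
          Lp.coeFn_add ((hmem f).toLp _) ((hmem g).toLp _), hball] with z h1 h2 h3 h4 hz
        rw [h1, h4, Pi.add_apply, h2, h3, hσ.bergmanP_congr (Lp.coeFn_add f g),
          hσ.bergmanP_add hσfin (Lp.memLp f) (Lp.memLp g) hz]
      map_smul' := fun c f => by
        refine Lp.ext ?_
        filter_upwards [(hmem (c • f)).coeFn_toLp, (hmem f).coeFn_toLp,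
          Lp.coeFn_smul c ((hmem f).toLp _)] with z h1 h2 h3
        rw [h1, RingHom.id_apply, h3, Pi.smul_apply, h2, hσ.bergmanP_congr (Lp.coeFn_smul c f),
          bergmanP_smul, smul_eq_mul] }
  have hL : ∀ f, ‖L f‖ ≤ K.toReal * ‖f‖ := fun f => by
    have h := hbd f (Lp.memLp f)
    have h1 : ‖L f‖ = (eLpNorm (bergmanP fun ζ => (σ ζ : ℂ) * f ζ) 2 (weightMeasure w)).toReal :=
      Lp.norm_toLp _ (hmem f)
    rw [h1, Lp.norm_def, ← ENNReal.toReal_mul]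
    exact ENNReal.toReal_mono (ENNReal.mul_ne_top hK (Lp.memLp f).2.ne) h
  refine ⟨L.mkContinuous K.toReal hL, fun f => (hmem f).coeFn_toLp, ?_⟩
  rw [← ofReal_norm]
  exact (ENNReal.ofReal_le_ofReal (L.mkContinuous_norm_le ENNReal.toReal_nonneg hL)).trans_eq
    (ENNReal.ofReal_toReal hK)

end Projection

end

section

/-! ### Separated sets in the unit sphere -/

section Separated

variable {d : ℕ}

theorem measurableSet_region (u : Cd d) (h : ℝ) : MeasurableSet (region u h) := by
  refine Metric.isOpen_ball.measurableSet.inter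
    (isClosed_le ((continuous_const.sub ?_).norm) continuous_const).measurableSet
  exact continuous_herm_left u

theorem mem_region_sq {ζ u : Cd d} {t : ℝ} (ht : 0 ≤ t) :
    ζ ∈ region u (t ^ 2) ↔ ‖ζ‖ < 1 ∧ rho ζ u ≤ t := by
  rw [← pow_le_pow_iff_left₀ (rho_nonneg _ _) ht two_ne_zero, rho_sq, ← mem_unitBall]
  rfl

/-- A finite set of unit vectors with pairwise nonisotropic distances at least `t`. -/
def IsSep (t : ℝ) (X : Finset (Cd d)) : Prop :=
  (∀ x ∈ X, ‖x‖ = 1) ∧ ∀ x ∈ X, ∀ y ∈ X, x ≠ y → t ≤ rho x y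

theorem IsSep.mono {t : ℝ} {X Y : Finset (Cd d)} (hX : IsSep t X) (h : Y ⊆ X) : IsSep t Y :=
  ⟨fun x hx => hX.1 x (h hx), fun x hx y hy => hX.2 x (h hx) y (h hy)⟩

/-- The number of `t`-separated points in a ball of radius `K t` is bounded independently of `t`,
by comparison of volumes. -/
theorem exists_card_le (d : ℕ) {K : ℝ} (hK : 0 ≤ K) : ∃ N : ℕ, ∀ (t : ℝ) (u : Cd d)
    (X : Finset (Cd d)), 0 < t → t ≤ 3 → ‖u‖ = 1 → IsSep t X → (∀ x ∈ X, rho x u ≤ K * t) →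
      X.card ≤ N := by
  obtain ⟨C, hC, HC⟩ := exists_nu_region_le d
  obtain ⟨c, hc, Hc⟩ := exists_le_nu_region d
  obtain ⟨N, hN⟩ := exists_nat_ge (C * ((K + 1) ^ 2 * 9) ^ (d + 1) / c)
  refine ⟨N, fun t u X ht ht1 hu hX hXu => ?_⟩
  have hdisj : (X : Set (Cd d)).PairwiseDisjoint fun x => region x ((t / 3) ^ 2) := by
    intro x hx y hy hxy
    rw [Function.onFun, Set.disjoint_left]
    intro ζ h1 h2
    rw [mem_region_sq (by positivity)] at h1 h2
    have h3 := rho_triangle (hX.1 x hx).le (hX.1 y hy).le h1.1.le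
    have h4 := hX.2 x hx y hy hxy
    rw [rho_comm x ζ] at h3
    linarith [h1.2, h2.2]
  have hsub : ⋃ x ∈ X, region x ((t / 3) ^ 2) ⊆ region u (((K + 1) * t) ^ 2) := by
    refine Set.iUnion₂_subset fun x hx ζ hζ => ?_
    rw [mem_region_sq (by positivity)] at hζ ⊢
    refine ⟨hζ.1, ?_⟩
    have h3 := rho_triangle hζ.1.le hu.le (hX.1 x hx).le
    have h4 := hXu x hx
    linarith [hζ.2]
  have h1 : ENNReal.ofReal (X.card * (c * ((t / 3) ^ 2) ^ (d + 1))) ≤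
      ENNReal.ofReal (C * (((K + 1) * t) ^ 2) ^ (d + 1)) := by
    calc _ = ∑ _x ∈ X, ENNReal.ofReal (c * ((t / 3) ^ 2) ^ (d + 1)) := by
          rw [Finset.sum_const, nsmul_eq_mul, ENNReal.ofReal_mul (by positivity),
            ENNReal.ofReal_natCast]
      _ ≤ ∑ x ∈ X, nu d (region x ((t / 3) ^ 2)) :=
          Finset.sum_le_sum fun x hx => Hc x _ (hX.1 x hx) (by positivity) (by nlinarith)
      _ = nu d (⋃ x ∈ X, region x ((t / 3) ^ 2)) :=
          (measure_biUnion_finset hdisj fun x _ => measurableSet_region _ _).symm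
      _ ≤ _ := (measure_mono hsub).trans (HC u _ hu (by positivity))
  rw [ENNReal.ofReal_le_ofReal_iff (by positivity)] at h1
  have h2 : (((K + 1) * t) ^ 2) ^ (d + 1) =
      ((K + 1) ^ 2 * 9) ^ (d + 1) * ((t / 3) ^ 2) ^ (d + 1) := by
    rw [← mul_pow]; congr 1; ring
  rw [h2, ← mul_assoc, ← mul_assoc] at h1
  have h3 := le_of_mul_le_mul_right h1 (by positivity)
  rw [← le_div_iff₀ hc] at h3
  exact_mod_cast h3.trans hN

/-- Every separated set extends to a maximal one. -/
theorem IsSep.exists_superset {t : ℝ} (ht : 0 < t) (ht3 : t ≤ 3) {X : Finset (Cd d)}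
    (hX : IsSep t X) : ∃ Y, X ⊆ Y ∧ IsSep t Y ∧ ∀ u, ‖u‖ = 1 → ∃ y ∈ Y, rho u y < t := by
  classical
  obtain ⟨N, hN⟩ := exists_card_le d (K := 2 / t) (by positivity)
  have hbound : ∀ Y : Finset (Cd d), IsSep t Y → Y.card ≤ N := fun Y hY => by
    rcases Y.eq_empty_or_nonempty with rfl | ⟨y, hy⟩
    · simp
    · refine hN t y Y ht ht3 (hY.1 y hy) hY fun x hx => ?_
      rw [div_mul_cancel₀ _ ht.ne']
      exact rho_le_two (hY.1 x hx).le (hY.1 y hy).le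
  by_contra! H
  have : ∀ k : ℕ, ∃ Y, X ⊆ Y ∧ IsSep t Y ∧ k ≤ Y.card := fun k => by
    induction k with
    | zero => exact ⟨X, subset_rfl, hX, Nat.zero_le _⟩
    | succ k ih =>
      obtain ⟨Y, h1, h2, h3⟩ := ih
      obtain ⟨u, hu, hu'⟩ := H Y h1 h2
      have huY : u ∉ Y := fun h => by
        have := hu' u h
        rw [rho_self hu] at this
        linarith
      refine ⟨insert u Y, h1.trans (Finset.subset_insert _ _), ⟨?_, ?_⟩, ?_⟩
      · intro x hx
        rcases Finset.mem_insert.1 hx with rfl | hx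
        exacts [hu, h2.1 x hx]
      · intro x hx y hy hxy
        rcases Finset.mem_insert.1 hx with rfl | hx' <;>
          rcases Finset.mem_insert.1 hy with rfl | hy'
        · exact absurd rfl hxy
        · exact hu' y hy'
        · rw [rho_comm]; exact hu' x hx'
        · exact h2.2 x hx' y hy' hxy
      · rw [Finset.card_insert_of_notMem huY]; omega
  obtain ⟨Y, _, h2, h3⟩ := this (N + 1)
  have := hbound Y h2
  omega

/-- Greedy colouring of a finite set with a symmetric relation of bounded degree. -/
theorem exists_coloring {α : Type*} {r : α → α → Prop} (hr : ∀ x y, r x y → r y x) {N : ℕ}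
    (X : Finset α) (hX : ∀ x ∈ X, ∀ Y ⊆ X, (∀ y ∈ Y, r x y) → Y.card ≤ N) :
    ∃ col : α → Fin (N + 1), ∀ x ∈ X, ∀ y ∈ X, x ≠ y → r x y → col x ≠ col y := by
  classical
  induction X using Finset.induction_on with
  | empty => exact ⟨fun _ => 0, by simp⟩
  | insert a X ha ih =>
    obtain ⟨col, hcol⟩ := ih fun x hx Y hY =>
      hX x (Finset.mem_insert_of_mem hx) Y (hY.trans (Finset.subset_insert _ _))
    obtain ⟨k, hk⟩ : ∃ k, k ∉ (X.filter (r a)).image col := by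
      by_contra! H
      have h1 : (Finset.univ : Finset (Fin (N + 1))) ⊆ (X.filter (r a)).image col :=
        fun k _ => H k
      have h2 := (Finset.card_le_card h1).trans Finset.card_image_le
      have h3 := hX a (Finset.mem_insert_self _ _) (X.filter (r a))
        ((Finset.filter_subset _ _).trans (Finset.subset_insert _ _))
        fun y hy => (Finset.mem_filter.1 hy).2
      rw [Finset.card_univ, Fintype.card_fin] at h2
      omega
    have hk' : ∀ y ∈ X, r a y → col y ≠ k := fun y hy hay h =>
      hk (Finset.mem_image.2 ⟨y, Finset.mem_filter.2 ⟨hy, hay⟩, h⟩)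
    refine ⟨Function.update col a k, fun x hx y hy hxy hr' => ?_⟩
    rcases Finset.mem_insert.1 hx with rfl | hx' <;>
      rcases Finset.mem_insert.1 hy with rfl | hy'
    · exact absurd rfl hxy
    · rw [Function.update_self, Function.update_of_ne (Ne.symm hxy)]
      exact (hk' y hy' hr').symm
    · rw [Function.update_self, Function.update_of_ne hxy]
      exact hk' x hx' (hr _ _ hr')
    · rw [Function.update_of_ne (by rintro rfl; exact ha hx'),
        Function.update_of_ne (by rintro rfl; exact ha hy')]
      exact hcol x hx' y hy' hxy hr'

/-- A Borel partition of the unit sphere into nonisotropic Voronoi cells, ties being broken by the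
index. Given separated points are among the centres. -/
theorem IsSep.exists_cells {t : ℝ} (ht : 0 < t) (ht3 : t ≤ 3) {X : Finset (Cd d)}
    (hX : IsSep t X) : ∃ (m : ℕ) (y : Fin m → Cd d) (V : Fin m → Set (Cd d)),
      (∀ j, ‖y j‖ = 1) ∧ (∀ x ∈ X, ∃ j, y j = x) ∧ (∀ j, MeasurableSet (V j)) ∧
      (∀ i j η, η ∈ V i → η ∈ V j → i = j) ∧ (∀ η, ‖η‖ = 1 → ∃ j, η ∈ V j) ∧
      (∀ j η, ‖η‖ = 1 → rho η (y j) < t / 2 → η ∈ V j) ∧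
      ∀ j, ∀ η ∈ V j, ‖η‖ = 1 ∧ rho η (y j) < t := by
  obtain ⟨Y, hXY, hY, hcov⟩ := hX.exists_superset ht ht3
  let e := Y.equivFin
  let y : Fin Y.card → Cd d := fun j => e.symm j
  have hy : ∀ j, y j ∈ Y := fun j => (e.symm j).2
  have hyu : ∀ j, ‖y j‖ = 1 := fun j => hY.1 _ (hy j)
  have hyinj : Function.Injective y := Subtype.val_injective.comp e.symm.injective
  have hsurj : ∀ x ∈ Y, ∃ j, y j = x := fun x hx => ⟨e ⟨x, hx⟩, by simp [y]⟩
  have hcont : ∀ j, Measurable fun η : Cd d => rho η (y j) := fun j =>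
    (continuous_rho_left _).measurable
  let V : Fin Y.card → Set (Cd d) := fun j =>
    {η | ‖η‖ = 1} ∩ ((⋂ i, {η | rho η (y j) ≤ rho η (y i)}) ∩
      ⋂ i, ⋂ _ : i < j, {η | rho η (y j) < rho η (y i)})
  have hV : ∀ j η, η ∈ V j ↔ ‖η‖ = 1 ∧ (∀ i, rho η (y j) ≤ rho η (y i)) ∧
      ∀ i, i < j → rho η (y j) < rho η (y i) := fun j η => by
    simp only [V, Set.mem_inter_iff, Set.mem_iInter, Set.mem_ofPred_eq]
  refine ⟨Y.card, y, V, hyu, fun x hx => hsurj x (hXY hx), fun j => ?_, ?_, ?_, ?_, ?_⟩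
  · refine (measurableSet_eq_fun measurable_norm measurable_const).inter
      ((MeasurableSet.iInter fun i => measurableSet_le (hcont j) (hcont i)).inter
        (MeasurableSet.iInter fun i => MeasurableSet.iInter fun _ =>
          measurableSet_lt (hcont j) (hcont i)))
  · intro i j η hi hj
    rw [hV] at hi hj
    rcases lt_trichotomy i j with h | h | h
    · exact absurd (hj.2.2 i h) (hi.2.1 j).not_gt
    · exact h
    · exact absurd (hi.2.2 j h) (hj.2.1 i).not_gt
  · intro η hη
    obtain ⟨x, hx, _⟩ := hcov η hη
    have hne : (Finset.univ : Finset (Fin Y.card)).Nonempty :=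
      ⟨(hsurj x hx).choose, Finset.mem_univ _⟩
    obtain ⟨j, _, hj⟩ := Finset.exists_min_image Finset.univ
      (fun j => toLex (rho η (y j), j)) hne
    have hj' := fun i => Prod.Lex.toLex_le_toLex.1 (hj i (Finset.mem_univ _))
    refine ⟨j, (hV j η).2 ⟨hη, fun i => ?_, fun i hij => ?_⟩⟩
    · rcases hj' i with h | h
      exacts [h.le, h.1.le]
    · rcases hj' i with h | h
      exacts [h, absurd h.2 hij.not_ge]
  · intro j η hη h
    have key : ∀ i, i ≠ j → rho η (y j) < rho η (y i) := fun i hij => by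
      have h1 := hY.2 _ (hy j) _ (hy i) (hyinj.ne hij.symm)
      have h2 := rho_triangle (hyu j).le (hyu i).le hη.le
      rw [rho_comm (y j) η] at h2
      linarith
    refine (hV j η).2 ⟨hη, fun i => ?_, fun i hij => key i hij.ne⟩
    rcases eq_or_ne i j with rfl | hij
    exacts [le_rfl, (key i hij).le]
  · intro j η h
    rw [hV] at h
    obtain ⟨x, hx, hlt⟩ := hcov η h.1
    obtain ⟨i, rfl⟩ := hsurj x hx
    exact ⟨h.1, (h.2.1 i).trans_lt hlt⟩

end Separated

end

section

/-! ### Existence of admissible collections -/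

section Existence

variable {d : ℕ}

theorem exp_neg_three_le : Real.exp (-3) ≤ 1 / 16 := by
  have h := Real.exp_one_gt_d9
  have h1 : Real.exp 3 = Real.exp 1 ^ 3 := by rw [← Real.exp_nat_mul]; norm_num
  rw [Real.exp_neg, ← one_div]
  apply one_div_le_one_div_of_le (by norm_num)
  rw [h1]
  calc (16 : ℝ) ≤ 2.7 ^ 3 := by norm_num
    _ ≤ _ := by gcongr; linarith

theorem scale_three_succ_le (n : ℕ) : scale 3 (n + 1) ≤ 1 / 16 * scale 3 n := by
  rw [scale_succ]
  exact mul_le_mul_of_nonneg_right exp_neg_three_le (scale_pos 3 n).le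

theorem scale_three_le {n : ℕ} (hn : n ≠ 0) : scale 3 n ≤ 1 / 16 := by
  obtain ⟨m, rfl⟩ := Nat.exists_eq_succ_of_ne_zero hn
  have h1 := scale_three_succ_le m
  have h2 := scale_anti (R := 3) (by norm_num) (Nat.zero_le m)
  rw [scale_zero] at h2
  exact h1.trans (by linarith)

/-- One generation of a Bergman tree with parameters `R = 3`, `δ = 1`: radial images of nonisotropic
Voronoi cells. On the sphere of that generation, a Bergman ball of radius `1` has nonisotropic
radius less than `10 e^{-3n}`, and a Bergman ball of radius `D` contains the nonisotropic ball of
radius `20 e^{-3n}`. -/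
theorem IsSep.exists_level {D : ℝ} (hD : 0 < D) (hcosh : Real.cosh D = 500) {n : ℕ} (hn : n ≠ 0)
    {X : Finset (Cd d)} (hX : IsSep (20 * scale 3 n) X) :
    ∃ (m : ℕ) (y : Fin m → Cd d) (Om : Fin m → Set (Cd d)),
      (∀ j, ‖y j‖ = 1) ∧ (∀ j, MeasurableSet (Om j)) ∧
      (∀ i j, i ≠ j → Disjoint (Om i) (Om j)) ∧ ⋃ j, Om j = bSphere d (n * 3) ∧
      (∀ j, bBall ((Real.tanh (n * 3) : ℂ) • y j) 1 ∩ bSphere d (n * 3) ⊆ Om j) ∧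
      (∀ j, Om j ⊆ bBall ((Real.tanh (n * 3) : ℂ) • y j) (D * 1) ∩ bSphere d (n * 3)) ∧
      (∀ x ∈ X, ∃ j, y j = x) ∧
      (∀ j η, ‖η‖ = 1 → rho η (y j) < 10 * scale 3 n → (Real.tanh (n * 3) : ℂ) • η ∈ Om j) ∧
      ∀ j η, ‖η‖ = 1 → (Real.tanh (n * 3) : ℂ) • η ∈ Om j → rho η (y j) < 20 * scale 3 n := by
  have hs := scale_pos 3 n
  have hs1 := scale_three_le hn
  obtain ⟨m, y, V, hy, hXy, hmeas, huniq, hcov, hin, hout⟩ :=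
    hX.exists_cells (by positivity) (by linarith)
  have hr0 : 0 < Real.tanh (n * 3) := by
    have : (0 : ℝ) < n := by exact_mod_cast Nat.pos_of_ne_zero hn
    exact tanh_pos (by positivity)
  have hle : 1 - Real.tanh (n * 3) ^ 2 ≤ 4 * scale 3 n ^ 2 := one_sub_tanh_sq_le _
  have hge : scale 3 n ^ 2 ≤ 1 - Real.tanh (n * 3) ^ 2 := by
    have := exp_neg_sq_le_one_sub_tanh_sq (n * 3)
    rwa [abs_of_nonneg (by positivity)] at this
  have hpolar : ∀ ζ ∈ bSphere d (n * 3),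
      ‖unitVec ζ‖ = 1 ∧ ζ = (Real.tanh (n * 3) : ℂ) • unitVec ζ := fun ζ hζ => by
    rw [mem_bSphere] at hζ
    have h0 : ζ ≠ 0 := fun h => by rw [h, norm_zero] at hζ; linarith
    exact ⟨norm_unitVec h0, by rw [← hζ, norm_smul_unitVec]⟩
  have hsph : ∀ η : Cd d, ‖η‖ = 1 →
      (Real.tanh (n * 3) : ℂ) • η ∈ bSphere d (n * 3) := fun η hη => by
    rw [mem_bSphere, norm_smul, hη, mul_one, Complex.norm_real, Real.norm_of_nonneg hr0.le]
  have hmem : ∀ j η, ‖η‖ = 1 → ((Real.tanh (n * 3) : ℂ) • η ∈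
      bSphere d (n * 3) ∩ unitVec ⁻¹' V j ↔ η ∈ V j) := fun j η hη => by
    rw [Set.mem_inter_iff, Set.mem_preimage, unitVec_smul hη hr0, and_iff_right (hsph η hη)]
  refine ⟨m, y, fun j => bSphere d (n * 3) ∩ unitVec ⁻¹' V j, hy, fun j => ?_, fun i j hij => ?_,
    ?_, fun j ζ hζ => ?_, fun j ζ hζ => ?_, hXy, fun j η hη h => ?_, fun j η hη h => ?_⟩
  · refine MeasurableSet.inter ?_ (measurable_unitVec (hmeas j))
    have : bSphere d (n * 3) = {ζ | ‖ζ‖ = Real.tanh (n * 3)} := by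
      ext ζ; exact mem_bSphere
    rw [this]
    exact measurableSet_eq_fun measurable_norm measurable_const
  · rw [Set.disjoint_left]
    exact fun ζ h1 h2 => hij (huniq i j _ h1.2 h2.2)
  · refine (Set.iUnion_subset fun j => Set.inter_subset_left).antisymm fun ζ hζ => ?_
    obtain ⟨j, hj⟩ := hcov _ (hpolar ζ hζ).1
    exact Set.mem_iUnion.2 ⟨j, hζ, hj⟩
  · obtain ⟨h1, h2⟩ := hpolar ζ hζ.2
    refine ⟨hζ.2, hin j _ h1 ?_⟩
    have h3 := hζ.1
    rw [h2] at h3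
    have h4 := rho_sq_lt_of_smul_mem_bBall one_pos (hy j) h1 h3
    have h5 : Real.cosh 1 ≤ 3 := by
      have h6 := Real.cosh_le_exp_half_sq 1
      have h7 : Real.exp (1 ^ 2 / 2) ≤ Real.exp 1 := Real.exp_le_exp.2 (by norm_num)
      have h8 := Real.exp_one_lt_d9
      linarith
    refine lt_of_pow_lt_pow_left₀ 2 (by positivity) ?_
    have h6 : Real.cosh 1 * (1 - Real.tanh (n * 3) ^ 2) ≤ 3 * (4 * scale 3 n ^ 2) := by
      have : 0 ≤ 1 - Real.tanh (n * 3) ^ 2 := (sq_nonneg _).trans hge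
      gcongr
    have h7 : 1 / 2 ≤ Real.tanh (n * 3) ^ 2 := by nlinarith
    have h8 : 1 / 2 * rho (unitVec ζ) (y j) ^ 2 ≤
        Real.tanh (n * 3) ^ 2 * rho (unitVec ζ) (y j) ^ 2 := by gcongr
    nlinarith [sq_nonneg (scale 3 n), pow_pos hs 2]
  · obtain ⟨h1, h2⟩ := hpolar ζ hζ.1
    refine ⟨?_, hζ.1⟩
    rw [h2]
    refine smul_mem_bBall_of_rho_lt (by linarith) (hy j) h1 ?_
    have h3 := (hout j _ hζ.2).2
    have h4 : rho (unitVec ζ) (y j) ^ 2 < (20 * scale 3 n) ^ 2 :=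
      pow_lt_pow_left₀ h3 (rho_nonneg _ _) two_ne_zero
    rw [mul_one, hcosh]
    nlinarith
  · exact (hmem j η hη).2 (hin j η hη (by linarith))
  · exact (hout j η ((hmem j η hη).1 h)).2

namespace BergmanTree

/-- Bergman trees with prescribed separated families of centres. -/
theorem exists_dir_eq (hd : 0 < d) (X : ℕ → Finset (Cd d))
    (hX : ∀ n, n ≠ 0 → IsSep (20 * scale 3 n) (X n)) : ∃ T : BergmanTree d 3 1,
      (∀ n, n ≠ 0 → ∀ x ∈ X n, ∃ α : T.Vertex, α.1 = n ∧ T.dir hd α = x) ∧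
      ∀ α : T.Vertex, α.1 ≠ 0 → ∀ η, ‖η‖ = 1 →
        (rho η (T.dir hd α) < 10 * scale 3 α.1 →
          (Real.tanh (α.1 * 3) : ℂ) • η ∈ T.Om α.1 α.2) ∧
        ((Real.tanh (α.1 * 3) : ℂ) • η ∈ T.Om α.1 α.2 →
          rho η (T.dir hd α) < 20 * scale 3 α.1) := by
  obtain ⟨D, hD0, hD⟩ := Real.cosh_surjOn (show (500 : ℝ) ∈ Set.Ici 1 by norm_num [Set.mem_Ici])
  replace hD0 : 0 < D := lt_of_le_of_ne hD0 (by rintro rfl; norm_num at hD)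
  have key : ∀ n : ℕ, ∃ (m : ℕ) (y : Fin m → Cd d) (Om : Fin m → Set (Cd d)),
      (∀ j, ‖y j‖ = 1) ∧ (∀ j, MeasurableSet (Om j)) ∧
      (∀ i j, i ≠ j → Disjoint (Om i) (Om j)) ∧ ⋃ j, Om j = bSphere d (n * 3) ∧
      (∀ j, bBall ((Real.tanh (n * 3) : ℂ) • y j) 1 ∩ bSphere d (n * 3) ⊆ Om j) ∧
      (∀ j, Om j ⊆ bBall ((Real.tanh (n * 3) : ℂ) • y j) (D * 1) ∩ bSphere d (n * 3)) ∧
      (n ≠ 0 → (∀ x ∈ X n, ∃ j, y j = x) ∧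
      (∀ j η, ‖η‖ = 1 → rho η (y j) < 10 * scale 3 n → (Real.tanh (n * 3) : ℂ) • η ∈ Om j) ∧
      ∀ j η, ‖η‖ = 1 → (Real.tanh (n * 3) : ℂ) • η ∈ Om j → rho η (y j) < 20 * scale 3 n) := by
    intro n
    rcases eq_or_ne n 0 with rfl | hn
    · have h0 : bSphere d ((0 : ℕ) * 3) = {0} := by
        ext ζ; rw [mem_bSphere]; simp
      refine ⟨1, fun _ => EuclideanSpace.single ⟨0, hd⟩ 1, fun _ => {0}, by simp, by simp,
        fun i j hij => absurd (Subsingleton.elim i j) hij, ?_, ?_, ?_, fun h => absurd rfl h⟩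
      · rw [h0]; simp
      · rw [h0]; exact fun _ => Set.inter_subset_right
      · rw [h0]
        rintro _ ζ rfl
        refine ⟨?_, rfl⟩
        simp only [Nat.cast_zero, zero_mul, Real.tanh_zero, Complex.ofReal_zero, zero_smul, mul_one]
        rw [mem_bBall_zero, norm_zero]
        exact tanh_pos hD0
    · obtain ⟨m, y, Om, h1, h2, h3, h4, h5, h6, h7⟩ := (hX n hn).exists_level hD0 hD hn
      exact ⟨m, y, Om, h1, h2, h3, h4, h5, h6, fun _ => h7⟩
  choose J y Om h1 h2 h3 h4 h5 h6 h7 using key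
  let T : BergmanTree d 3 1 :=
    { J := J
      C := D
      pt := fun n j => (Real.tanh (n * 3) : ℂ) • y n j
      Om := Om
      pt_mem := fun n j => by
        rw [mem_bSphere, norm_smul, h1, mul_one, Complex.norm_real,
          Real.norm_of_nonneg (tanh_nonneg (by positivity))]
      measurable_Om := h2
      disjoint_Om := h3
      iUnion_Om := h4
      ball_subset := h5
      subset_ball := h6 }
  have hdir : ∀ (n : ℕ) (j : Fin (J n)), n ≠ 0 → T.dir hd ⟨n, j⟩ = y n j := fun n j hn => by
    have hr : 0 < Real.tanh (n * 3) := by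
      have : (0 : ℝ) < n := by exact_mod_cast Nat.pos_of_ne_zero hn
      exact tanh_pos (by positivity)
    have h : (Real.tanh (n * 3) : ℂ) • y n j = (Real.tanh (n * 3) : ℂ) • T.dir hd ⟨n, j⟩ :=
      T.pt_eq hd ⟨n, j⟩
    exact (smul_right_injective _ (Complex.ofReal_ne_zero.2 hr.ne') h).symm
  refine ⟨T, fun n hn x hx => ?_, ?_⟩
  · obtain ⟨j, hj⟩ := (h7 n hn).1 x hx
    exact ⟨⟨n, j⟩, rfl, (hdir n j hn).trans hj⟩
  · rintro ⟨n, j⟩ hn η hη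
    rw [hdir n j hn]
    exact ⟨(h7 n hn).2.1 j η hη, (h7 n hn).2.2 j η hη⟩

/-- A Carleson tent of height comparable to `e^{-6n}` lies in a dyadic tent of generation `n` if its
axis is close to the centre of that tent: the branches of all kubes it meets pass near this
centre. -/
theorem region_subset_tent (hd : 0 < d) (T : BergmanTree d 3 1)
    (hT : ∀ α : T.Vertex, α.1 ≠ 0 → ∀ η, ‖η‖ = 1 →
        (rho η (T.dir hd α) < 10 * scale 3 α.1 →
          (Real.tanh (α.1 * 3) : ℂ) • η ∈ T.Om α.1 α.2) ∧
        ((Real.tanh (α.1 * 3) : ℂ) • η ∈ T.Om α.1 α.2 →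
          rho η (T.dir hd α) < 20 * scale 3 α.1))
    {α : T.Vertex} (hα : α.1 ≠ 0) {u : Cd d} (hu : ‖u‖ = 1)
    (hαu : rho u (T.dir hd α) < 5 * scale 3 α.1) : region u (scale 3 α.1 ^ 2) ⊆ T.tent α := by
  intro ζ hζ
  have hs := scale_pos 3 α.1
  rw [mem_region_sq hs.le] at hζ
  obtain ⟨hζ1, hζu⟩ := hζ
  have hζn : 1 - scale 3 α.1 ^ 2 ≤ ‖ζ‖ := by
    have h1 : 1 - ‖herm ζ u‖ ≤ ‖1 - herm ζ u‖ := by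
      have := norm_sub_norm_le (1 : ℂ) (herm ζ u); simpa using this
    have h2 := norm_herm_le ζ u
    have h3 : rho ζ u ^ 2 ≤ scale 3 α.1 ^ 2 := pow_le_pow_left₀ (rho_nonneg _ _) hζu 2
    rw [rho_sq] at h3
    rw [hu, mul_one] at h2
    linarith
  have hlev : Real.tanh (α.1 * 3) ≤ ‖ζ‖ := by
    have h : scale 3 α.1 ^ 2 ≤ 1 - Real.tanh (α.1 * 3) :=
      exp_neg_sq_le_one_sub_tanh (x := α.1 * 3) (by positivity)
    linarith
  have hζ0 : ζ ≠ 0 := by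
    rintro rfl
    have h := scale_three_le hα
    rw [norm_zero] at hζn
    nlinarith
  have hη := norm_unitVec hζ0
  have hηζ : rho ζ (unitVec ζ) ≤ scale 3 α.1 := by
    refine le_of_sq_le_sq ?_ hs.le
    rw [rho_sq, herm_self_unitVec hζ0, ← Complex.ofReal_one, ← Complex.ofReal_sub,
      Complex.norm_real, Real.norm_of_nonneg (by linarith)]
    linarith
  have hηα : rho (unitVec ζ) (T.dir hd α) < 7 * scale 3 α.1 := by
    have h1 := rho_triangle hη.le hu.le hζ1.le
    have h2 := rho_triangle hη.le (T.norm_dir hd α).le hu.le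
    rw [rho_comm (unitVec ζ) ζ] at h1
    linarith
  obtain ⟨β, hβ⟩ := T.exists_mem_kube (by norm_num) hζ1
  obtain ⟨hβ1, hβ2, hβ3⟩ := T.mem_kube.1 hβ
  replace hβ3 : (Real.tanh (β.1 * 3) : ℂ) • unitVec ζ ∈ T.Om β.1 β.2 := hβ3
  have hle : α.1 ≤ β.1 := by
    have h := tanh_strictMono.lt_iff_lt.1 (hlev.trans_lt hβ2)
    have h' : (α.1 : ℝ) < β.1 + 1 := by linarith
    exact Nat.lt_succ_iff.1 (by exact_mod_cast h')
  refine T.mem_tent.2 ⟨β, ?_, hβ⟩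
  rcases hle.eq_or_lt with h | h
  · have h1 := (hT α hα _ hη).1 (by linarith)
    obtain ⟨n, i⟩ := α
    obtain ⟨m, j⟩ := β
    simp only at h
    subst h
    obtain rfl := T.eq_of_mem_Om h1 hβ3
    exact le_rfl
  · obtain ⟨γ, hγ, hβγ⟩ := T.exists_ancestor hd (by norm_num) β (α.1 + 1) h
    have hq := exp_neg_three_le
    have h1 := T.rho_dir_le_of_le hd (by norm_num) (K := 20) (m := 1)
      (fun α η hα hη h => ((hT α (by omega) η hη).2 h).le) (α := γ) (by omega) hβγ
    have h2 := (hT β (by omega) _ hη).2 hβ3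
    have h3 : 20 / (1 - Real.exp (-3)) ≤ 22 := by
      rw [div_le_iff₀ (by linarith)]; linarith
    have h4 : scale 3 β.1 ≤ scale 3 γ.1 := scale_anti (by norm_num) (T.le_def.1 hβγ).level_le
    have h5 : rho (T.dir hd β) (T.dir hd γ) ≤ 22 * (scale 3 γ.1 - scale 3 β.1) :=
      h1.trans (mul_le_mul_of_nonneg_right h3 (by linarith))
    have h6 : scale 3 γ.1 ≤ 1 / 16 * scale 3 α.1 := hγ ▸ scale_three_succ_le α.1
    have h7 := rho_triangle (T.norm_dir hd γ).le hη.le (T.norm_dir hd β).le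
    have h8 := rho_triangle (T.norm_dir hd γ).le (T.norm_dir hd α).le hη.le
    rw [rho_comm (T.dir hd γ) (T.dir hd β), rho_comm (T.dir hd β) (unitVec ζ)] at h7
    have hsβ := scale_pos 3 β.1
    -- the distance is at most `7 + 22 / 16 < 10` in units of `scale 3 α.1`
    have h9 := (hT α hα _ (T.norm_dir hd γ)).1 (by linarith)
    refine hβγ.trans (T.le_def.2 (Relation.ReflTransGen.single ⟨hγ, ?_⟩))
    rwa [T.radialProj_center hd (by norm_num) (by omega)]

end BergmanTree

theorem exists_scale_sq_lt {h : ℝ} (h0 : 0 < h) (h1 : h ≤ 1) :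
    ∃ n, scale 3 (n + 1) ^ 2 < h ∧ h ≤ scale 3 n ^ 2 := by
  classical
  have hex : ∃ n, scale 3 (n + 1) ^ 2 < h := by
    obtain ⟨n, hn⟩ := exists_nat_gt (-Real.log h)
    refine ⟨n, ?_⟩
    rw [scale, ← Real.exp_nat_mul, ← Real.lt_log_iff_exp_lt h0]
    push_cast
    have : (0 : ℝ) ≤ n := n.cast_nonneg
    linarith
  refine ⟨Nat.find hex, Nat.find_spec hex, ?_⟩
  rcases hn : Nat.find hex with _ | m
  · rw [scale_zero]; simpa using h1
  · exact not_lt.1 (Nat.find_min hex (m := m) (by omega))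

theorem exists_le_nu_carlesonTent (hd : 0 < d) : ∃ c : ℝ, 0 < c ∧ ∀ z ∈ unitBall d,
    ENNReal.ofReal (c * (1 - ‖z‖) ^ (d + 1)) ≤ nu d (carlesonTent z) := by
  obtain ⟨c, hc, H⟩ := exists_le_nu_region d
  refine ⟨c, hc, fun z hz => ?_⟩
  rw [mem_unitBall] at hz
  have h1 := norm_nonneg z
  by_cases h0 : z = 0
  · rw [carlesonTent, if_pos h0]
    exact (H (EuclideanSpace.single ⟨0, hd⟩ 1) _ (by simp) (by linarith) (by linarith)).trans
      (measure_mono (region_subset _ _))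
  · rw [carlesonTent, if_neg h0]
    exact H _ _ (norm_unitVec h0) (by linarith) (by linarith)

/-- Maximal separated sets of axes are distributed over finitely many trees by a colouring, so that
the centres used in one tree are separated enough to be prescribed. -/
theorem exists_admissible (hd : 0 < d) :
    ∃ (N : ℕ) (T : Fin N → BergmanTree d 3 1), Admissible T := by
  obtain ⟨N, hN⟩ := exists_card_le d (K := 4) (by norm_num)
  have hnet : ∀ n : ℕ, ∃ (X : Finset (Cd d)) (col : Cd d → Fin (N + 1)), n ≠ 0 →
      IsSep (5 * scale 3 n) X ∧ (∀ u, ‖u‖ = 1 → ∃ x ∈ X, rho u x < 5 * scale 3 n) ∧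
      ∀ x ∈ X, ∀ y ∈ X, x ≠ y → rho x y ≤ 4 * (5 * scale 3 n) → col x ≠ col y := by
    intro n
    rcases eq_or_ne n 0 with rfl | hn
    · exact ⟨∅, fun _ => 0, fun h => absurd rfl h⟩
    have hs := scale_pos 3 n
    have hs1 := scale_three_le hn
    obtain ⟨X, _, h1, h2⟩ := IsSep.exists_superset (d := d) (t := 5 * scale 3 n) (X := ∅)
      (by positivity) (by linarith) ⟨by simp, by simp⟩
    obtain ⟨col, hcol⟩ := exists_coloring (r := fun x y => rho y x ≤ 4 * (5 * scale 3 n))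
      (fun x y h => by rwa [rho_comm]) X fun x hx Y hY h =>
        hN _ x Y (by positivity) (by linarith) (h1.1 x hx) (h1.mono hY) h
    exact ⟨X, col, fun _ => ⟨h1, h2, fun x hx y hy hxy h => hcol x hx y hy hxy (by rwa [rho_comm])⟩⟩
  choose X col hX using hnet
  have htree := fun ℓ : Fin (N + 1) =>
    BergmanTree.exists_dir_eq hd (fun n => (X n).filter (fun x => col n x = ℓ)) fun n hn =>
      ⟨fun x hx => (hX n hn).1.1 x (Finset.mem_filter.1 hx).1, fun x hx y hy hxy => by
        rw [Finset.mem_filter] at hx hy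
        by_contra! h
        exact (hX n hn).2.2 x hx.1 y hy.1 hxy (by linarith) (hx.2.trans hy.2.symm)⟩
  choose T hT1 hT2 using htree
  choose c₀ C₀ hc₀ hC₀ hvol using fun ℓ =>
    (T ℓ).exists_nu_kube_tent_bounds hd (by norm_num) one_pos
  obtain ⟨c, hc, Hc⟩ := exists_le_nu_carlesonTent hd
  have hq : 0 < Real.exp (-3) := Real.exp_pos _
  set C := ∑ ℓ, C₀ ℓ with hC
  have hCpos : 0 ≤ C := Finset.sum_nonneg fun ℓ _ => (hC₀ ℓ).le
  refine ⟨N + 1, T, (C / (c * (Real.exp (-3) ^ 2) ^ (d + 1))).toNNReal, fun z hz => ?_⟩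
  have hz' := mem_unitBall.1 hz
  have hzn := norm_nonneg z
  obtain ⟨n, hn1, hn2⟩ := exists_scale_sq_lt (h := 1 - ‖z‖) (by linarith) (by linarith)
  obtain ⟨ℓ, α, hα, hsub⟩ : ∃ ℓ, ∃ α : (T ℓ).Vertex, α.1 = n ∧ carlesonTent z ⊆ (T ℓ).tent α := by
    rcases eq_or_ne n 0 with rfl | hn
    · obtain ⟨j, -⟩ := (T 0).exists_mem_Om (n := 0) (x := 0) (by simp)
      obtain ⟨α, hα⟩ : ∃ α : (T 0).Vertex, α.1 = 0 := ⟨⟨0, j⟩, rfl⟩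
      refine ⟨0, α, hα, ?_⟩
      rw [(T 0).tent_eq_unitBall hd (by norm_num) one_pos hα, carlesonTent]
      split_ifs
      exacts [subset_rfl, fun ζ hζ => hζ.1]
    · have hz0 : z ≠ 0 := by
        rintro rfl
        have h1 := scale_three_le hn
        have h2 := scale_pos 3 n
        rw [norm_zero] at hn2
        nlinarith
      obtain ⟨x, hx, hux⟩ := (hX n hn).2.1 _ (norm_unitVec hz0)
      obtain ⟨α, hα, hαx⟩ := hT1 (col n x) n hn x (Finset.mem_filter.2 ⟨hx, rfl⟩)
      refine ⟨col n x, α, hα, ?_⟩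
      rw [← hα] at hn hn2 hux
      refine subset_trans ?_ ((T _).region_subset_tent hd (hT2 _) hn (norm_unitVec hz0)
        (by rwa [hαx]))
      rw [carlesonTent, if_neg hz0]
      exact fun ζ hζ => ⟨hζ.1, hζ.2.trans hn2⟩
  refine ⟨_, ⟨ℓ, α, rfl⟩, hsub, ?_⟩
  have hCℓ : C₀ ℓ ≤ C := Finset.single_le_sum (fun ℓ _ => (hC₀ ℓ).le) (Finset.mem_univ ℓ)
  calc _ ≤ ENNReal.ofReal (C₀ ℓ * (scale 3 α.1 ^ 2) ^ (d + 1)) := (hvol ℓ α).2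
    _ ≤ ENNReal.ofReal (C / (c * (Real.exp (-3) ^ 2) ^ (d + 1)) * (c * (1 - ‖z‖) ^ (d + 1))) := by
      apply ENNReal.ofReal_le_ofReal
      rw [hα]
      have h1 : (Real.exp (-3) ^ 2) ^ (d + 1) * (scale 3 n ^ 2) ^ (d + 1) ≤
          (1 - ‖z‖) ^ (d + 1) := by
        rw [← mul_pow, ← mul_pow, ← scale_succ]
        have := scale_pos 3 (n + 1)
        gcongr
      calc C₀ ℓ * (scale 3 n ^ 2) ^ (d + 1) ≤ C * (scale 3 n ^ 2) ^ (d + 1) := by gcongr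
        _ = C / (c * (Real.exp (-3) ^ 2) ^ (d + 1)) *
            (c * ((Real.exp (-3) ^ 2) ^ (d + 1) * (scale 3 n ^ 2) ^ (d + 1))) := by field_simp
        _ ≤ _ := by gcongr
    _ = (C / (c * (Real.exp (-3) ^ 2) ^ (d + 1))).toNNReal *
        ENNReal.ofReal (c * (1 - ‖z‖) ^ (d + 1)) := ENNReal.ofReal_mul (by positivity)
    _ ≤ _ := by gcongr; exact Hc z hz

end Existence

end

end BergmanBall

end

theorem theorem1 (d : ℕ) (hd : 0 < d) :
    (∃ R : ℝ, 0 < R ∧ ∃ δ : ℝ, 0 < δ ∧ ∃ N : ℕ, ∃ T : Fin N → BergmanBall.BergmanTree d R δ,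
      BergmanBall.Admissible T) ∧
    ∀ (R δ : ℝ), 0 < R → 0 < δ → ∀ (N : ℕ) (T : Fin N → BergmanBall.BergmanTree d R δ),
      BergmanBall.Admissible T →
      ∃ C : ℝ≥0, 0 < C ∧ ∀ σ w : BergmanBall.Cd d → ℝ,
        BergmanBall.IsWeight σ → BergmanBall.IsWeight w →
        BergmanBall.charBinf (BergmanBall.tents T) σ < ∞ →
        BergmanBall.charBinf (BergmanBall.tents T) w < ∞ →
        BergmanBall.jointBp (BergmanBall.tents T) 2 w σ < ∞ →
        (∀ f : BergmanBall.Cd d → ℂ, MemLp f 2 (BergmanBall.weightMeasure σ) →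
          ∀ z ∈ BergmanBall.unitBall d,
            Integrable (BergmanBall.bergmanIntegrand (fun ζ => (σ ζ : ℂ) * f ζ) z)
              (BergmanBall.nu d)) ∧
        ∃ S : Lp ℂ 2 (BergmanBall.weightMeasure σ) →L[ℂ] Lp ℂ 2 (BergmanBall.weightMeasure w),
          (∀ f : Lp ℂ 2 (BergmanBall.weightMeasure σ),
            ∀ᵐ z ∂(BergmanBall.weightMeasure w),
              S f z = BergmanBall.bergmanP (fun ζ => (σ ζ : ℂ) * f ζ) z) ∧
          ‖S‖ₑ ≤ (C : ℝ≥0∞) * BergmanBall.jointBp (BergmanBall.tents T) 2 w σ ^ (1 / 2 : ℝ) *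
            (BergmanBall.charBinf (BergmanBall.tents T) w ^ (1 / 2 : ℝ) +
              BergmanBall.charBinf (BergmanBall.tents T) σ ^ (1 / 2 : ℝ)) := by
  refine ⟨⟨3, by norm_num, 1, one_pos, BergmanBall.exists_admissible hd⟩, ?_⟩
  intro R δ hR hδ N T hT
  obtain ⟨C, hC, H⟩ := BergmanBall.exists_eLpNorm_bergmanP_le hd hR hδ hT
  refine ⟨C, hC, fun σ w hσ hw hBσ hBw hJ => ?_⟩
  obtain ⟨hσfin, hwfin⟩ := BergmanBall.weightMeasure_univ_ne_top hd hR hδ hT hσ hw hJ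
  refine ⟨fun f hf z hz => hσ.integrable_bergmanIntegrand hσfin hf hz,
    hσ.exists_clm hσfin hwfin ?_ (H σ w hσ hw hBσ hBw hJ)⟩
  have hroot : ∀ {x : ℝ≥0∞}, x < ∞ → x ^ (1 / 2 : ℝ) ≠ ∞ := fun h =>
    ENNReal.rpow_ne_top_of_nonneg (by norm_num) h.ne
  exact ENNReal.mul_ne_top (ENNReal.mul_ne_top ENNReal.coe_ne_top (hroot hJ))
    (ENNReal.add_ne_top.2 ⟨hroot hBw, hroot hBσ⟩)
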